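/- **Conventions.** Let $k$ be a field. A *finite embedding problem over $k$* is a surjective homomorphism $\alpha : G \to \mathrm{Aut}(L/k)$, where $G$ is a finite group and $L/k$ is a finite separable (not necessarily normal) extension. A *solution* to $\alpha$ is an isomorphism $\beta : \mathrm{Aut}(E/k) \to G$, where $E/k$ is a finite separable extension with $L \subseteq E$, such that every $\sigma \in \mathrm{Aut}(E/k)$ maps $L$ into itself and $\sigma|_L = \alpha(\beta(\sigma))$; the field $E$ is called its *solution field*. If $k=\kappa(T)$ with $T$ an indeterminate over a field $\kappa$, the solution is *regular* if $E \cap \overline{\kappa} = L \cap \overline{\kappa}$. Let $\mathbf{T} = (T_1,\dots,T_n)$ be an $n$-tuple of algebraically independent indeterminates over $k$, $n \ge 1$. The restriction map $\mathrm{Aut}(L(\mathbf{T})/k(\mathbf{T})) \to \mathrm{Aut}(L/k)$ is an isomorphism, and $\alpha_{k(\mathbf{T})} : G \to \mathrm{Aut}(L(\mathbf{T})/k(\mathbf{T}))$ denotes the composition of $\alpha$ with its inverse. Let $E/k(\mathbf{T})$ be a finite separable extension with Galois closure $\widehat{E}$, and let $B$ and $\widehat{B}$ be the integral closures of $k[\mathbf{T}]$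 in $E$ and $\widehat{E}$. For $\mathbf{t} \in k^n$, let $\widehat{E}_{\mathbf{t}}$ be the residue field of $\widehat{B}$ at a maximal ideal lying over $\langle T_1 - t_1, \dots, T_n - t_n\rangle$; up to $k$-isomorphism it does not depend on the ideal. If $[\widehat{E}_{\mathbf{t}} : k] = [\widehat{E} : k(\mathbf{T})]$, then $B$ has exactly one maximal ideal lying over $\langle T_1 - t_1, \dots, T_n - t_n\rangle$; in this case the specialization $E_{\mathbf{t}}$ is defined, as the residue field of $B$ at this ideal. If $L(\mathbf{T}) \subseteq E$, then $L \subseteq B$, and $L$ is viewed as a subfield of $E_{\mathbf{t}}$ through $L \subseteq B \to E_{\mathbf{t}}$. The field $k$ is *Hilbertian* if for all $r$, all finite families $f_1,\dots,f_m \in k[T_1,\dots,T_r][X]$ of polynomials that are irreducible and separable in $X$ over $k(T_1,\dots,T_r)$, and all nonzero $g \in k[T_1,\dots,T_r]$, there is $\mathbf{a} \in k^r$ such that $g(\mathbf{a}) \neq 0$ and every $f_i(\mathbf{a},X)$ is irreducible over $k$. **Proposition 3.1.** Let $\alpha : G \to \mathrm{Aut}(L/k)$ be a finite embedding problem over $k$.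 Suppose that the finite embedding problem $\alpha_{k(\mathbf{T})}$ has a solution, with solution field $E$. (1) Suppose that $k$ is Hilbertian. Then there is a Zariski-dense subset $S$ of $k^n$ such that, for every $\mathbf{t} \in S$, the specialization $E_{\mathbf{t}}$ is defined and the embedding problem $\alpha$ has a solution whose solution field is $E_{\mathbf{t}}$. (2) Suppose that $k = \kappa(T)$ for some field $\kappa$ and an indeterminate $T$, and that $E \cap \overline{\kappa} = L \cap \overline{\kappa}$. Then there is $\mathbf{t} \in k^n$ such that $E_{\mathbf{t}}$ is defined and is the solution field of a regular solution to $\alpha$. -/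

import Mathlib

open Polynomial

noncomputable section

namespace EmbeddingProblem

/-! ### Rational function fields and constant extensions -/

/-- The polynomial ring `k[T_1, …, T_n]`. -/
abbrev PolyRing (n : ℕ) (k : Type*) [Field k] : Type _ := MvPolynomial (Fin n) k

/-- The rational function field `k(T_1, …, T_n)`. -/
abbrev FunField (n : ℕ) (k : Type*) [Field k] : Type _ := FractionRing (PolyRing n k)

section ConstantExtension

variable (n : ℕ) (k L : Type*) [Field k] [Field L] [Algebra k L]

attribute [local instance] MvPolynomial.algebraMvPolynomial

theorem injective_poly_funField :
    Function.Injective (algebraMap (PolyRing n k) (FunField n L)) := by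
  rw [IsScalarTower.algebraMap_eq (PolyRing n k) (PolyRing n L) (FunField n L)]
  exact (IsFractionRing.injective (PolyRing n L) (FunField n L)).comp
    (MvPolynomial.map_injective _ (algebraMap k L).injective)

/-- The inclusion `k(T) ⊆ L(T)` induced by `k[T] ⊆ L[T]`. -/
instance algebraFunField : Algebra (FunField n k) (FunField n L) :=
  (IsFractionRing.lift (injective_poly_funField n k L)).toAlgebra

theorem isScalarTower_poly_funField :
    IsScalarTower (PolyRing n k) (FunField n k) (FunField n L) :=
  IsScalarTower.of_algebraMap_eq fun x =>
    (IsFractionRing.lift_algebraMap (injective_poly_funField n k L) x).symm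

attribute [local instance] isScalarTower_poly_funField

instance isScalarTower_base_funField :
    IsScalarTower k (FunField n k) (FunField n L) :=
  IsScalarTower.of_algebraMap_eq fun x => by
    rw [IsScalarTower.algebraMap_apply k (PolyRing n k) (FunField n k),
      ← IsScalarTower.algebraMap_apply (PolyRing n k) (FunField n k) (FunField n L),
      IsScalarTower.algebraMap_apply (PolyRing n k) (PolyRing n L) (FunField n L),
      IsScalarTower.algebraMap_apply k (PolyRing n L) (FunField n L)]
    congr 1
    exact (MvPolynomial.map_C (algebraMap k L) x).symm

variable {k L}

/-- A `k`-automorphism of `L`, acting on the coefficients of `L[T]`. -/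
def coeffAut : (L ≃ₐ[k] L) →* (PolyRing n L ≃ₐ[PolyRing n k] PolyRing n L) where
  toFun σ := AlgEquiv.ofRingEquiv (f := MvPolynomial.mapEquiv (Fin n) σ.toRingEquiv) fun p => by
    change MvPolynomial.map (σ : L →+* L) (MvPolynomial.map (algebraMap k L) p) =
      MvPolynomial.map (algebraMap k L) p
    rw [MvPolynomial.map_map]
    congr 2
    ext x
    simp
  map_one' := AlgEquiv.ext fun p => MvPolynomial.map_id p
  map_mul' σ τ := AlgEquiv.ext fun p =>
    (MvPolynomial.map_map (τ : L →+* L) (σ : L →+* L) p).symm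

/-- The extension of a `k`-automorphism of `L` to a `k(T)`-automorphism of `L(T)`. By the two
lemmas below this is the inverse of the restriction map `Aut(L(T)/k(T)) → Aut(L/k)`. -/
def liftAut : (L ≃ₐ[k] L) →* (FunField n L ≃ₐ[FunField n k] FunField n L) :=
  (IsFractionRing.fieldEquivOfAlgEquivHom (FunField n k) (FunField n L)).comp (coeffAut n)

theorem liftAut_algebraMap (σ : L ≃ₐ[k] L) (x : L) :
    liftAut n σ (algebraMap L (FunField n L) x) = algebraMap L (FunField n L) (σ x) := by
  rw [IsScalarTower.algebraMap_apply L (PolyRing n L) (FunField n L),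
    IsScalarTower.algebraMap_apply L (PolyRing n L) (FunField n L)]
  change IsFractionRing.fieldEquivOfAlgEquiv _ _ _ (coeffAut n σ) _ = _
  rw [IsFractionRing.fieldEquivOfAlgEquiv_algebraMap]
  congr 1
  exact MvPolynomial.map_C (σ : L →+* L) x

theorem eq_liftAut (σ : L ≃ₐ[k] L) (τ : FunField n L ≃ₐ[FunField n k] FunField n L)
    (h : ∀ x : L, τ (algebraMap L (FunField n L) x) = algebraMap L (FunField n L) (σ x)) :
    τ = liftAut n σ := by
  have key : ∀ ρ : FunField n L ≃ₐ[FunField n k] FunField n L, ∀ i,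
      ρ (algebraMap (PolyRing n L) (FunField n L) (MvPolynomial.X i)) =
        algebraMap (PolyRing n L) (FunField n L) (MvPolynomial.X i) := fun ρ i => by
    have e : algebraMap (PolyRing n L) (FunField n L) (MvPolynomial.X i) =
        algebraMap (FunField n k) (FunField n L)
          (algebraMap (PolyRing n k) (FunField n k) (MvPolynomial.X i)) := by
      rw [← IsScalarTower.algebraMap_apply (PolyRing n k) (FunField n k) (FunField n L),
        IsScalarTower.algebraMap_apply (PolyRing n k) (PolyRing n L) (FunField n L)]
      congr 1
      exact (MvPolynomial.map_X (algebraMap k L) i).symm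
    rw [e, ρ.commutes]
  have hr : (τ : FunField n L →+* FunField n L) = (liftAut n σ : FunField n L →+* FunField n L) := by
    refine IsFractionRing.ringHom_ext (A := PolyRing n L) fun p => ?_
    refine RingHom.congr_fun (f := (τ : FunField n L →+* FunField n L).comp (algebraMap _ _))
      (g := (liftAut n σ : FunField n L →+* FunField n L).comp (algebraMap _ _)) ?_ p
    refine MvPolynomial.ringHom_ext (fun x => ?_) fun i => ?_
    · exact (h x).trans (liftAut_algebraMap n σ x).symm
    · exact (key τ i).trans (key (liftAut n σ) i).symm
  exact AlgEquiv.ext fun x => RingHom.congr_fun hr x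

end ConstantExtension

/-! ### Finite embedding problems -/

section Problems

variable {k L G : Type*} [Field k] [Field L] [Algebra k L] [Group G]

/-- `α : G → Aut(L/k)` is a finite embedding problem over `k`: `G` is finite, `L/k` is finite
separable (not necessarily normal) and `α` is surjective. -/
structure IsFiniteEmbeddingProblem (α : G →* (L ≃ₐ[k] L)) : Prop where
  finite_group : Finite G
  finiteDimensional : FiniteDimensional k L
  isSeparable : Algebra.IsSeparable k L
  surjective : Function.Surjective α

/-- `β : Aut(E/k) → G` is a solution to `α : G → Aut(L/k)`, where `L` is viewed inside `E` through
`j`: the extension `E/k` is finite separable, and every `σ ∈ Aut(E/k)` maps `L` into itself with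
restriction `α (β σ)`. -/
structure IsSolution {E : Type*} [Field E] [Algebra k E] (α : G →* (L ≃ₐ[k] L)) (j : L →ₐ[k] E)
    (β : (E ≃ₐ[k] E) ≃* G) : Prop where
  finiteDimensional : FiniteDimensional k E
  isSeparable : Algebra.IsSeparable k E
  restrict_eq : ∀ (σ : E ≃ₐ[k] E) (x : L), σ (j x) = j (α (β σ) x)

/-- The embedding problem `α_{k(T)} : G → Aut(L(T)/k(T))`. -/
def baseChange (n : ℕ) (α : G →* (L ≃ₐ[k] L)) :
    G →* (FunField n L ≃ₐ[FunField n k] FunField n L) :=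
  (liftAut n).comp α

/-- For fields `κ ⊆ F`, the set `F ∩ κ̄` of elements of `F` that are algebraic over `κ`. -/
def algebraicElements {κ F : Type*} [Field κ] [Field F] (f : κ →+* F) : Set F :=
  {x | ∃ p : κ[X], p ≠ 0 ∧ p.eval₂ f x = 0}

/-- For fields `κ ⊆ L ⊆ E`, the condition `E ∩ κ̄ = L ∩ κ̄`. -/
def SameConstants {κ L E : Type*} [Field κ] [Field L] [Field E] (i : κ →+* L) (j : L →+* E) :
    Prop :=
  algebraicElements (j.comp i) = j '' algebraicElements i

/-- For `k = κ(T)`, the embedding of `κ` into `k`. -/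
def ratConst (κ k : Type*) [Field κ] [Field k] [Algebra κ[X] k] : κ →+* k :=
  (algebraMap κ[X] k).comp Polynomial.C

/-- `β` is a regular solution to the embedding problem `α` over `k = κ(T)`: a solution whose
solution field `E` satisfies `E ∩ κ̄ = L ∩ κ̄`. -/
structure IsRegularSolution (κ : Type*) [Field κ] [Algebra κ[X] k]
    {E : Type*} [Field E] [Algebra k E] (α : G →* (L ≃ₐ[k] L)) (j : L →ₐ[k] E)
    (β : (E ≃ₐ[k] E) ≃* G) : Prop extends IsSolution α j β where
  sameConstants : SameConstants ((algebraMap k L).comp (ratConst κ k)) (j : L →+* E)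

end Problems

/-! ### Hilbertian fields and Zariski density -/

/-- `k` is Hilbertian: every separable Hilbert subset of every affine space `k^r` is non-empty.
That is, given polynomials `f_1, …, f_m` in `k[T_1, …, T_r][X]` that are irreducible and separable
over `k(T_1, …, T_r)`, and `g ≠ 0` in `k[T_1, …, T_r]`, there is `a ∈ k^r` such that `g(a) ≠ 0` and
all `f_i(a, X)` are irreducible over `k`. -/
def IsHilbertian (k : Type*) [Field k] : Prop :=
  ∀ (r m : ℕ) (f : Fin m → (PolyRing r k)[X]) (g : PolyRing r k),
    (∀ i, Irreducible ((f i).map (algebraMap (PolyRing r k) (FunField r k)))) →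
    (∀ i, ((f i).map (algebraMap (PolyRing r k) (FunField r k))).Separable) →
    g ≠ 0 →
    ∃ a : Fin r → k, MvPolynomial.eval a g ≠ 0 ∧
      ∀ i, Irreducible ((f i).map (MvPolynomial.eval a))

/-- A subset of `k^n` is Zariski-dense if it does not lie in the zero set of a nonzero
polynomial. -/
def IsZariskiDense {n : ℕ} {k : Type*} [Field k] (S : Set (Fin n → k)) : Prop :=
  ∀ g : PolyRing n k, g ≠ 0 → ∃ t ∈ S, MvPolynomial.eval t g ≠ 0

/-! ### Specializations -/

/-- The ideal `⟨T_1 - t_1, …, T_n - t_n⟩` of `k[T_1, …, T_n]`. -/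
def pointIdeal {n : ℕ} {k : Type*} [Field k] (t : Fin n → k) : Ideal (PolyRing n k) :=
  Ideal.span (Set.range fun i => MvPolynomial.X i - MvPolynomial.C (t i))

section Specialization

variable {n : ℕ} {k : Type*} [Field k]

/-- A maximal ideal of the integral closure `B` of `k[T]` in `E` that lies over `⟨T - t⟩`. -/
structure IdealAbove (E : Type*) [Field E] [Algebra (PolyRing n k) E] (t : Fin n → k) where
  ideal : Ideal (integralClosure (PolyRing n k) E)
  isMaximal : ideal.IsMaximal
  under_eq : ideal.under (PolyRing n k) = pointIdeal t

instance {E : Type*} [Field E] [Algebra (PolyRing n k) E] {t : Fin n → k} (P : IdealAbove E t) :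
    P.ideal.IsMaximal :=
  P.isMaximal

/-- The residue field `E_{t,i}` of `B` at a maximal ideal over `⟨T - t⟩`. -/
abbrev IdealAbove.residueField {E : Type*} [Field E] [Algebra (PolyRing n k) E] {t : Fin n → k}
    (P : IdealAbove E t) : Type _ :=
  P.ideal.ResidueField

/-- The inclusion of `L` into the integral closure of `k[T]` in an extension `E` of `k(T)` and `L`,
where `L` is algebraic over `k`. -/
def toIntegralClosure {L E : Type*} [Field L] [Algebra k L] [Algebra.IsAlgebraic k L]
    [Field E] [Algebra k E] [Algebra (PolyRing n k) E] [IsScalarTower k (PolyRing n k) E]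
    (j : L →ₐ[k] E) : L →ₐ[k] integralClosure (PolyRing n k) E where
  toFun x := ⟨j x, ((Algebra.IsIntegral.isIntegral (R := k) x).map j).tower_top⟩
  map_one' := Subtype.ext (map_one j)
  map_mul' x y := Subtype.ext (map_mul j x y)
  map_zero' := Subtype.ext (map_zero j)
  map_add' x y := Subtype.ext (map_add j x y)
  commutes' x := Subtype.ext (j.commutes x)

/-- The inclusion `L ⊆ E_{t,i}` induced by `L ⊆ B`. -/
def IdealAbove.embed {L E : Type*} [Field L] [Algebra k L] [Algebra.IsAlgebraic k L]
    [Field E] [Algebra k E] [Algebra (PolyRing n k) E] [IsScalarTower k (PolyRing n k) E]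
    {t : Fin n → k} (P : IdealAbove E t) (j : L →ₐ[k] E) : L →ₐ[k] P.residueField :=
  (IsScalarTower.toAlgHom k (integralClosure (PolyRing n k) E) P.residueField).comp
    (toIntegralClosure j)

/-- The Galois closure `Ê` of a finite separable extension `E` of `k(T)`. -/
abbrev GalClosure (n : ℕ) (k E : Type*) [Field k] [Field E] [Algebra (FunField n k) E] : Type _ :=
  IntermediateField.normalClosure (FunField n k) E (AlgebraicClosure E)

instance isScalarTower_funField {E : Type*} [Field E] [Algebra k E] [Algebra (PolyRing n k) E]
    [Algebra (FunField n k) E] [IsScalarTower k (PolyRing n k) E]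
    [IsScalarTower (PolyRing n k) (FunField n k) E] : IsScalarTower k (FunField n k) E :=
  IsScalarTower.of_algebraMap_eq fun x => by
    rw [IsScalarTower.algebraMap_apply k (PolyRing n k) (FunField n k),
      ← IsScalarTower.algebraMap_apply (PolyRing n k) (FunField n k) E,
      ← IsScalarTower.algebraMap_apply k (PolyRing n k) E]

instance isScalarTower_galClosure {E : Type*} [Field E] [Algebra k E] [Algebra (PolyRing n k) E]
    [Algebra (FunField n k) E] [IsScalarTower k (PolyRing n k) E]
    [IsScalarTower (PolyRing n k) (FunField n k) E] :
    IsScalarTower k (PolyRing n k) (GalClosure n k E) :=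
  ⟨fun a p x => Subtype.ext (smul_assoc a p (x : AlgebraicClosure E))⟩

/-- The residue field at `P` is the specialization `E_t` of `E/k(T)` at `t`. For `E_t` to be
defined, one asks that `[Ê_t : k] = [Ê : k(T)]`, and that `P` is the only maximal ideal of `B` over
`⟨T - t⟩`. -/
structure IdealAbove.IsSpecialization {E : Type*} [Field E] [Algebra k E]
    [Algebra (PolyRing n k) E] [Algebra (FunField n k) E] [IsScalarTower k (PolyRing n k) E]
    [IsScalarTower (PolyRing n k) (FunField n k) E] {t : Fin n → k} (P : IdealAbove E t) :
    Prop where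
  finrank_eq : ∀ Q : IdealAbove (GalClosure n k E) t,
    Module.finrank k Q.residueField = Module.finrank (FunField n k) (GalClosure n k E)
  unique : ∀ Q : IdealAbove E t, Q = P

/-- The inclusion of `L` into `E` obtained from an inclusion of `L(T)` into `E`. -/
def constEmbedding {L E : Type*} [Field L] [Algebra k L] [Field E] [Algebra k E]
    [Algebra (PolyRing n k) E] [Algebra (FunField n k) E] [IsScalarTower k (PolyRing n k) E]
    [IsScalarTower (PolyRing n k) (FunField n k) E]
    (ι : FunField n L →ₐ[FunField n k] E) : L →ₐ[k] E where
  toRingHom := (ι : FunField n L →+* E).comp (algebraMap L (FunField n L))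
  commutes' x := by
    change ι (algebraMap L (FunField n L) (algebraMap k L x)) = _
    rw [← IsScalarTower.algebraMap_apply k L (FunField n L),
      IsScalarTower.algebraMap_apply k (FunField n k) (FunField n L), ι.commutes,
      ← IsScalarTower.algebraMap_apply k (FunField n k) E]

end Specialization

end EmbeddingProblem

end

open Polynomial

noncomputable section

namespace HilbertIrreducibility

/-! ### Approximate roots over a local ring -/

section Approximation

/-! Let `K = k(T_1, …, T_n)` and let `Ω` be a finite Galois extension of `K` containing the Galois
closure of `E`, with an integral primitive element `θ`. If `t` keeps the minimal polynomial of `θ`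
irreducible and avoids the zeros of some Bézout constants, which play the part of discriminants,
then the maximal ideal over `t` in `Ω` is unique, so it is stable under `Gal(Ω/K)`, and reduction is
injective on the conjugates of a generator. The residue field `E_t` then has degree `[E : K]`, and
reduction gives `Aut(E/K) ≃ Aut(E_t/k)` although `E` need not be normal: an automorphism of `E_t`
sends the residue of a generator to the residue of a conjugate in `Ω`, and this conjugate lies in
`E`, because `Gal(Ω/E)` cannot change its residue and so fixes it (`mem_range_of_map_eq`,
`exists_mulEquiv_aut`). The solution over `K` is transported along this isomorphism
(`exists_isSolution`). Over a Hilbertian field such `t` exist off any hypersurface, which is (1).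

For (2) the constants of `E_t` have to be controlled. Choose a prime `p` of `κ[T]` and a point `t₀`
modulo which `E` has good reduction, and take `t` `p`-adically close to `t₀`. The minimal polynomial
over `κ` of any constant of `E_t` then has a root in a fixed finite extension `M` of `κ[T]/p`. If
`Ω` was chosen to split all separable irreducible polynomials over `κ` with a root in `M`, the
descent argument above lifts the constant to a constant of `E`
(`exists_specialization_algebraicElements`).

This needs irreducible specializations over `κ(T)` with a congruence condition
(`exists_irreducible_specialization_of_ratFunc`). They are found one variable at a time by a
nonstandard argument (`exists_irreducible_specialization`). If `f(1/(w_N + c), X)` is reducible for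
almost all `N` and every `c`, then in an ultrapower `f(z, X)` factors at the infinitesimals `z =
1/(w + c)`. As `f(0, X)` is separable, the factors agree to high order in `z` with members of a
finite list, and infinitely many `c` share the same member. After inverting the variable, the
coefficients of the factors are polynomials in `w + c` up to infinitesimals; they also lie in a ring
without nonzero infinitesimals, so Lagrange interpolation makes this exact. The resulting
factorization over the ultrapower descends to the base field and contradicts irreducibility. -/

theorem eval_eval_eq {R : Type*} [CommRing R] (Q : R[X][X]) (r : R[X]) (z : R) :
    (Q.eval r).eval z = (Q.map (evalRingHom z)).eval (r.eval z) :=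
  (hom_eval₂ Q (RingHom.id _) (evalRingHom z) r).trans
    (by rw [RingHom.comp_id, eval_map, coe_evalRingHom])

variable {O : Type*} [CommRing O]

/-- Newton iteration in powers of `X`: the derivative at the starting root is a unit, so each
correction term removes one more coefficient. -/
theorem exists_approx_root (P : O[X][X]) (a : O)
    (h0 : (P.map (evalRingHom 0)).eval a = 0)
    (h1 : IsUnit ((P.map (evalRingHom 0)).derivative.eval a)) (M : ℕ) :
    ∃ r : O[X], r.eval 0 = a ∧ X ^ M ∣ P.eval r := by
  induction M with
  | zero => exact ⟨C a, by simp, by simp⟩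
  | succ M ih =>
    -- A correction of order `m` leaves a Taylor remainder of order `2 m`, which is at least `m + 1`
    -- only for `m ≥ 1`; order zero is therefore treated apart.
    rcases M with _ | M
    · refine ⟨C a, by simp, ?_⟩
      rw [zero_add, pow_one, X_dvd_iff, coeff_zero_eq_eval_zero, eval_eval_eq, eval_C, h0]
    obtain ⟨r, hr, q, hq⟩ := ih
    obtain ⟨u, hu⟩ := h1
    -- `t` solves the linear equation that kills the constant coefficient of `q + P'(r) t`.
    set t : O := -(↑u⁻¹ * q.eval 0) with ht
    obtain ⟨k, hk⟩ := P.binomExpansion r (X ^ (M + 1) * C t)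
    refine ⟨r + X ^ (M + 1) * C t, by simp [hr], ?_⟩
    have h2 : X ∣ q + P.derivative.eval r * C t := by
      rw [X_dvd_iff, coeff_zero_eq_eval_zero, eval_add, eval_mul, eval_eval_eq, hr,
        ← derivative_map, eval_C, ← hu, ht]
      simp
    obtain ⟨q', hq'⟩ := h2
    refine ⟨q' + k * C t ^ 2 * X ^ M, ?_⟩
    rw [hk, hq]
    linear_combination X ^ (M + 1) * hq'

theorem dvd_eval_sub_eval_zero (Q : O[X]) (z : O) : z ∣ Q.eval z - Q.eval 0 := by
  simpa using sub_dvd_eval_sub z 0 Q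

/-- Modulo the maximal ideal `x` is a root of a product of linear factors, so `x ≡ a` for one of the
`a`. Taylor expansion at `r_a(z)` gives `0 = z^M q(z) + ε (x - r_a(z))`, where `ε` is a unit because
it is congruent to the derivative at `a`. -/
theorem exists_eq_approx_root [IsLocalRing O] (P : O[X][X]) (s : Multiset O)
    (hs : P.map (evalRingHom 0) = (s.map fun a => X - C a).prod) (M : ℕ) (r : O → O[X])
    (hr0 : ∀ a ∈ s, (r a).eval 0 = a) (hr : ∀ a ∈ s, X ^ M ∣ P.eval (r a))
    (hu : ∀ a ∈ s, IsUnit ((P.map (evalRingHom 0)).derivative.eval a))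
    {z : O} (hz : z ∈ IsLocalRing.maximalIdeal O) {x : O}
    (hx : (P.map (evalRingHom z)).eval x = 0) :
    ∃ a ∈ s, ∃ y, x = (r a).eval z + z ^ M * y := by
  have hmem : ∀ Q : O[X], Q.eval z - Q.eval 0 ∈ IsLocalRing.maximalIdeal O := fun Q =>
    Ideal.mem_of_dvd _ (dvd_eval_sub_eval_zero Q z) hz
  have hmem' : ∀ (Q : O[X][X]) (y : O), (Q.map (evalRingHom z)).eval y -
      (Q.map (evalRingHom 0)).eval y ∈ IsLocalRing.maximalIdeal O := fun Q y => by
    simpa [eval_eval_eq] using hmem (Q.eval (C y))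
  have h1 : (s.map fun a => x - a).prod ∈ IsLocalRing.maximalIdeal O := by
    have := hmem' P x
    rw [hx, zero_sub, neg_mem_iff, hs, eval_multiset_prod, Multiset.map_map] at this
    simpa using this
  obtain ⟨b, hb, hbm⟩ := Ideal.IsPrime.multiset_prod_mem_iff_exists_mem
    (I := IsLocalRing.maximalIdeal O) inferInstance _ |>.1 h1
  obtain ⟨a, ha, rfl⟩ := Multiset.mem_map.1 hb
  refine ⟨a, ha, ?_⟩
  obtain ⟨k, hk⟩ := (P.map (evalRingHom z)).binomExpansion ((r a).eval z) (x - (r a).eval z)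
  have hy : x - (r a).eval z ∈ IsLocalRing.maximalIdeal O := by
    have := sub_mem hbm (hmem (r a))
    rw [hr0 a ha] at this
    convert this using 1
    ring
  obtain ⟨q, hq⟩ := hr a ha
  have hq' : (P.map (evalRingHom z)).eval ((r a).eval z) = z ^ M * q.eval z := by
    rw [← eval_eval_eq, hq]; simp
  rw [add_sub_cancel, hx, hq'] at hk
  have hunit : IsUnit ((P.map (evalRingHom z)).derivative.eval ((r a).eval z) +
      k * (x - (r a).eval z)) := by
    have h2 : (P.map (evalRingHom z)).derivative.eval ((r a).eval z) -
        (P.map (evalRingHom 0)).derivative.eval a ∈ IsLocalRing.maximalIdeal O := by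
      have := hmem (P.derivative.eval (r a))
      rwa [eval_eval_eq, eval_eval_eq, hr0 a ha, ← derivative_map, ← derivative_map] at this
    by_contra hc
    refine (IsLocalRing.mem_maximalIdeal _).1 ?_ (hu a ha)
    have h3 := sub_mem ((IsLocalRing.mem_maximalIdeal _).2 hc)
      (add_mem h2 (Ideal.mul_mem_left _ k hy))
    convert h3 using 1
    ring
  obtain ⟨u, hu'⟩ := hunit
  refine ⟨-(q.eval z * ↑u⁻¹), ?_⟩
  have h4 : (x - (r a).eval z) * u = - (z ^ M * q.eval z) := by
    rw [hu']; linear_combination hk.symm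
  have h5 : x - (r a).eval z = - (z ^ M * q.eval z) * ↑u⁻¹ := by
    rw [← h4, mul_assoc, Units.mul_inv, mul_one]
  linear_combination h5

variable {A : Type*} [Field A] [IsAlgClosed A] [Algebra O A]

/-- Roots are split off one at a time; they are integral over `O`, hence lie in `O`. The list
consists of the products of `d` factors `X - r_a` and does not depend on `z`. -/
theorem exists_finite_approx_factor [IsDomain O] [IsLocalRing O] [IsIntegrallyClosed O]
    [IsFractionRing O A]
    (P : O[X][X]) (hP : P.Monic) (s : Multiset O)
    (hs : P.map (evalRingHom 0) = (s.map fun a => X - C a).prod)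
    (hu : ∀ a ∈ s, IsUnit ((P.map (evalRingHom 0)).derivative.eval a)) (M d : ℕ) :
    ∃ Λ : Set O[X][X], Λ.Finite ∧ ∀ z ∈ IsLocalRing.maximalIdeal O, ∀ g : A[X], g.Monic →
      g.natDegree = d → g ∣ (P.map (evalRingHom z)).map (algebraMap O A) →
      ∃ l ∈ Λ, ∃ q : O[X],
        g = (l.map (evalRingHom z) + C (z ^ M) * q).map (algebraMap O A) := by
  have hroot : ∀ a : O, a ∈ s → (P.map (evalRingHom 0)).eval a = 0 := fun a ha => by
    rw [hs, eval_multiset_prod, Multiset.map_map]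
    exact Multiset.prod_eq_zero (Multiset.mem_map.2 ⟨a, ha, by simp⟩)
  have hr : ∀ a : O, ∃ r : O[X], a ∈ s → r.eval 0 = a ∧ X ^ M ∣ P.eval r := fun a => by
    by_cases ha : a ∈ s
    · obtain ⟨r, hr⟩ := exists_approx_root P a (hroot a ha) (hu a ha) M
      exact ⟨r, fun _ => hr⟩
    · exact ⟨0, fun h => absurd h ha⟩
  choose r hr using hr
  induction d with
  | zero =>
    refine ⟨{1}, Set.finite_singleton _, fun z _ g hg hd _ => ⟨1, rfl, 0, ?_⟩⟩
    rw [hg.natDegree_eq_zero.1 hd]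
    simp
  | succ d ih =>
    obtain ⟨Λ, hΛ, h⟩ := ih
    refine ⟨Set.image2 (fun a l => (X - C (r a)) * l) {a | a ∈ s} Λ,
      Set.Finite.image2 _ (Multiset.finite_toSet s) hΛ, fun z hz g hg hd hdvd => ?_⟩
    obtain ⟨x, hx⟩ := IsAlgClosed.exists_root g (by
      rw [Polynomial.degree_eq_natDegree hg.ne_zero, hd]; exact_mod_cast Nat.succ_ne_zero d)
    obtain ⟨g₁, rfl⟩ := dvd_iff_isRoot.2 hx
    have hg₁ : g₁.Monic := (monic_X_sub_C x).of_mul_monic_left hg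
    have hd₁ : g₁.natDegree = d := by
      rw [(monic_X_sub_C x).natDegree_mul hg₁, natDegree_X_sub_C] at hd
      omega
    have hxint : IsIntegral O x := ⟨P.map (evalRingHom z), hP.map _, by
      rw [← eval_map]; exact hx.dvd hdvd⟩
    obtain ⟨x, rfl⟩ := IsIntegrallyClosed.isIntegral_iff.1 hxint
    obtain ⟨l, hl, q, hq⟩ := h z hz g₁ hg₁ hd₁ (dvd_of_mul_left_dvd hdvd)
    have hx0 : (P.map (evalRingHom z)).eval x = 0 := by
      apply IsFractionRing.injective O A
      rw [map_zero, ← eval_map_apply]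
      exact hx.dvd hdvd
    obtain ⟨a, ha, y, hy⟩ := exists_eq_approx_root P s hs M r (fun a ha => (hr a ha).1)
      (fun a ha => (hr a ha).2) hu hz hx0
    refine ⟨_, ⟨a, ha, l, hl, rfl⟩, (X - C ((r a).eval z)) * q - C y * l.map (evalRingHom z) -
      C y * C (z ^ M) * q, ?_⟩
    rw [hq, show (X - C (algebraMap O A x)) = (X - C x).map (algebraMap O A) by simp,
      ← Polynomial.map_mul]
    congr 1
    rw [hy]
    simp only [Polynomial.map_mul, Polynomial.map_sub, map_X, map_C, coe_evalRingHom, C_add, C_mul]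
    ring

end Approximation

/-! ### Interpolation of factors -/

section Interpolation

/-- The image in `A` of the maximal ideal of a local ring `O`. -/
def infinitesimals (O A : Type*) [CommRing O] [IsLocalRing O] [CommRing A] [Algebra O A] :
    Submodule O A :=
  Submodule.map (Algebra.linearMap O A) (IsLocalRing.maximalIdeal O)

variable {O A : Type*} [CommRing O] [IsLocalRing O] [Field A] [Algebra O A]

theorem algebraMap_mem_infinitesimals {z : O} (hz : z ∈ IsLocalRing.maximalIdeal O) :
    algebraMap O A z ∈ infinitesimals O A :=
  ⟨z, hz, rfl⟩

/-- As a Laurent polynomial in `w`, the expression `w^a l(1/w)` is a polynomial in `w` plus a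
polynomial in `w⁻¹` without constant term. -/
theorem exists_sub_mem_infinitesimals (l : O[X]) (a : ℕ) :
    ∃ p : A[X], ∀ w : A, w ≠ 0 → ∀ z ∈ IsLocalRing.maximalIdeal O, algebraMap O A z = w⁻¹ →
      w ^ a * algebraMap O A (l.eval z) - p.eval w ∈ infinitesimals O A := by
  induction a generalizing l with
  | zero =>
    refine ⟨C (algebraMap O A (l.eval 0)), fun w _ z hz _ => ?_⟩
    rw [pow_zero, one_mul, eval_C, ← map_sub]
    exact algebraMap_mem_infinitesimals (Ideal.mem_of_dvd _ (dvd_eval_sub_eval_zero l z) hz)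
  | succ a ih =>
    obtain ⟨p, hp⟩ := ih l.divX
    refine ⟨p + C (algebraMap O A (l.coeff 0)) * X ^ (a + 1), fun w hw z hz hzw => ?_⟩
    convert hp w hw z hz hzw using 1
    have h : algebraMap O A (l.eval z) =
        algebraMap O A (l.divX.eval z) * w⁻¹ + algebraMap O A (l.coeff 0) := by
      conv_lhs => rw [← l.divX_mul_X_add]
      simp only [eval_add, eval_mul, eval_X, eval_C, map_add, map_mul, hzw]
    rw [h]
    simp only [eval_add, eval_mul, eval_X, eval_C, eval_pow]
    field_simp
    ring

variable {F Fs : Type*} [Field F] [Field Fs] [Algebra F Fs] [Algebra Fs A]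

/-- At the points `w + c` the Lagrange basis takes values in `F`, since `w` cancels from differences
of nodes. On `deg p + 1` nodes `p` is recovered exactly, so the interpolant of `γ` differs from `γ
c` by an infinitesimal. That difference lies in `S`, so it is zero. -/
theorem exists_interpolation (i : F →+* O)
    (hi : ∀ a, algebraMap O A (i a) = algebraMap Fs A (algebraMap F Fs a))
    (S : Subalgebra F Fs) (hS : ∀ s ∈ S, algebraMap Fs A s ∈ infinitesimals O A → s = 0)
    {I : Set F} (hI : I.Infinite) (w : Fs) (γ : F → Fs) (hγ : ∀ c ∈ I, γ c ∈ S) (p : A[X])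
    (hp : ∀ c ∈ I, algebraMap Fs A (γ c) - p.eval (algebraMap Fs A (w + algebraMap F Fs c)) ∈
      infinitesimals O A) :
    ∃ Q : Fs[X], ∀ c ∈ I, Q.eval (w + algebraMap F Fs c) = γ c := by
  classical
  obtain ⟨J, hJI, hJ⟩ := hI.exists_subset_card_eq (p.natDegree + 1)
  set v : F → Fs := fun c => w + algebraMap F Fs c with hv
  have hvinj : Function.Injective v := fun a b h =>
    (algebraMap F Fs).injective (add_left_cancel h)
  set ℓ : F → F → F := fun c₀ c => ∏ c₁ ∈ J.erase c₀, (c₀ - c₁)⁻¹ * (c - c₁) with hℓ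
  have hbasis : ∀ c₀ c, (Lagrange.basis J v c₀).eval (v c) = algebraMap F Fs (ℓ c₀ c) := by
    intro c₀ c
    simp [Lagrange.basis, Lagrange.basisDivisor, eval_prod, hℓ, hv, map_prod]
  have hvA : Function.Injective fun c => algebraMap Fs A (v c) :=
    (algebraMap Fs A).injective.comp hvinj
  have hbasisA : ∀ c₀ c, (Lagrange.basis J (fun c => algebraMap Fs A (v c)) c₀).eval
      (algebraMap Fs A (v c)) = algebraMap O A (i (ℓ c₀ c)) := by
    intro c₀ c
    rw [hi, ← hbasis]
    simp [Lagrange.basis, Lagrange.basisDivisor, eval_prod, map_prod]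
  refine ⟨Lagrange.interpolate J v γ, fun c hc => ?_⟩
  have hpA : p = Lagrange.interpolate J (fun c => algebraMap Fs A (v c))
      (fun c => p.eval (algebraMap Fs A (v c))) :=
    Lagrange.eq_interpolate hvA.injOn (by
      rw [hJ]
      exact lt_of_le_of_lt degree_le_natDegree (by exact_mod_cast Nat.lt_succ_self _))
  have e1 : (Lagrange.interpolate J v γ).eval (v c) =
      ∑ c₀ ∈ J, γ c₀ * algebraMap F Fs (ℓ c₀ c) := by
    simp [Lagrange.interpolate_apply, eval_finsetSum, hbasis]
  have e2 : p.eval (algebraMap Fs A (v c)) =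
      ∑ c₀ ∈ J, p.eval (algebraMap Fs A (v c₀)) * algebraMap O A (i (ℓ c₀ c)) := by
    conv_lhs => rw [hpA]
    simp [Lagrange.interpolate_apply, eval_finsetSum, hbasisA]
  refine sub_eq_zero.1 (hS _ ?_ ?_)
  · refine sub_mem ?_ (hγ c hc)
    rw [e1]
    exact sum_mem fun c₀ hc₀ => mul_mem (hγ _ (hJI hc₀)) (S.algebraMap_mem _)
  · have e3 : algebraMap Fs A ((Lagrange.interpolate J v γ).eval (v c) - γ c) =
        ∑ c₀ ∈ J, i (ℓ c₀ c) • (algebraMap Fs A (γ c₀) - p.eval (algebraMap Fs A (v c₀))) -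
          (algebraMap Fs A (γ c) - p.eval (algebraMap Fs A (v c))) := by
      rw [e1, e2]
      simp only [map_sub, map_sum, map_mul, Algebra.smul_def, mul_sub, Finset.sum_sub_distrib, hi]
      simp only [mul_comm]
      ring
    rw [e3]
    exact sub_mem (Submodule.sum_mem _ fun c₀ hc₀ => Submodule.smul_mem _ _ (hp _ (hJI hc₀)))
      (hp c hc)

theorem degree_sum_range_lt {R : Type*} [CommRing R] (a : ℕ → R) (d : ℕ) :
    (∑ l ∈ Finset.range d, C (a l) * X ^ l : R[X]).degree < d := by
  refine (degree_sum_le _ _).trans_lt ((Finset.sup_lt_iff (WithBot.bot_lt_coe d)).2 fun l hl => ?_)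
  exact (degree_C_mul_X_pow_le _ _).trans_lt (WithBot.coe_lt_coe.2 (Finset.mem_range.1 hl))

theorem exists_monic_of_coeff {R : Type*} [CommRing R] [Nontrivial R] {ι : Type*} (I : Set ι)
    (v : ι → R) (g : ι → R[X])
    (d : ℕ) (hg : ∀ c ∈ I, (g c).Monic) (hd : ∀ c ∈ I, (g c).natDegree = d)
    (h : ∀ l < d, ∃ Q : R[X], ∀ c ∈ I, Q.eval (v c) = (g c).coeff l) :
    ∃ Y : R[X][X], Y.Monic ∧ Y.natDegree = d ∧ ∀ c ∈ I, Y.map (evalRingHom (v c)) = g c := by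
  choose! Q hQ using h
  have hdeg := degree_sum_range_lt Q d
  refine ⟨X ^ d + ∑ l ∈ Finset.range d, C (Q l) * X ^ l, monic_X_pow_add hdeg,
    natDegree_eq_of_degree_eq_some ?_, fun c hc => ?_⟩
  · rw [degree_add_eq_left_of_degree_lt (by rwa [degree_X_pow]), degree_X_pow]
  · rw [(hg c hc).as_sum, hd c hc, Polynomial.map_add, Polynomial.map_pow, map_X,
      Polynomial.map_sum]
    congr 1
    refine Finset.sum_congr rfl fun l hl => ?_
    simp [hQ l (Finset.mem_range.1 hl) c hc]

/-- Undoing the scaling of roots multiplies the coefficient of `X^l` by `(w + c)^(e (d - l))`.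
Because `M > e d`, the error term with `z^M` stays infinitesimal, and each coefficient is a
polynomial in `w + c` up to an infinitesimal. -/
theorem exists_monic_interpolation (i : F →+* O)
    (hi : ∀ a, algebraMap O A (i a) = algebraMap Fs A (algebraMap F Fs a))
    (S : Subalgebra F Fs) (hS : ∀ s ∈ S, algebraMap Fs A s ∈ infinitesimals O A → s = 0)
    {I : Set F} (hI : I.Infinite) (w : Fs) (e d M : ℕ) (hM : e * d < M)
    (hw : ∀ c ∈ I, w + algebraMap F Fs c ≠ 0)
    (z : F → O) (hz : ∀ c ∈ I, z c ∈ IsLocalRing.maximalIdeal O)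
    (hzw : ∀ c ∈ I, algebraMap O A (z c) = (algebraMap Fs A (w + algebraMap F Fs c))⁻¹)
    (g : F → Fs[X]) (hg : ∀ c ∈ I, (g c).Monic) (hd : ∀ c ∈ I, (g c).natDegree = d)
    (hgS : ∀ c ∈ I, ∀ l, (g c).coeff l ∈ S) (lam : O[X][X])
    (hlam : ∀ c ∈ I, ∃ q : O[X], ((g c).map (algebraMap Fs A)).scaleRoots
      (algebraMap O A (z c) ^ e) =
        (lam.map (evalRingHom (z c)) + C (z c ^ M) * q).map (algebraMap O A)) :
    ∃ Y : Fs[X][X], Y.Monic ∧ Y.natDegree = d ∧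
      ∀ c ∈ I, Y.map (evalRingHom (w + algebraMap F Fs c)) = g c := by
  refine exists_monic_of_coeff I _ g d hg hd fun l hl => ?_
  obtain ⟨p, hp⟩ := exists_sub_mem_infinitesimals (A := A) (lam.coeff l) (e * (d - l))
  refine exists_interpolation i hi S hS hI w _ (fun c hc => hgS c hc l) p fun c hc => ?_
  obtain ⟨q, hq⟩ := hlam c hc
  set x : A := algebraMap Fs A (w + algebraMap F Fs c) with hx
  have hx0 : x ≠ 0 := (_root_.map_ne_zero _).2 (hw c hc)
  have h1 := congrArg (fun p => p.coeff l) hq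
  rw [coeff_scaleRoots, natDegree_map, hd c hc, coeff_map, coeff_map, coeff_add, coeff_C_mul,
    coeff_map, coe_evalRingHom, map_add, map_mul, map_pow, ← pow_mul] at h1
  have h2 : algebraMap Fs A ((g c).coeff l) = x ^ (e * (d - l)) *
      algebraMap O A ((lam.coeff l).eval (z c)) +
      algebraMap O A (z c ^ (M - e * (d - l)) * q.coeff l) := by
    have hle : e * (d - l) ≤ M :=
      (Nat.mul_le_mul_left e (Nat.sub_le d l)).trans hM.le
    obtain ⟨N, rfl⟩ := Nat.exists_eq_add_of_le hle
    have hxz : x ^ (e * (d - l)) * algebraMap O A (z c) ^ (e * (d - l)) = 1 := by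
      rw [← mul_pow, hzw c hc, mul_inv_cancel₀ hx0, one_pow]
    rw [Nat.add_sub_cancel_left, map_mul, map_pow]
    rw [pow_add] at h1
    linear_combination x ^ (e * (d - l)) * h1 +
      (algebraMap O A (z c) ^ N * algebraMap O A (q.coeff l) -
        algebraMap Fs A ((g c).coeff l)) * hxz
  rw [h2, add_sub_right_comm]
  refine add_mem (hp x hx0 (z c) (hz c hc) (hzw c hc)) (algebraMap_mem_infinitesimals ?_)
  refine Ideal.mul_mem_right _ _ (Ideal.pow_mem_of_mem _ (hz c hc) _ ?_)
  have := (Nat.mul_le_mul_left e (Nat.sub_le d l)).trans_lt hM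
  omega

theorem exists_multiset_prod_X_sub_C [IsDomain O] [IsIntegrallyClosed O] [IsFractionRing O A]
    [IsAlgClosed A] (p : O[X]) (hp : p.Monic) :
    ∃ s : Multiset O, p = (s.map fun a => X - C a).prod := by
  induction hd : p.natDegree generalizing p with
  | zero => exact ⟨0, by simp [hp.natDegree_eq_zero.1 hd]⟩
  | succ d ih =>
    obtain ⟨x, hx⟩ := IsAlgClosed.exists_root (p.map (algebraMap O A)) (by
      rw [hp.degree_map, Polynomial.degree_eq_natDegree hp.ne_zero, hd]
      exact_mod_cast Nat.succ_ne_zero d)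
    obtain ⟨x, rfl⟩ := IsIntegrallyClosed.isIntegral_iff.1
      (⟨p, hp, by rwa [← eval_map]⟩ : IsIntegral O x)
    have hx' : p.IsRoot x := IsFractionRing.injective O A (by
      rw [map_zero, ← eval_map_apply]; exact hx)
    obtain ⟨q, rfl⟩ := dvd_iff_isRoot.2 hx'
    have hq : q.Monic := (monic_X_sub_C x).of_mul_monic_left hp
    obtain ⟨s, hs⟩ := ih q hq (by
      rw [(monic_X_sub_C x).natDegree_mul hq, natDegree_X_sub_C] at hd
      omega)
    exact ⟨x ::ₘ s, by rw [Multiset.map_cons, Multiset.prod_cons, ← hs]⟩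

end Interpolation

/-! ### Factorizations at infinitely many infinitely large points -/

section Core

theorem exists_infinite_fiber_of_infinite {α β : Type*} {I : Set α} (hI : I.Infinite) (f : α → β)
    {T : Set β} (hT : T.Finite) (hf : ∀ a ∈ I, f a ∈ T) : ∃ y, {a ∈ I | f a = y}.Infinite := by
  by_contra! h
  exact hI ((hT.biUnion (t := fun y => {a ∈ I | f a = y}) fun y _ => h y).subset fun a ha =>
    Set.mem_biUnion (hf a ha) ⟨ha, rfl⟩)

theorem isUnit_derivative_eval_of_separable {R : Type*} [CommRing R] {p : R[X]} (hp : p.Separable)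
    {a : R} (ha : p.eval a = 0) : IsUnit (p.derivative.eval a) := by
  obtain ⟨u, v, huv⟩ := hp
  have := congrArg (eval a) huv
  rw [eval_add, eval_mul, eval_mul, ha, mul_zero, zero_add, eval_one] at this
  exact IsUnit.of_mul_eq_one_right _ this

variable {O A : Type*} [CommRing O] [IsDomain O] [IsLocalRing O] [IsIntegrallyClosed O]
  [Field A] [IsAlgClosed A] [Algebra O A] [IsFractionRing O A]
  {F Fs : Type*} [Field F] [Field Fs] [Algebra F Fs] [Algebra Fs A]

/-- Scaled by `z^e`, the factors of `G` at `w + c` divide `f` at `z = 1/(w + c)`, so each agrees to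
order `M` with a member of a finite list. By pigeonhole infinitely many `c` share the degrees and
the list members, and the factors can be interpolated. The product of the interpolants is `G`
because both agree at infinitely many points. -/
theorem exists_factorization_of_infinite (i : F →+* O)
    (hi : ∀ a, algebraMap O A (i a) = algebraMap Fs A (algebraMap F Fs a))
    (S : Subalgebra F Fs) (hS : ∀ s ∈ S, algebraMap Fs A s ∈ infinitesimals O A → s = 0)
    (f G : F[X][X]) (hf : f.Monic) (e : ℕ)
    (hfG : ∀ x : Fs, x ≠ 0 → G.map (eval₂RingHom (algebraMap F Fs) x) =
      (f.map (eval₂RingHom (algebraMap F Fs) x⁻¹)).scaleRoots (x ^ e))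
    (hsep : (f.map (evalRingHom 0)).Separable)
    {I : Set F} (hI : I.Infinite) (w : Fs) (hw : ∀ c ∈ I, w + algebraMap F Fs c ≠ 0)
    (z : F → O) (hz : ∀ c ∈ I, z c ∈ IsLocalRing.maximalIdeal O)
    (hzw : ∀ c ∈ I, algebraMap O A (z c) = (algebraMap Fs A (w + algebraMap F Fs c))⁻¹)
    (g h : F → Fs[X]) (hg : ∀ c ∈ I, (g c).Monic) (hh : ∀ c ∈ I, (h c).Monic)
    (hg0 : ∀ c ∈ I, (g c).natDegree ≠ 0) (hh0 : ∀ c ∈ I, (h c).natDegree ≠ 0)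
    (hgS : ∀ c ∈ I, ∀ l, (g c).coeff l ∈ S) (hhS : ∀ c ∈ I, ∀ l, (h c).coeff l ∈ S)
    (hgh : ∀ c ∈ I, g c * h c =
      G.map (eval₂RingHom (algebraMap F Fs) (w + algebraMap F Fs c))) :
    ∃ g' h' : Fs[X][X], g'.Monic ∧ h'.Monic ∧ g'.natDegree ≠ 0 ∧ h'.natDegree ≠ 0 ∧
      g' * h' = G.map (mapRingHom (algebraMap F Fs)) := by
  set P : O[X][X] := f.map (mapRingHom i) with hPdef
  have hP : P.Monic := hf.map _
  have hP0 : P.map (evalRingHom 0) = (f.map (evalRingHom 0)).map i := by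
    rw [hPdef, map_map, map_map]
    congr 1
    ext <;> simp
  obtain ⟨s, hs⟩ := exists_multiset_prod_X_sub_C (A := A) (P.map (evalRingHom 0)) (hP.map _)
  have hu : ∀ a ∈ s, IsUnit ((P.map (evalRingHom 0)).derivative.eval a) := fun a ha => by
    refine isUnit_derivative_eval_of_separable (by rw [hP0]; exact hsep.map) ?_
    rw [hs, eval_multiset_prod, Multiset.map_map]
    exact Multiset.prod_eq_zero (Multiset.mem_map.2 ⟨a, ha, by simp⟩)
  have hPz : ∀ c ∈ I, (P.map (evalRingHom (z c))).map (algebraMap O A) =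
      (f.map (eval₂RingHom (algebraMap F Fs) (w + algebraMap F Fs c)⁻¹)).map
        (algebraMap Fs A) := fun c hc => by
    rw [hPdef, map_map, map_map, map_map]
    congr 1
    ext
    · simp [hi]
    · simpa using hzw c hc
  set d := f.natDegree with hd
  set M := e * d + 1 with hM
  choose Λ hΛ hΛ' using exists_finite_approx_factor (A := A) P hP s hs hu M
  set sc : F → Fs[X] → A[X] := fun c p => (p.map (algebraMap Fs A)).scaleRoots
    (algebraMap O A (z c) ^ e) with hsc
  have hsc1 : ∀ c p, p.Monic → (sc c p).Monic := fun c p hp =>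
    (monic_scaleRoots_iff _).2 (hp.map _)
  have hsc2 : ∀ c p, (sc c p).natDegree = p.natDegree := fun c p => by
    rw [hsc, natDegree_scaleRoots, natDegree_map]
  have hmul : ∀ c ∈ I, sc c (g c) * sc c (h c) =
      (P.map (evalRingHom (z c))).map (algebraMap O A) := fun c hc => by
    rw [hPz c hc, hsc, ← mul_scaleRoots_of_noZeroDivisors, ← Polynomial.map_mul, hgh c hc,
      hfG _ (hw c hc), map_scaleRoots _ _ _ (by rw [(hf.map _).leadingCoeff]; simp), ← scaleRoots_mul,
      hzw c hc, map_pow, ← mul_pow, mul_inv_cancel₀ ((_root_.map_ne_zero _).2 (hw c hc)), one_pow,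
      scaleRoots_one]
  have hdeg : ∀ c ∈ I, (g c).natDegree + (h c).natDegree = d := fun c hc => by
    rw [← hsc2 c, ← hsc2 c (h c), ← (hsc1 c _ (hg c hc)).natDegree_mul (hsc1 c _ (hh c hc)),
      hmul c hc, (hP.map _).natDegree_map, hP.natDegree_map, hf.natDegree_map]
  have hlg : ∀ c ∈ I, ∃ l ∈ Λ (g c).natDegree, ∃ q : O[X],
      sc c (g c) = (l.map (evalRingHom (z c)) + C (z c ^ M) * q).map (algebraMap O A) :=
    fun c hc => hΛ' _ (z c) (hz c hc) _ (hsc1 c _ (hg c hc)) (hsc2 c _)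
      (Dvd.intro _ (hmul c hc))
  have hlh : ∀ c ∈ I, ∃ l ∈ Λ (h c).natDegree, ∃ q : O[X],
      sc c (h c) = (l.map (evalRingHom (z c)) + C (z c ^ M) * q).map (algebraMap O A) :=
    fun c hc => hΛ' _ (z c) (hz c hc) _ (hsc1 c _ (hh c hc)) (hsc2 c _)
      (Dvd.intro_left _ (hmul c hc))
  choose! lg hlg1 hlg2 using hlg
  choose! lh hlh1 hlh2 using hlh
  have hT : (⋃ n ∈ Set.Iic d, Λ n).Finite := (Set.finite_Iic d).biUnion fun n _ => hΛ n
  obtain ⟨⟨m, l₁, l₂⟩, hJ⟩ := exists_infinite_fiber_of_infinite hI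
    (fun c => ((g c).natDegree, lg c, lh c)) ((Set.finite_Iic d).prod (hT.prod hT)) (by
      intro c hc
      have := hdeg c hc
      have h1 : (g c).natDegree ∈ Set.Iic d := Set.mem_Iic.2 (by omega)
      have h2 : (h c).natDegree ∈ Set.Iic d := Set.mem_Iic.2 (by omega)
      exact ⟨h1, Set.mem_biUnion h1 (hlg1 c hc), Set.mem_biUnion h2 (hlh1 c hc)⟩)
  set J : Set F := {c ∈ I | ((g c).natDegree, lg c, lh c) = (m, l₁, l₂)} with hJdef
  have hJI : ∀ c ∈ J, c ∈ I := fun c hc => hc.1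
  have hJ1 : ∀ c ∈ J, (g c).natDegree = m := fun c hc => congrArg Prod.fst hc.2
  have hJ2 : ∀ c ∈ J, lg c = l₁ := fun c hc => congrArg (fun x => x.2.1) hc.2
  have hJ3 : ∀ c ∈ J, lh c = l₂ := fun c hc => congrArg (fun x => x.2.2) hc.2
  have hJ4 : ∀ c ∈ J, (h c).natDegree = d - m := fun c hc => by
    have := hdeg c (hJI c hc); have := hJ1 c hc; omega
  obtain ⟨c₀, hc₀⟩ := hJ.nonempty
  have hmd : m ≤ d := by have := hdeg c₀ (hJI _ hc₀); have := hJ1 _ hc₀; omega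
  obtain ⟨Y₁, hY₁, hYd₁, hYe₁⟩ := exists_monic_interpolation (A := A) i hi S hS hJ w e m M
    (Nat.lt_succ_of_le (Nat.mul_le_mul_left e hmd))
    (fun c hc => hw c (hJI c hc)) z (fun c hc => hz c (hJI c hc))
    (fun c hc => hzw c (hJI c hc)) g (fun c hc => hg c (hJI c hc)) hJ1
    (fun c hc => hgS c (hJI c hc)) l₁ (fun c hc => hJ2 c hc ▸ hlg2 c (hJI c hc))
  obtain ⟨Y₂, hY₂, hYd₂, hYe₂⟩ := exists_monic_interpolation (A := A) i hi S hS hJ w e (d - m) M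
    (Nat.lt_succ_of_le (Nat.mul_le_mul_left e (Nat.sub_le d m)))
    (fun c hc => hw c (hJI c hc)) z (fun c hc => hz c (hJI c hc))
    (fun c hc => hzw c (hJI c hc)) h (fun c hc => hh c (hJI c hc)) hJ4
    (fun c hc => hhS c (hJI c hc)) l₂ (fun c hc => hJ3 c hc ▸ hlh2 c (hJI c hc))
  refine ⟨Y₁, Y₂, hY₁, hY₂, ?_, ?_, ?_⟩
  · rw [hYd₁, ← hJ1 c₀ hc₀]; exact hg0 _ (hJI _ hc₀)
  · rw [hYd₂, ← hJ4 c₀ hc₀]; exact hh0 _ (hJI _ hc₀)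
  · ext1 n
    refine eq_of_infinite_eval_eq _ _ ((hJ.image
      (f := fun c => w + algebraMap F Fs c) (fun a _ b _ hab =>
        (algebraMap F Fs).injective (add_left_cancel hab))).mono ?_)
    rintro _ ⟨c, hc, rfl⟩
    have h1 : (Y₁ * Y₂).map (evalRingHom (w + algebraMap F Fs c)) =
        (G.map (mapRingHom (algebraMap F Fs))).map (evalRingHom (w + algebraMap F Fs c)) := by
      rw [Polynomial.map_mul, hYe₁ c hc, hYe₂ c hc, hgh c (hJI c hc), map_map]
      congr 1
      ext <;> simp
    simpa only [coeff_map, coe_evalRingHom, Set.mem_ofPred_eq] using congrArg (fun p => p.coeff n) h1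

end Core

/-! ### Inverting the variable -/

section InvertVariable

variable {F : Type*} [Field F]

/-- A bound for the degrees in `Z` of the coefficients of `f(Z, X)`. -/
def coeffDegree (f : F[X][X]) : ℕ := f.support.sup fun i => (f.coeff i).natDegree

/-- The polynomial `Y ^ (e d) f(1 / Y, X / Y ^ e)` where `d` is the degree of `f` in `X` and `e` is
a bound for the degrees of the coefficients. -/
def invertVar (f : F[X][X]) : F[X][X] :=
  ∑ i ∈ Finset.range (f.natDegree + 1),
    C (reflect (coeffDegree f * (f.natDegree - i)) (f.coeff i)) * X ^ i

theorem natDegree_coeff_le_coeffDegree (f : F[X][X]) (i : ℕ) :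
    (f.coeff i).natDegree ≤ coeffDegree f := by
  by_cases h : i ∈ f.support
  · exact Finset.le_sup (f := fun i => (f.coeff i).natDegree) h
  · rw [notMem_support_iff.1 h, natDegree_zero]; exact Nat.zero_le _

theorem coeff_invertVar (f : F[X][X]) (n : ℕ) : (invertVar f).coeff n =
    reflect (coeffDegree f * (f.natDegree - n)) (f.coeff n) := by
  simp only [invertVar, finsetSum_coeff, coeff_C_mul, coeff_X_pow, mul_ite, mul_one, mul_zero]
  rw [Finset.sum_ite_eq, ite_eq_left_iff]
  intro h
  rw [coeff_eq_zero_of_natDegree_lt (by simpa using h), reflect_zero]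

/-- Reflection at `N` evaluates to `x^N` times the value at `x⁻¹` when `N` bounds the degree. Below
the top degree `N` is at least the bound for the coefficients; in the top degree `N = 0` and the
coefficient is 1. -/
theorem map_invertVar {f : F[X][X]} (hf : f.Monic) {K : Type*} [Field K] (φ : F →+* K) {x : K}
    (hx : x ≠ 0) : (invertVar f).map (eval₂RingHom φ x) =
      (f.map (eval₂RingHom φ x⁻¹)).scaleRoots (x ^ coeffDegree f) := by
  ext n
  rw [coeff_map, coeff_scaleRoots, coeff_map, coeff_invertVar, hf.natDegree_map, ← pow_mul]
  rcases eq_or_ne n f.natDegree with rfl | hn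
  · rw [hf.coeff_natDegree]; simp
  rcases Nat.lt_or_ge f.natDegree n with h | h
  · rw [coeff_eq_zero_of_natDegree_lt h]; simp
  have hle : (f.coeff n).natDegree ≤ coeffDegree f * (f.natDegree - n) :=
    (natDegree_coeff_le_coeffDegree f n).trans (Nat.le_mul_of_pos_right _ (by omega))
  let inv : Invertible x⁻¹ := ⟨x, mul_inv_cancel₀ hx, inv_mul_cancel₀ hx⟩
  have := eval₂_reflect_mul_pow φ x⁻¹ _ (f.coeff n) hle
  change eval₂ φ x _ * _ = _ at this
  rw [coe_eval₂RingHom, coe_eval₂RingHom, ← this, mul_assoc, ← mul_pow, inv_mul_cancel₀ hx,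
    one_pow, mul_one]

theorem monic_invertVar {f : F[X][X]} (hf : f.Monic) : (invertVar f).Monic := by
  have hd : (invertVar f).natDegree ≤ f.natDegree := natDegree_le_iff_coeff_eq_zero.2 fun n hn => by
    rw [coeff_invertVar, coeff_eq_zero_of_natDegree_lt hn, reflect_zero]
  refine monic_of_natDegree_le_of_coeff_eq_one _ hd ?_
  rw [coeff_invertVar, hf.coeff_natDegree]
  simp

/-- At `Y = 1/Z` the inverted polynomial is `f` with scaled roots, so its factors scale back to
factors of `f` of positive degree over `F(Z)`. Gauss's lemma for the monic `f` leads back to `F[Z]`.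
-/
theorem not_irreducible_of_invertVar_eq_mul {f : F[X][X]} (hf : f.Monic) {g h : F[X][X]}
    (hg : g.Monic) (hh : h.Monic) (hg0 : g.natDegree ≠ 0) (hh0 : h.natDegree ≠ 0)
    (hgh : g * h = invertVar f) : ¬ Irreducible f := by
  intro hirr
  let K := FractionRing F[X]
  rw [hf.irreducible_iff_irreducible_map_fraction_map (K := K)] at hirr
  set x : K := (algebraMap F[X] K X)⁻¹ with hx
  have hx0 : x ≠ 0 := inv_ne_zero (by simp)
  set φ : F →+* K := (algebraMap F[X] K).comp C with hφ
  have h1 : eval₂RingHom φ x⁻¹ = algebraMap F[X] K := by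
    rw [hx, inv_inv]
    ext <;> simp [hφ]
  have h2 := map_invertVar hf φ hx0
  rw [h1, ← hgh, Polynomial.map_mul] at h2
  set y := x ^ coeffDegree f with hy
  have hy0 : y ≠ 0 := pow_ne_zero _ hx0
  have h3 : f.map (algebraMap F[X] K) =
      (g.map (eval₂RingHom φ x)).scaleRoots y⁻¹ * (h.map (eval₂RingHom φ x)).scaleRoots y⁻¹ := by
    rw [← mul_scaleRoots_of_noZeroDivisors, h2, ← scaleRoots_mul, mul_inv_cancel₀ hy0,
      scaleRoots_one]
  have hdeg : ∀ p : F[X][X], p.Monic → p.natDegree ≠ 0 →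
      ¬ IsUnit ((p.map (eval₂RingHom φ x)).scaleRoots y⁻¹) := fun p hp hp0 hu => by
    have := natDegree_eq_zero_of_isUnit hu
    rw [natDegree_scaleRoots, hp.natDegree_map] at this
    exact hp0 this
  rcases hirr.isUnit_or_isUnit h3 with hu | hu
  · exact hdeg g hg hg0 hu
  · exact hdeg h hh hh0 hu

end InvertVariable

/-! ### Denominators of factors -/

section Integrality

variable (R : Type*) {F : Type*} [CommRing R] [Field F] [Algebra R F]
  [IsFractionRing R F]

/-- With `b` a common denominator, scaling the roots by `b` multiplies every coefficient below the
leading 1 by a positive power of `b`. -/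
theorem exists_scaleRoots_eq_map [IsDomain R] (G : F[X][X]) (hG : G.Monic) :
    ∃ b : R, b ≠ 0 ∧ ∃ H : R[X][X], H.Monic ∧
      H.map (mapRingHom (algebraMap R F)) = G.scaleRoots (C (algebraMap R F b)) := by
  classical
  obtain ⟨b, hb⟩ := IsLocalization.exist_integer_multiples_of_finset (nonZeroDivisors R)
    (G.support.biUnion fun i => (G.coeff i).support.image (G.coeff i).coeff)
  have hb' : ∀ i j, ∃ r : R, algebraMap R F r = (G.coeff i).coeff j * algebraMap R F b := by
    intro i j
    by_cases hi : i ∈ G.support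
    · by_cases hj : j ∈ (G.coeff i).support
      · obtain ⟨r, hr⟩ := hb ((G.coeff i).coeff j)
          (Finset.mem_biUnion.2 ⟨i, hi, Finset.mem_image_of_mem _ hj⟩)
        exact ⟨r, by rw [hr, Algebra.smul_def, mul_comm]⟩
      · exact ⟨0, by rw [notMem_support_iff.1 hj]; simp⟩
    · exact ⟨0, by rw [notMem_support_iff.1 hi]; simp⟩
  have hlift : G.scaleRoots (C (algebraMap R F b)) ∈ lifts (mapRingHom (algebraMap R F)) := by
    rw [lifts_iff_coeff_lifts]
    intro i
    rw [coeff_scaleRoots, ← C_pow, ← map_pow]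
    rcases Nat.lt_or_ge i G.natDegree with h | h
    · obtain ⟨m, hm⟩ := Nat.exists_eq_succ_of_ne_zero (Nat.sub_ne_zero_of_lt h)
      have : G.coeff i * C (algebraMap R F (b ^ (G.natDegree - i))) ∈ lifts (algebraMap R F) := by
        rw [lifts_iff_coeff_lifts]
        intro j
        obtain ⟨r, hr⟩ := hb' i j
        refine ⟨r * b ^ m, ?_⟩
        rw [coeff_mul_C, hm, map_mul, hr, pow_succ']
        simp [mul_assoc]
      obtain ⟨q, hq⟩ := this
      exact ⟨q, hq⟩
    · rcases h.eq_or_lt with h | h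
      · refine ⟨1, ?_⟩
        rw [← h, hG.coeff_natDegree]
        simp
      · exact ⟨0, by rw [coeff_eq_zero_of_natDegree_lt h]; simp⟩
  obtain ⟨H, hH, -, hHm⟩ := lifts_and_natDegree_eq_and_monic hlift
    ((monic_scaleRoots_iff _).2 hG)
  exact ⟨b, nonZeroDivisors.coe_ne_zero b, H, hHm, hH⟩

variable {R} in
-- The scaled factor divides a monic polynomial over the integrally closed ring `R`, hence has
-- coefficients in `R`. The denominator does not depend on `r`, so it can serve a whole sequence of
-- specializations.
theorem exists_algebraMap_eq_coeff_mul_pow [IsIntegrallyClosed R] {G : F[X][X]} {b : R}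
    {H : R[X][X]} (hH : H.Monic)
    (hHG : H.map (mapRingHom (algebraMap R F)) = G.scaleRoots (C (algebraMap R F b)))
    (hG : G.Monic) (r : R) {g : F[X]} (hg : g.Monic)
    (hdvd : g ∣ G.map (evalRingHom (algebraMap R F r))) (l : ℕ) :
    ∃ s : R, algebraMap R F s = g.coeff l * algebraMap R F b ^ (g.natDegree - l) := by
  have h1 : (H.map (evalRingHom r)).map (algebraMap R F) =
      (G.map (evalRingHom (algebraMap R F r))).scaleRoots (algebraMap R F b) := by
    have : (H.map (mapRingHom (algebraMap R F))).map (evalRingHom (algebraMap R F r)) =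
        (H.map (evalRingHom r)).map (algebraMap R F) := by
      rw [map_map, map_map]
      congr 1
      ext <;> simp
    rw [← this, hHG, map_scaleRoots _ _ _ (by rw [hG.leadingCoeff]; simp)]
    simp
  have h2 : g.scaleRoots (algebraMap R F b) ∣ (H.map (evalRingHom r)).map (algebraMap R F) := by
    rw [h1]; exact scaleRoots_dvd _ _ hdvd
  obtain ⟨g', hg'⟩ := IsIntegrallyClosed.eq_map_mul_C_of_dvd F (hH.map _) h2
  rw [((monic_scaleRoots_iff _).2 hg).leadingCoeff, C_1, mul_one] at hg'
  exact ⟨g'.coeff l, by rw [← coeff_map, hg', coeff_scaleRoots]⟩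

end Integrality

open Filter

/-! ### Polynomials over sequences modulo an ultrafilter -/

section Sequences

variable {F Fs : Type*} [Field F] [Field Fs] {U : Ultrafilter ℕ} {π : (ℕ → F) →+* Fs}

theorem map_eq_zero_of_eventually (hπ : ∀ x, π x = 0 ↔ ∀ᶠ N in U, x N = 0) {q : (ℕ → F)[X]}
    (hq : ∀ᶠ N in U, q.map (Pi.evalRingHom _ N) = 0) : q.map π = 0 := by
  ext n
  rw [coeff_map, coeff_zero, hπ]
  filter_upwards [hq] with N hN
  simpa using congrArg (fun p => p.coeff n) hN

theorem eventually_map_map_eq_zero (hπ : ∀ x, π x = 0 ↔ ∀ᶠ N in U, x N = 0) {q : (ℕ → F)[X][X]}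
    (hq : q.map (mapRingHom π) = 0) :
    ∀ᶠ N in U, q.map (mapRingHom (Pi.evalRingHom _ N)) = 0 := by
  have h1 : ∀ i j, ∀ᶠ N in U, (q.coeff i).coeff j N = 0 := fun i j => by
    rw [← hπ]
    simpa using congrArg (fun p => (p.coeff i).coeff j) hq
  have h2 : ∀ᶠ N in U, ∀ i ∈ q.support, ∀ j ∈ (q.coeff i).support, (q.coeff i).coeff j N = 0 := by
    rw [eventually_all_finset]
    intro i _
    rw [eventually_all_finset]
    exact fun j _ => h1 i j
  filter_upwards [h2] with N hN
  ext i j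
  rw [coeff_map, coe_mapRingHom, coeff_map, coeff_zero, coeff_zero]
  by_cases hi : i ∈ q.support
  · by_cases hj : j ∈ (q.coeff i).support
    · exact hN i hi j hj
    · rw [notMem_support_iff.1 hj, map_zero]
  · rw [notMem_support_iff.1 hi, coeff_zero, map_zero]

/-- Łoś's principle: lift the two factors to monic polynomials over sequences. The product formula
amounts to finitely many coefficient equations, so it holds at almost every index, and one such
index suffices. -/
theorem exists_factorization_of_eventually (hsurj : Function.Surjective π)
    (hπ : ∀ x, π x = 0 ↔ ∀ᶠ N in U, x N = 0) (G : F[X][X]) {g h : Fs[X][X]}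
    (hg : g.Monic) (hh : h.Monic) (hgh : g * h = G.map (mapRingHom (π.comp (Pi.constRingHom ℕ F)))) :
    ∃ g' h' : F[X][X], g'.Monic ∧ h'.Monic ∧ g'.natDegree = g.natDegree ∧
      h'.natDegree = h.natDegree ∧ g' * h' = G := by
  have hlift : ∀ p : Fs[X][X], p ∈ lifts (mapRingHom π) := fun p => by
    obtain ⟨q, hq⟩ := map_surjective (mapRingHom π) (map_surjective π hsurj) p
    exact ⟨q, hq⟩
  obtain ⟨g₁, hg₁, hgd, hgm⟩ := lifts_and_natDegree_eq_and_monic (hlift g) hg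
  obtain ⟨h₁, hh₁, hhd, hhm⟩ := lifts_and_natDegree_eq_and_monic (hlift h) hh
  have h0 : (g₁ * h₁ - G.map (mapRingHom (Pi.constRingHom ℕ F))).map (mapRingHom π) = 0 := by
    rw [Polynomial.map_sub, Polynomial.map_mul, hg₁, hh₁, hgh, Polynomial.map_map, mapRingHom_comp, sub_self]
  obtain ⟨N, hN⟩ := (eventually_map_map_eq_zero hπ h0).exists
  rw [Polynomial.map_sub, Polynomial.map_mul, Polynomial.map_map, mapRingHom_comp, sub_eq_zero] at hN
  refine ⟨_, _, hgm.map _, hhm.map _, (hgm.natDegree_map _).trans hgd,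
    (hhm.natDegree_map _).trans hhd, hN.trans ?_⟩
  have : (Pi.evalRingHom (fun _ => F) N).comp (Pi.constRingHom ℕ F) = RingHom.id F := rfl
  rw [this, mapRingHom_id, Polynomial.map_id]

/-- The monic polynomial of degree `d` whose coefficients are the sequences of coefficients of the
given polynomials. -/
def seqPoly (g : ℕ → F[X]) (d : ℕ) : (ℕ → F)[X] :=
  X ^ d + ∑ l ∈ Finset.range d, C (fun N => (g N).coeff l) * X ^ l

theorem map_seqPoly (g : ℕ → F[X]) (d N : ℕ) (hg : (g N).Monic) (hd : (g N).natDegree = d) :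
    (seqPoly g d).map (Pi.evalRingHom _ N) = g N := by
  conv_rhs => rw [hg.as_sum, hd]
  simp [seqPoly, Polynomial.map_sum]

theorem monic_seqPoly (g : ℕ → F[X]) (d : ℕ) : (seqPoly g d).Monic :=
  monic_X_pow_add (degree_sum_range_lt _ _)

theorem natDegree_seqPoly (g : ℕ → F[X]) (d : ℕ) : (seqPoly g d).natDegree = d := by
  refine natDegree_eq_of_degree_eq_some ?_
  rw [seqPoly, degree_add_eq_left_of_degree_lt
    (by rw [degree_X_pow]; exact degree_sum_range_lt _ _), degree_X_pow]

theorem coeff_seqPoly (g : ℕ → F[X]) (d N l : ℕ) (hg : (g N).Monic) (hd : (g N).natDegree = d) :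
    (seqPoly g d).coeff l N = (g N).coeff l := by
  conv_rhs => rw [← map_seqPoly g d N hg hd]
  rw [coeff_map]
  rfl

end Sequences

section Ultrapower

theorem exists_ultrapower.{u} (F : Type u) [Field F] (U : Ultrafilter ℕ) :
    ∃ (Fs : Type u) (_ : Field Fs) (π : (ℕ → F) →+* Fs), Function.Surjective π ∧
      ∀ x, π x = 0 ↔ ∀ᶠ N in U, x N = 0 :=
  ⟨Germ (U : Filter ℕ) F, inferInstance, Germ.coeRingHom (U : Filter ℕ), Quot.mk_surjective,
    fun _ => Germ.coe_eq⟩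

end Ultrapower

end HilbertIrreducibility

namespace HilbertIrreducibility

open Filter

/-! ### A valuation ring that makes `w` infinite -/

section Place

variable {F Fs A Γ₀ : Type*} [Field F] [Field Fs] [Field A] [Algebra Fs A]
  [LinearOrderedCommGroupWithZero Γ₀] (v : Valuation F Γ₀) {U : Ultrafilter ℕ}
  (π : (ℕ → F) →+* Fs)

/-- The subring of the ultrapower consisting of the classes of `v`-bounded sequences. -/
def boundedSubring (U : Ultrafilter ℕ) : Subring (ℕ → F) where
  carrier := {x | ∃ a, ∀ᶠ N in U, v (x N) ≤ v a}
  zero_mem' := ⟨0, Eventually.of_forall fun _ => by simp⟩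
  one_mem' := ⟨1, Eventually.of_forall fun _ => le_rfl⟩
  neg_mem' := by
    rintro x ⟨a, ha⟩
    exact ⟨a, ha.mono fun N hN => by simpa using hN⟩
  add_mem' := by
    rintro x y ⟨a, ha⟩ ⟨b, hb⟩
    rcases le_total (v a) (v b) with h | h
    · exact ⟨b, ha.mp (hb.mono fun N h1 h2 => v.map_add_le (h2.trans h) h1)⟩
    · exact ⟨a, ha.mp (hb.mono fun N h1 h2 => v.map_add_le h2 (h1.trans h))⟩
  mul_mem' := by
    rintro x y ⟨a, ha⟩ ⟨b, hb⟩
    refine ⟨a * b, ha.mp (hb.mono fun N h1 h2 => ?_)⟩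
    simpa using mul_le_mul' h2 h1

variable (A) {π} in
-- If `w⁻¹` were a unit in the ring of bounded classes, its inverse would be bounded and agree with
-- `w` almost everywhere, yet `w` exceeds every bound. Hence `w⁻¹` generates a proper ideal, and
-- some valuation ring of `A` contains the bounded classes and has `w⁻¹` as a nonunit.
theorem exists_valuationSubring (hπ : ∀ x, π x = 0 ↔ ∀ᶠ N in U, x N = 0)
    (w : ℕ → F) (hw : ∀ a, ∀ᶠ N in U, v a < v (w N)) :
    ∃ O : ValuationSubring A, (∀ x ∈ boundedSubring v U, algebraMap Fs A (π x) ∈ O) ∧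
      algebraMap Fs A (π w) ∉ O := by
  set ψ : (ℕ → F) →+* A := (algebraMap Fs A).comp π with hψ
  have hψ0 : ∀ x, ψ x = 0 ↔ ∀ᶠ N in U, x N = 0 := fun x => by
    rw [hψ, RingHom.comp_apply, _root_.map_eq_zero, hπ]
  have hw0 : ∀ᶠ N in U, w N ≠ 0 := (hw 0).mono fun N hN h => by simp [h] at hN
  have hinv : ψ w * ψ (fun N => (w N)⁻¹) = 1 := by
    rw [← map_mul, ← sub_eq_zero, ← map_one ψ, ← map_sub, hψ0]
    exact hw0.mono fun N hN => by simp [hN]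
  have hwinv : (fun N => (w N)⁻¹) ∈ boundedSubring v U :=
    ⟨1, (hw 1).mono fun N hN => by
      rw [map_inv₀, map_one] at *; exact (inv_lt_one_of_one_lt₀ hN).le⟩
  set B : Subring A := (boundedSubring v U).map ψ with hB
  set z : B := ⟨ψ fun N => (w N)⁻¹, _, hwinv, rfl⟩ with hz
  have hz1 : Ideal.span {z} ≠ ⊤ := by
    intro h
    obtain ⟨⟨_, y, ⟨a, ha⟩, rfl⟩, hy⟩ := Ideal.mem_span_singleton'.1 ((Ideal.eq_top_iff_one _).1 h)
    have h1 : ψ y * ψ (fun N => (w N)⁻¹) = 1 := congrArg Subtype.val hy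
    have h2 : ψ (y - w) = 0 := by
      rw [map_sub, sub_eq_zero]
      exact mul_right_cancel₀ (right_ne_zero_of_mul_eq_one hinv) (h1.trans hinv.symm)
    rw [hψ0] at h2
    obtain ⟨N, h3, h4, h5⟩ := (h2.and (ha.and (hw a))).exists
    rw [Pi.sub_apply, sub_eq_zero] at h3
    exact absurd (h3 ▸ h4) (not_le.2 h5)
  obtain ⟨O, hO, hO'⟩ := Ideal.image_subset_nonunits_valuationSubring _ hz1
  refine ⟨O, fun x hx => hO ⟨x, hx, rfl⟩, fun hwO => ?_⟩
  have h1 : (z : A) ∈ O.nonunits := hO' ⟨z, Ideal.mem_span_singleton_self z, rfl⟩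
  rw [ValuationSubring.mem_nonunits_iff] at h1
  have h2 := (O.valuation_le_one_iff _).2 hwO
  have h3 := congrArg O.valuation hinv
  rw [map_mul, map_one] at h3
  exact absurd h3 ((mul_le_of_le_one_left' h2).trans_lt h1).ne

end Place

/-! ### Classes with a common denominator -/

section Denominators

/-- The elements of an ultrapower of `F = Frac R` that become classes of sequences in `R` after
multiplication with a nonzero element of `R`. -/
def almostIntegral (R : Type*) {F Fs : Type*} [CommRing R] [IsDomain R] [Field F] [Algebra R F]
    [IsFractionRing R F] [Field Fs] [Algebra F Fs] (π : (ℕ → F) →+* Fs)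
    (hF : ∀ a, algebraMap F Fs a = π fun _ => a) : Subalgebra F Fs where
  carrier := {x | ∃ b : R, b ≠ 0 ∧ ∃ r : ℕ → R,
    algebraMap F Fs (algebraMap R F b) * x = π fun N => algebraMap R F (r N)}
  algebraMap_mem' a := by
    obtain ⟨p, q, hq, rfl⟩ := IsFractionRing.div_surjective (A := R) a
    refine ⟨q, nonZeroDivisors.ne_zero hq, fun _ => p, ?_⟩
    rw [← map_mul, mul_div_cancel₀ _ (IsFractionRing.to_map_ne_zero_of_mem_nonZeroDivisors hq), hF]
  add_mem' := by
    rintro x y ⟨b, hb, r, hr⟩ ⟨c, hc, s, hs⟩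
    refine ⟨b * c, mul_ne_zero hb hc, fun N => c * r N + b * s N, ?_⟩
    have : (fun N => algebraMap R F (c * r N + b * s N)) =
        (fun _ => algebraMap R F c) * (fun N => algebraMap R F (r N)) +
        (fun _ => algebraMap R F b) * fun N => algebraMap R F (s N) := by
      ext N; simp
    rw [this, map_add π, map_mul π, map_mul π, ← hr, ← hs, ← hF, ← hF, map_mul, map_mul]
    ring
  mul_mem' := by
    rintro x y ⟨b, hb, r, hr⟩ ⟨c, hc, s, hs⟩
    refine ⟨b * c, mul_ne_zero hb hc, fun N => r N * s N, ?_⟩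
    have : (fun N => algebraMap R F (r N * s N)) =
        (fun N => algebraMap R F (r N)) * fun N => algebraMap R F (s N) := by
      ext N; simp
    rw [this, map_mul π, ← hr, ← hs, map_mul, map_mul]
    ring

end Denominators

end HilbertIrreducibility

/-! ### Irreducible specialization by passing to an ultrapower -/

namespace HilbertIrreducibility

open Filter

/-- A factorization of `f` at `1/r_N` rescales to one of the inverted polynomial at `r_N`. The
degrees take finitely many values, so the ultrafilter fixes them, and one element `b` clears the
denominators for all `N` at once. -/
theorem exists_almostIntegral_factorization {R F Fs : Type*} [CommRing R] [IsDomain R]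
    [IsIntegrallyClosed R] [Field F] [Algebra R F] [IsFractionRing R F] [Field Fs] [Algebra F Fs]
    {π : (ℕ → F) →+* Fs} (hF : ∀ a, algebraMap F Fs a = π fun _ => a) {U : Ultrafilter ℕ}
    (hπ : ∀ x, π x = 0 ↔ ∀ᶠ N in U, x N = 0) {f : F[X][X]} (hf : f.Monic) (hirr : Irreducible f)
    (r : ℕ → R) (hr : ∀ᶠ N in U, r N ≠ 0)
    (hred : ∀ᶠ N in U, ¬ Irreducible (f.map (evalRingHom (algebraMap R F (r N))⁻¹))) :
    ∃ g h : Fs[X], g.Monic ∧ h.Monic ∧ g.natDegree ≠ 0 ∧ h.natDegree ≠ 0 ∧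
      (∀ l, g.coeff l ∈ almostIntegral R π hF) ∧ (∀ l, h.coeff l ∈ almostIntegral R π hF) ∧
      g * h = (invertVar f).map
        (eval₂RingHom (algebraMap F Fs) (π fun N => algebraMap R F (r N))) := by
  set G := invertVar f with hGdef
  have hG : G.Monic := monic_invertVar hf
  have hf0 : f.natDegree ≠ 0 := fun h => hirr.not_isUnit (by
    rw [hf.natDegree_eq_zero.1 h]; exact isUnit_one)
  have h1 : ∀ᶠ N in U, ∃ g h : F[X], g.Monic ∧ h.Monic ∧ g.natDegree ≠ 0 ∧ h.natDegree ≠ 0 ∧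
      g * h = G.map (evalRingHom (algebraMap R F (r N))) := by
    filter_upwards [hr, hred] with N hN hN'
    set x := algebraMap R F (r N) with hx
    have hx0 : x ≠ 0 := by
      simpa [hx] using hN
    have hm : (f.map (evalRingHom x⁻¹)).Monic := hf.map _
    have h1 : f.map (evalRingHom x⁻¹) ≠ 1 := fun h => by
      have := congrArg natDegree h
      rw [hf.natDegree_map, natDegree_one] at this
      exact hf0 this
    rw [hm.irreducible_iff_natDegree] at hN'
    push Not at hN'
    obtain ⟨a, b, ha, hb, hab, ha0, hb0⟩ := hN' h1
    refine ⟨a.scaleRoots (x ^ coeffDegree f), b.scaleRoots (x ^ coeffDegree f),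
      (monic_scaleRoots_iff _).2 ha, (monic_scaleRoots_iff _).2 hb, ?_, ?_, ?_⟩
    · rwa [natDegree_scaleRoots]
    · rwa [natDegree_scaleRoots]
    · rw [← mul_scaleRoots_of_noZeroDivisors, hab]
      exact (map_invertVar hf (RingHom.id F) hx0).symm
  -- Indices without a factorization get the pair `0, 0`, which the ultrafilter ignores.
  have h2 : ∀ N, ∃ g h : F[X], (∃ g h : F[X], g.Monic ∧ h.Monic ∧ g.natDegree ≠ 0 ∧
      h.natDegree ≠ 0 ∧ g * h = G.map (evalRingHom (algebraMap R F (r N)))) →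
      g.Monic ∧ h.Monic ∧ g.natDegree ≠ 0 ∧ h.natDegree ≠ 0 ∧
      g * h = G.map (evalRingHom (algebraMap R F (r N))) := fun N => by
    by_cases h : ∃ g h : F[X], g.Monic ∧ h.Monic ∧ g.natDegree ≠ 0 ∧
      h.natDegree ≠ 0 ∧ g * h = G.map (evalRingHom (algebraMap R F (r N)))
    · obtain ⟨g, h, hh⟩ := h
      exact ⟨g, h, fun _ => hh⟩
    · exact ⟨0, 0, fun h' => absurd h' h⟩
  choose g h hgh using h2
  have h3 : ∀ᶠ N in U, (g N).Monic ∧ (h N).Monic ∧ (g N).natDegree ≠ 0 ∧ (h N).natDegree ≠ 0 ∧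
      g N * h N = G.map (evalRingHom (algebraMap R F (r N))) := h1.mono hgh
  have hdeg : ∀ᶠ N in U, (g N).natDegree + (h N).natDegree = G.natDegree :=
    h3.mono fun N hN => by
      rw [← hN.1.natDegree_mul hN.2.1, hN.2.2.2.2, hG.natDegree_map]
  obtain ⟨s, -, hs⟩ := (Ultrafilter.eventually_exists_mem_iff (Set.finite_Iic G.natDegree)
    (P := fun s N => (g N).natDegree = s) (f := U)).1
      (hdeg.mono fun N hN => ⟨_, Set.mem_Iic.2 (by omega), rfl⟩)
  have ht : ∀ᶠ N in U, (h N).natDegree = G.natDegree - s :=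
    hdeg.mp (hs.mono fun N h1 h2 => by omega)
  obtain ⟨b, hb, H, hH, hHG⟩ := exists_scaleRoots_eq_map R G hG
  have hcoeff : ∀ (p : ℕ → F[X]) (d : ℕ), (∀ᶠ N in U, (p N).Monic ∧ (p N).natDegree = d ∧
      p N ∣ G.map (evalRingHom (algebraMap R F (r N)))) → ∀ l,
      ((seqPoly p d).map π).coeff l ∈ almostIntegral R π hF := fun p d hp l => by
    have h4 : ∀ N, ∃ t : R, ((p N).Monic ∧ (p N).natDegree = d ∧
        p N ∣ G.map (evalRingHom (algebraMap R F (r N)))) →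
        algebraMap R F t = (p N).coeff l * algebraMap R F b ^ (d - l) := fun N => by
      by_cases hN : (p N).Monic ∧ (p N).natDegree = d ∧
        p N ∣ G.map (evalRingHom (algebraMap R F (r N)))
      · obtain ⟨t, ht⟩ := exists_algebraMap_eq_coeff_mul_pow hH hHG hG (r N) hN.1 hN.2.2 l
        exact ⟨t, fun _ => by rw [ht, hN.2.1]⟩
      · exact ⟨0, fun h => absurd h hN⟩
    choose t ht using h4
    refine ⟨b ^ (d - l), pow_ne_zero _ hb, t, ?_⟩
    rw [hF, coeff_map, ← map_mul, ← sub_eq_zero, ← map_sub, hπ]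
    filter_upwards [hp] with N hN
    rw [Pi.sub_apply, Pi.mul_apply, coeff_seqPoly p d N l hN.1 hN.2.1, ht N hN, map_pow]
    ring
  obtain ⟨N₀, hN₀, hN₁, hN₂⟩ := (h3.and (hs.and ht)).exists
  refine ⟨(seqPoly g s).map π, (seqPoly h (G.natDegree - s)).map π, (monic_seqPoly _ _).map _,
    (monic_seqPoly _ _).map _, ?_, ?_, hcoeff g s ?_, hcoeff h _ ?_, ?_⟩
  · rw [(monic_seqPoly _ _).natDegree_map, natDegree_seqPoly, ← hN₁]
    exact hN₀.2.2.1
  · rw [(monic_seqPoly _ _).natDegree_map, natDegree_seqPoly, ← hN₂]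
    exact hN₀.2.2.2.1
  · filter_upwards [h3, hs] with N h4 h5
    exact ⟨h4.1, h5, Dvd.intro _ h4.2.2.2.2⟩
  · filter_upwards [h3, ht] with N h4 h5
    exact ⟨h4.2.1, h5, Dvd.intro_left _ h4.2.2.2.2⟩
  · have h5 : (seqPoly g s * seqPoly h (G.natDegree - s) - G.map (eval₂RingHom
        (Pi.constRingHom ℕ F) fun N => algebraMap R F (r N))).map π = 0 := by
      refine map_eq_zero_of_eventually hπ ?_
      filter_upwards [h3, hs, ht] with N h4 h5 h6
      rw [Polynomial.map_sub, Polynomial.map_mul, map_seqPoly g s N h4.1 h5,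
        map_seqPoly h _ N h4.2.1 h6, h4.2.2.2.2, Polynomial.map_map, sub_eq_zero]
      congr 1
      ext <;> simp
    rw [Polynomial.map_sub, Polynomial.map_mul, sub_eq_zero] at h5
    rw [h5, Polynomial.map_map]
    congr 1
    ext x
    · simp only [RingHom.comp_apply, coe_eval₂RingHom, eval₂_C, hF]
      rfl
    · simp

/-- Otherwise the inverted polynomial factors at `w + c` in the ultrapower for every `c`, with
coefficients in `almostIntegral`. `exists_factorization_of_infinite` makes the factorization
polynomial in the variable, and descent to `F` contradicts the irreducibility of `f`. -/
theorem exists_irreducible_specialization {R F Γ₀ : Type*} [CommRing R] [IsDomain R]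
    [IsIntegrallyClosed R] [Field F] [Algebra R F] [IsFractionRing R F]
    [LinearOrderedCommGroupWithZero Γ₀] (v : Valuation F Γ₀)
    (hv : ∀ r : R, r ≠ 0 → 1 ≤ v (algebraMap R F r))
    (w : ℕ → R) (hw : ∀ a, ∀ᶠ N in atTop, v a < v (algebraMap R F (w N)))
    {C : Set R} (hC : C.Infinite) {f : F[X][X]} (hf : f.Monic) (hirr : Irreducible f)
    (hsep : (f.map (evalRingHom 0)).Separable) :
    ∃ c ∈ C, ∃ᶠ N in atTop,
      Irreducible (f.map (evalRingHom (algebraMap R F (w N + c))⁻¹)) := by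
  by_contra! hcon
  have hred : ∀ c ∈ C, ∀ᶠ N in atTop,
      ¬ Irreducible (f.map (evalRingHom (algebraMap R F (w N + c))⁻¹)) := fun c hc => by
    simpa only [not_frequently] using hcon c hc
  let U : Ultrafilter ℕ := hyperfilter ℕ
  have hU : (U : Filter ℕ) ≤ atTop := Nat.hyperfilter_le_atTop
  obtain ⟨Fs, _, π, hsurj, hπ⟩ := exists_ultrapower F U
  let _ : Algebra F Fs := (π.comp (Pi.constRingHom ℕ F)).toAlgebra
  have hF : ∀ a, algebraMap F Fs a = π fun _ => a := fun a => rfl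
  let A := AlgebraicClosure Fs
  obtain ⟨O, hO, hwO⟩ := exists_valuationSubring A v hπ (fun N => algebraMap R F (w N))
    fun a => hU (hw a)
  have hFO : ∀ a : F, algebraMap Fs A (algebraMap F Fs a) ∈ O := fun a =>
    hO _ ⟨a, Eventually.of_forall fun _ => le_rfl⟩
  let i : F →+* O := RingHom.codRestrict ((algebraMap Fs A).comp (algebraMap F Fs)) O hFO
  have hi : ∀ a, algebraMap O A (i a) = algebraMap Fs A (algebraMap F Fs a) := fun a => rfl
  -- For `s = r/b` nonzero, the inverse `b/r` is bounded by `v b`, because nonzero elements of `R`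
  -- have value at least 1. So `s⁻¹` lies in `O` and `s` is not infinitesimal.
  have hS : ∀ s ∈ almostIntegral R π hF, algebraMap Fs A s ∈ infinitesimals O A → s = 0 := by
    rintro s ⟨b, hb, r, hr⟩ ⟨y, hy, hys⟩
    by_contra hs0
    have hb0 : algebraMap F Fs (algebraMap R F b) ≠ 0 := by simpa using hb
    have hr0 : ¬ ∀ᶠ N in U, algebraMap R F (r N) = 0 := by
      rw [← hπ, ← hr]
      exact mul_ne_zero hb0 hs0
    rw [← Ultrafilter.eventually_not] at hr0
    have h1 : s * π (fun N => algebraMap R F b / algebraMap R F (r N)) = 1 := by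
      have h2 : π (fun N => algebraMap R F (r N)) *
          π (fun N => algebraMap R F b / algebraMap R F (r N)) =
            algebraMap F Fs (algebraMap R F b) := by
        rw [hF, ← map_mul, ← sub_eq_zero, ← map_sub, hπ]
        filter_upwards [hr0] with N hN
        simp [mul_div_cancel₀ _ hN]
      rw [← hr, mul_assoc] at h2
      exact mul_left_cancel₀ hb0 (by rw [h2, mul_one])
    have h3 : algebraMap Fs A (π fun N => algebraMap R F b / algebraMap R F (r N)) ∈ O := by
      refine hO _ ⟨algebraMap R F b, ?_⟩
      filter_upwards [hr0] with N hN
      rw [map_div₀]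
      exact div_le_of_le_mul₀ zero_le zero_le (le_mul_of_one_le_right' (hv _ fun h => hN (by rw [h, map_zero])))
    refine (IsLocalRing.mem_maximalIdeal _).1 hy (IsUnit.of_mul_eq_one ⟨_, h3⟩ (Subtype.ext ?_))
    have h4 := congrArg (algebraMap Fs A) h1
    rw [map_mul, map_one, ← hys] at h4
    exact h4
  set w₀ : Fs := π fun N => algebraMap R F (w N) with hw₀
  have hwc : ∀ c : F, algebraMap Fs A (w₀ + algebraMap F Fs c) ∉ O := fun c hc => hwO (by
    have := O.sub_mem hc (hFO c)
    rwa [map_add, add_sub_cancel_right] at this)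
  have hz : ∀ c : F, ∃ z : O, z ∈ IsLocalRing.maximalIdeal O ∧
      algebraMap O A z = (algebraMap Fs A (w₀ + algebraMap F Fs c))⁻¹ := fun c => by
    have h1 := (O.mem_or_inv_mem (algebraMap Fs A (w₀ + algebraMap F Fs c))).resolve_left (hwc c)
    refine ⟨⟨_, h1⟩, (IsLocalRing.mem_maximalIdeal _).2 fun hu => hwc c ?_, rfl⟩
    obtain ⟨u, hu⟩ := hu.exists_right_inv
    have h2 : (algebraMap Fs A (w₀ + algebraMap F Fs c))⁻¹ * (u : A) = 1 := congrArg Subtype.val hu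
    rw [← inv_inv (algebraMap Fs A (w₀ + algebraMap F Fs c)), ← eq_inv_of_mul_eq_one_right h2]
    exact u.2
  choose z hz hzw using hz
  have hw0 : ∀ c : F, w₀ + algebraMap F Fs c ≠ 0 := fun c h => hwc c (by
    rw [h, map_zero]; exact O.zero_mem)
  have hfac : ∀ c ∈ algebraMap R F '' C, ∃ g h : Fs[X], g.Monic ∧ h.Monic ∧ g.natDegree ≠ 0 ∧
      h.natDegree ≠ 0 ∧ (∀ l, g.coeff l ∈ almostIntegral R π hF) ∧
      (∀ l, h.coeff l ∈ almostIntegral R π hF) ∧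
      g * h = (invertVar f).map (eval₂RingHom (algebraMap F Fs) (w₀ + algebraMap F Fs c)) := by
    rintro _ ⟨c, hc, rfl⟩
    have h1 : ∀ᶠ N in U, w N + c ≠ 0 := by
      filter_upwards [hU (hw (algebraMap R F c))] with N hN h0
      rw [eq_neg_of_add_eq_zero_left h0, map_neg, Valuation.map_neg] at hN
      exact lt_irrefl _ hN
    have h2 := exists_almostIntegral_factorization hF hπ hf hirr (fun N => w N + c) h1
      (hU (hred c hc))
    have h3 : (π fun N => algebraMap R F (w N + c)) = w₀ + algebraMap F Fs (algebraMap R F c) := by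
      rw [hF, hw₀, ← map_add π]
      congr 1
      ext N
      simp
    rwa [h3] at h2
  choose! g h hg hh hg0 hh0 hgS hhS hgh using hfac
  obtain ⟨g', h', hg', hh', hg0', hh0', hgh'⟩ := exists_factorization_of_infinite (O := O) (A := A) i hi
    (almostIntegral R π hF) hS f (invertVar f) hf (coeffDegree f)
    (fun x hx => map_invertVar hf (algebraMap F Fs) hx) hsep
    (hC.image (IsFractionRing.injective R F).injOn) w₀ (fun c _ => hw0 c) z
    (fun c _ => hz c) (fun c _ => hzw c) g h hg hh hg0 hh0 hgS hhS hgh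
  obtain ⟨g₁, h₁, hg₁, hh₁, hgd, hhd, hgh₁⟩ := exists_factorization_of_eventually hsurj hπ
    (invertVar f) hg' hh' hgh'
  exact not_irreducible_of_invertVar_eq_mul hf hg₁ hh₁ (hgd ▸ hg0') (hhd ▸ hh0') hgh₁ hirr

end HilbertIrreducibility

namespace HilbertIrreducibility

open Filter EmbeddingProblem

/-! ### The degree valuation on `κ(T)(T_1, …, T_n)` -/

section RationalFunctions

attribute [local instance] MvPolynomial.algebraMvPolynomial

variable (κ k : Type*) [Field κ] [Field k] [Algebra κ[X] k] [IsFractionRing κ[X] k] (n : ℕ)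

theorem algebraMap_mvPolynomial_funField_injective :
    Function.Injective (algebraMap (MvPolynomial (Fin n) κ[X]) (FunField n k)) := by
  rw [IsScalarTower.algebraMap_eq (MvPolynomial (Fin n) κ[X]) (PolyRing n k) (FunField n k)]
  exact (IsFractionRing.injective (PolyRing n k) (FunField n k)).comp
    (MvPolynomial.map_injective _ (IsFractionRing.injective κ[X] k))

theorem isFractionRing_mvPolynomial_funField :
    IsFractionRing (MvPolynomial (Fin n) κ[X]) (FunField n k) := by
  have hinj := algebraMap_mvPolynomial_funField_injective κ k n
  have : FaithfulSMul (MvPolynomial (Fin n) κ[X]) (FunField n k) :=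
    (faithfulSMul_iff_algebraMap_injective _ _).2 hinj
  have key : ∀ p : PolyRing n k, ∃ (q : MvPolynomial (Fin n) κ[X]) (b : κ[X]), b ≠ 0 ∧
      algebraMap (PolyRing n k) (FunField n k) p =
        algebraMap _ (FunField n k) q / algebraMap _ (FunField n k) (MvPolynomial.C b :
          MvPolynomial (Fin n) κ[X]) := fun p => by
    obtain ⟨⟨q, ⟨_, b, hb, rfl⟩⟩, hq⟩ := IsLocalization.surj
      ((nonZeroDivisors κ[X]).map (MvPolynomial.C (σ := Fin n))) p
    have hb0 : b ≠ 0 := nonZeroDivisors.ne_zero hb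
    refine ⟨q, b, hb0, ?_⟩
    rw [eq_div_iff (fun h => hb0 (MvPolynomial.C_injective _ _
      (hinj (by rw [h, map_zero, map_zero])))),
      IsScalarTower.algebraMap_apply _ (PolyRing n k) (FunField n k) q, ← hq, map_mul,
      ← IsScalarTower.algebraMap_apply]
  refine IsFractionRing.of_field _ _ fun z => ?_
  obtain ⟨x, y, hy, rfl⟩ := IsFractionRing.div_surjective (A := PolyRing n k) z
  obtain ⟨q, b, hb, hx⟩ := key x
  obtain ⟨q', b', hb', hy'⟩ := key y
  refine ⟨q * MvPolynomial.C b', MvPolynomial.C b * q', ?_⟩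
  rw [hx, hy', div_div_div_eq, map_mul, map_mul]

/-- The inclusion of `κ[T][T_1, …, T_n]` into `κ(T_1, …, T_n)[T]`. -/
def mvPolynomialToPolynomial : MvPolynomial (Fin n) κ[X] →+* (FunField n κ)[X] :=
  MvPolynomial.eval₂Hom (mapRingHom (algebraMap κ (FunField n κ)))
    fun i => C (algebraMap (PolyRing n κ) (FunField n κ) (MvPolynomial.X i))

theorem mvPolynomialToPolynomial_injective :
    Function.Injective (mvPolynomialToPolynomial κ n) := by
  let ψ : MvPolynomial (Fin n) κ[X] →+* (PolyRing n κ)[X] :=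
    MvPolynomial.eval₂Hom (mapRingHom MvPolynomial.C) fun i => C (MvPolynomial.X i)
  -- `χ` puts the variables back in their places, so it is a left inverse before passing to
  -- fractions.
  let χ : (PolyRing n κ)[X] →+* MvPolynomial (Fin n) κ[X] :=
    eval₂RingHom (MvPolynomial.map C) (MvPolynomial.C X)
  have h1 : χ.comp ψ = RingHom.id _ := by
    refine MvPolynomial.ringHom_ext' ?_ fun i => ?_
    · ext <;> simp [ψ, χ]
    · simp [ψ, χ]
  have h2 : (mapRingHom (algebraMap (PolyRing n κ) (FunField n κ))).comp ψ =
      mvPolynomialToPolynomial κ n := by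
    refine MvPolynomial.ringHom_ext' ?_ fun i => ?_
    · ext
      · simp [ψ, mvPolynomialToPolynomial]
        rfl
      · simp [ψ, mvPolynomialToPolynomial]
    · simp [ψ, mvPolynomialToPolynomial]
  rw [← h2]
  refine (map_injective _ (IsFractionRing.injective _ _)).comp
    (Function.LeftInverse.injective (g := χ) fun x => RingHom.congr_fun h1 x)

theorem mvPolynomial_ratFunc_injective :
    Function.Injective ((algebraMap (FunField n κ)[X] (RatFunc (FunField n κ))).comp
      (mvPolynomialToPolynomial κ n)) := by
  rw [RingHom.coe_comp]
  exact (IsFractionRing.injective _ _).comp (mvPolynomialToPolynomial_injective κ n)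

open scoped Classical in
/-- The valuation of `κ(T)(T_1, …, T_n)` given by the degree in `T`. -/
def degreeValuation : Valuation (FunField n k) (WithZero (Multiplicative ℤ)) :=
  haveI := isFractionRing_mvPolynomial_funField κ k n
  (RatFunc.inftyValuation (FunField n κ)).comap
    (IsFractionRing.lift (K := FunField n k) (mvPolynomial_ratFunc_injective κ n))

theorem degreeValuation_algebraMap {q : MvPolynomial (Fin n) κ[X]} (hq : q ≠ 0) :
    degreeValuation κ k n (algebraMap _ _ q) =
      WithZero.exp ((mvPolynomialToPolynomial κ n q).natDegree : ℤ) := by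
  classical
  have := isFractionRing_mvPolynomial_funField κ k n
  rw [degreeValuation, Valuation.comap_apply, IsFractionRing.lift_algebraMap, RingHom.comp_apply]
  exact RatFunc.inftyValuation.polynomial _
    ((_root_.map_ne_zero_iff _ (mvPolynomialToPolynomial_injective κ n)).2 hq)

theorem mvPolynomialToPolynomial_C (a : κ[X]) :
    mvPolynomialToPolynomial κ n (MvPolynomial.C a) = a.map (algebraMap κ (FunField n κ)) :=
  MvPolynomial.eval₂Hom_C _ _ _

theorem exists_valuation_lt (a : FunField n k) :
    ∃ m : ℕ, ∀ b : κ[X], m < b.natDegree → degreeValuation κ k n a <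
      degreeValuation κ k n (algebraMap (MvPolynomial (Fin n) κ[X]) _ (MvPolynomial.C b)) := by
  have := isFractionRing_mvPolynomial_funField κ k n
  have hb : ∀ b : κ[X], b ≠ 0 → degreeValuation κ k n
      (algebraMap (MvPolynomial (Fin n) κ[X]) _ (MvPolynomial.C b)) =
        WithZero.exp (b.natDegree : ℤ) := fun b hb => by
    rw [degreeValuation_algebraMap _ _ _ (by simpa using hb), mvPolynomialToPolynomial_C,
      natDegree_map]
  obtain ⟨x, y, hy, rfl⟩ := IsFractionRing.div_surjective (A := MvPolynomial (Fin n) κ[X]) a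
  have hy0 : y ≠ 0 := nonZeroDivisors.ne_zero hy
  refine ⟨(mvPolynomialToPolynomial κ n x).natDegree, fun b hm => ?_⟩
  rw [hb b (by rintro rfl; simp at hm), map_div₀, degreeValuation_algebraMap _ _ _ hy0]
  rcases eq_or_ne x 0 with rfl | hx
  · simp
  · rw [degreeValuation_algebraMap _ _ _ hx, ← WithZero.exp_sub, WithZero.exp_lt_exp]
    omega

/-- With `w_N = 1 + p T^N` and shifts `p T^j`, every candidate is congruent to 1 modulo `p`, while
the degree of `w_N` tends to infinity. The finitely many zeros of `g` are harmless, since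
irreducibility occurs for infinitely many `N`. -/
theorem exists_irreducible_specialization_of_funField (p : κ[X]) (hp : p.natDegree ≠ 0)
    {f : (FunField n k)[X][X]} (hf : f.Monic) (hirr : Irreducible f)
    (hsep : (f.map (evalRingHom 0)).Separable) {g : (FunField n k)[X]} (hg : g ≠ 0) :
    ∃ w : κ[X], w ≠ 0 ∧ p ∣ w - 1 ∧
      Irreducible (f.map (evalRingHom (algebraMap k (FunField n k) (algebraMap κ[X] k w)⁻¹))) ∧
      g.eval (algebraMap k (FunField n k) (algebraMap κ[X] k w)⁻¹) ≠ 0 := by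
  have := isFractionRing_mvPolynomial_funField κ k n
  have hp0 : p ≠ 0 := by rintro rfl; simp at hp
  let R := MvPolynomial (Fin n) κ[X]
  have hbase : ∀ b : κ[X], algebraMap R (FunField n k) (MvPolynomial.C b) =
      algebraMap k (FunField n k) (algebraMap κ[X] k b) := fun b => by
    rw [IsScalarTower.algebraMap_apply R (PolyRing n k) (FunField n k),
      IsScalarTower.algebraMap_apply k (PolyRing n k) (FunField n k)]
    congr 1
    exact MvPolynomial.map_C _ _
  have hinj : Function.Injective fun b : κ[X] =>
      algebraMap R (FunField n k) (MvPolynomial.C b) :=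
    (IsFractionRing.injective R (FunField n k)).comp (MvPolynomial.C_injective _ _)
  have hpX : Function.Injective fun j : ℕ => p * X ^ j := fun a b h => by
    have := congrArg natDegree (mul_left_cancel₀ hp0 h)
    simpa using this
  have hdeg : ∀ N : ℕ, (1 + p * X ^ N).natDegree = p.natDegree + N := fun N => by
    rw [natDegree_add_eq_right_of_natDegree_lt, natDegree_mul hp0 (pow_ne_zero _ X_ne_zero),
      natDegree_X_pow]
    rw [natDegree_mul hp0 (pow_ne_zero _ X_ne_zero), natDegree_one]
    omega
  obtain ⟨_, ⟨j, rfl⟩, hfreq⟩ := exists_irreducible_specialization (R := R) (degreeValuation κ k n)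
    (fun r hr => by
      rw [degreeValuation_algebraMap _ _ _ hr, ← WithZero.exp_zero, WithZero.exp_le_exp]
      omega)
    (fun N => MvPolynomial.C (1 + p * X ^ N))
    (fun a => by
      obtain ⟨m, hm⟩ := exists_valuation_lt κ k n a
      filter_upwards [eventually_gt_atTop m] with N hN
      exact hm _ (by rw [hdeg]; omega))
    (C := Set.range fun j : ℕ => (MvPolynomial.C (p * X ^ j) : R))
    (Set.infinite_range_of_injective ((MvPolynomial.C_injective _ _).comp hpX)) hf hirr hsep
  set w : ℕ → κ[X] := fun N => 1 + p * X ^ N + p * X ^ j with hw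
  have hwinj : Function.Injective w := fun a b h => by
    have h1 : p * X ^ a = p * X ^ b := by simpa [hw] using h
    exact hpX h1
  have hev : ∀ᶠ N in atTop,
      g.eval (algebraMap R (FunField n k) (MvPolynomial.C (w N)))⁻¹ ≠ 0 := by
    rw [← Nat.cofinite_eq_atTop, eventually_cofinite]
    have : {x | g.eval x = 0}.Finite := by
      classical
      refine g.roots.toFinset.finite_toSet.subset fun x hx => ?_
      simpa [hg] using hx
    refine (this.preimage (f := fun N => (algebraMap R (FunField n k) (MvPolynomial.C (w N)))⁻¹)
      ((inv_injective.comp (hinj.comp hwinj)).injOn)).subset fun N hN => ?_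
    simpa using hN
  obtain ⟨N, hN1, hN2⟩ := (hfreq.and_eventually hev).exists
  have hdvd : p ∣ w N - 1 := ⟨X ^ N + X ^ j, by simp only [hw]; ring⟩
  refine ⟨w N, ?_, hdvd, ?_, ?_⟩
  · intro h0
    rw [h0, zero_sub, dvd_neg] at hdvd
    exact hp (natDegree_eq_zero_of_isUnit (isUnit_of_dvd_one hdvd))
  · rwa [← map_add, hbase, ← map_inv₀] at hN1
  · rwa [hbase, ← map_inv₀] at hN2

end RationalFunctions

end HilbertIrreducibility

namespace HilbertIrreducibility

open EmbeddingProblem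

/-! ### Bézout constants and specialization of several variables -/

section Separability

theorem separable_map_of_bezout {R F : Type*} [CommRing R] [Field F] (φ : R →+* F) {f a b : R[X]}
    {u : R} (h : a * f + b * derivative f = C u) (hu : φ u ≠ 0) : (f.map φ).Separable := by
  have h' := congrArg (Polynomial.map φ) h
  rw [Polynomial.map_add, Polynomial.map_mul, Polynomial.map_mul, map_C, ← derivative_map] at h'
  refine ⟨C (φ u)⁻¹ * a.map φ, C (φ u)⁻¹ * b.map φ, ?_⟩
  rw [mul_assoc, mul_assoc, ← mul_add, h', ← C_mul, inv_mul_cancel₀ hu, C_1]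

/-- `u` takes the place of the discriminant: where it does not vanish, the specialized polynomial is
separable. -/
theorem exists_bezout_of_separable {R F : Type*} [CommRing R] [IsDomain R] [Field F] [Algebra R F]
    [IsFractionRing R F] {f : R[X]} (hf : (f.map (algebraMap R F)).Separable) :
    ∃ (u : R) (a b : R[X]), u ≠ 0 ∧ a * f + b * derivative f = C u := by
  obtain ⟨a, b, hab⟩ := hf
  obtain ⟨c, hc0, hc⟩ := IsLocalization.integerNormalization_spec (nonZeroDivisors R) a
  obtain ⟨d, hd0, hd⟩ := IsLocalization.integerNormalization_spec (nonZeroDivisors R) b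
  refine ⟨c * d, C d * IsLocalization.integerNormalization (nonZeroDivisors R) a,
    C c * IsLocalization.integerNormalization (nonZeroDivisors R) b,
    mul_ne_zero (nonZeroDivisors.ne_zero hc0) (nonZeroDivisors.ne_zero hd0),
    map_injective _ (IsFractionRing.injective R F) ?_⟩
  simp only [Polynomial.map_add, Polynomial.map_mul, map_C, hc, hd, ← derivative_map, map_mul]
  rw [← algebraMap_smul F c a, ← algebraMap_smul F d b, smul_eq_C_mul, smul_eq_C_mul]
  linear_combination (C (algebraMap R F c) * C (algebraMap R F d)) * hab

end Separability

/-- `F[X]` lies between `D[X]` and its fraction field, over which the monic `f` stays irreducible by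
Gauss's lemma. -/
theorem irreducible_map_mapRingHom_fractionRing {D F : Type*} [CommRing D] [IsDomain D]
    [IsIntegrallyClosed D] [Field F] [Algebra D F] [IsFractionRing D F] {f : D[X][X]} (hf : f.Monic)
    (hirr : Irreducible f) : Irreducible (f.map (mapRingHom (algebraMap D F))) := by
  let L := FractionRing D[X]
  have hDL : Function.Injective ((algebraMap D[X] L).comp C) :=
    (IsFractionRing.injective D[X] L).comp C_injective
  let φ : F[X] →+* L := eval₂RingHom (IsFractionRing.lift (K := F) hDL) (algebraMap D[X] L X)
  refine (hf.map _).irreducible_of_irreducible_map φ _ ?_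
  have : φ.comp (mapRingHom (algebraMap D F)) = algebraMap D[X] L := by
    ext x
    · simp [φ, IsFractionRing.lift_algebraMap]
    · simp [φ]
  rw [map_map, this]
  exact (hf.irreducible_iff_irreducible_map_fraction_map).1 hirr

theorem irreducible_map_affine {F : Type*} [Field F] {a b : F} (ha : a ≠ 0) {f : F[X][X]}
    (hirr : Irreducible f) :
    Irreducible (f.map (eval₂RingHom C (C a * X + C b) : F[X] →+* F[X])) := by
  let _ : Invertible a := invertibleOfNonzero ha
  have : (eval₂RingHom C (C a * X + C b) : F[X] →+* F[X]) =
      ((algEquivCMulXAddC a b).toRingEquiv : F[X] →+* F[X]) := by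
    ext <;> simp
  rw [this]
  exact (MulEquiv.irreducible_iff (mapEquiv (algEquivCMulXAddC a b).toRingEquiv)).2 hirr

/-- Induction on the number of variables, specializing the first. A base point `y₀ ≡ t₀ 0` modulo
`p` at which `u` does not vanish makes the substitution `Y = y₀ + p Z` separable at `Z = 0`. Then `Z
= 1/w` with `w ≡ 1` keeps the coordinate `p`-adically close to `t₀ 0`. Keeping `u` nonzero at the
new point preserves separability for the induction. -/
theorem exists_irreducible_specialization_of_ratFunc (κ k : Type*) [Field κ] [Field k]
    [Algebra κ[X] k] [IsFractionRing κ[X] k] (p : κ[X]) (hp : p.natDegree ≠ 0) (n : ℕ)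
    (t₀ : Fin n → κ[X]) {f : (PolyRing n k)[X]} (hf : f.Monic)
    (hirr : Irreducible (f.map (algebraMap (PolyRing n k) (FunField n k))))
    (hsep : (f.map (algebraMap (PolyRing n k) (FunField n k))).Separable)
    {g : PolyRing n k} (hg : g ≠ 0) :
    ∃ t : Fin n → k, MvPolynomial.eval t g ≠ 0 ∧ Irreducible (f.map (MvPolynomial.eval t)) ∧
      ∀ i, ∃ s w : κ[X], p ∣ w - 1 ∧
        (t i - algebraMap κ[X] k (t₀ i)) * algebraMap κ[X] k w = algebraMap κ[X] k (p * s) := by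
  have hp0 : p ≠ 0 := by rintro rfl; simp at hp
  induction n with
  | zero =>
    let e : PolyRing 0 k ≃+* k := MvPolynomial.isEmptyRingEquiv k (Fin 0)
    have he : (e : PolyRing 0 k →+* k) = MvPolynomial.eval default := by
      refine MvPolynomial.ringHom_ext (fun x => ?_) fun i => i.elim0
      simp only [e, MvPolynomial.isEmptyRingEquiv_apply, RingHom.coe_coe,
        MvPolynomial.eval_C]
      exact MvPolynomial.coeff_zero_C x
    refine ⟨default, ?_, ?_, fun i => i.elim0⟩
    · rw [← he]
      simpa using hg
    · rw [← he]
      exact (MulEquiv.irreducible_iff (mapEquiv e)).2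
        (hf.irreducible_iff_irreducible_map_fraction_map.2 hirr)
  | succ n ih =>
    obtain ⟨u, a, b, hu, hab⟩ := exists_bezout_of_separable hsep
    let D := PolyRing n k
    let F := FunField n k
    let φ : PolyRing (n + 1) k ≃+* D[X] := (MvPolynomial.finSuccEquiv k n).toRingEquiv
    let toD : κ[X] →+* D := MvPolynomial.C.comp (algebraMap κ[X] k)
    have htoD : Function.Injective toD :=
      (MvPolynomial.C_injective _ _).comp (IsFractionRing.injective κ[X] k)
    have htoF : ∀ x, algebraMap k F (algebraMap κ[X] k x) = algebraMap D F (toD x) := fun x =>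
      IsScalarTower.algebraMap_apply k D F _
    have hDF := IsFractionRing.injective D F
    set f₁ : D[X][X] := f.map (φ : PolyRing (n + 1) k →+* D[X]) with hf₁
    have hf₁m : f₁.Monic := hf.map _
    have hirr₁ : Irreducible f₁ := (MulEquiv.irreducible_iff (mapEquiv φ)).2
        (hf.irreducible_iff_irreducible_map_fraction_map.2 hirr)
    have hu₁ : φ u ≠ 0 := by simpa using hu
    have hg₁ : φ g ≠ 0 := by simpa using hg
    have hab₁ : a.map (φ : PolyRing (n + 1) k →+* D[X]) * f₁ +
        b.map (φ : PolyRing (n + 1) k →+* D[X]) * derivative f₁ = C (φ u) := by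
      rw [hf₁, derivative_map, ← Polynomial.map_mul, ← Polynomial.map_mul, ← Polynomial.map_add,
        hab, map_C]
      rfl
    -- the base point
    obtain ⟨s, hs⟩ : ∃ s : κ[X], (φ u).eval (toD (t₀ 0 + p * s)) ≠ 0 := by
      by_contra! hcon
      refine hu₁ (eq_zero_of_infinite_isRoot _ ((Set.infinite_range_of_injective
        (f := fun s => toD (t₀ 0 + p * s)) fun x y hxy => ?_).mono ?_))
      · exact mul_left_cancel₀ hp0 (add_left_cancel (htoD hxy))
      · rintro _ ⟨s, rfl⟩
        exact hcon s
    set y₀ : κ[X] := t₀ 0 + p * s with hy₀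
    have hpF : algebraMap D F (toD p) ≠ 0 := by
      rw [Ne, map_eq_zero_iff _ hDF, map_eq_zero_iff _ htoD]; exact hp0
    let τ : F[X] →+* F[X] := eval₂RingHom C (C (algebraMap D F (toD p)) * X +
      C (algebraMap D F (toD y₀)))
    have hτ : Function.Injective τ := by
      let _ : Invertible (algebraMap D F (toD p)) := invertibleOfNonzero hpF
      have : τ = ((algEquivCMulXAddC (algebraMap D F (toD p))
        (algebraMap D F (toD y₀))).toRingEquiv : F[X] →+* F[X]) := by
        ext <;> simp [τ]
      rw [this]
      exact RingEquiv.injective _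
    let θ : D[X] →+* F[X] := τ.comp (mapRingHom (algebraMap D F))
    have hθ : Function.Injective θ := hτ.comp (map_injective _ hDF)
    have hθeval : ∀ (z : k), (evalRingHom (algebraMap k F z)).comp θ = (algebraMap D F).comp
        (evalRingHom (MvPolynomial.C (algebraMap κ[X] k y₀ + algebraMap κ[X] k p * z))) := by
      intro z
      refine Polynomial.ringHom_ext (fun x => ?_) ?_
      · simp [θ, τ]
      · have h1 : θ X = C (algebraMap D F (toD p)) * X + C (algebraMap D F (toD y₀)) := by
          simp [θ, τ]
        change eval _ (θ X) = algebraMap D F (eval _ X)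
        rw [h1, ← htoF, ← htoF, eval_add, eval_mul, eval_C, eval_C, eval_X, eval_X, ← map_mul,
          ← map_add, add_comm]
        exact IsScalarTower.algebraMap_apply k D F _
    have hθ0 : (evalRingHom 0).comp θ = (algebraMap D F).comp (evalRingHom (toD y₀)) := by
      have := hθeval 0
      simpa [toD] using this
    obtain ⟨w, hw0, hpw, hwirr, hwg⟩ := exists_irreducible_specialization_of_funField κ k n p hp
      (f := f₁.map θ) (hf₁m.map _)
      (by
        rw [← map_map]
        exact irreducible_map_affine hpF (irreducible_map_mapRingHom_fractionRing hf₁m hirr₁))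
      (by
        rw [map_map, hθ0]
        refine separable_map_of_bezout _ hab₁ ?_
        rw [RingHom.comp_apply, Ne, map_eq_zero_iff _ hDF]
        exact hs)
      (g := θ (φ u * φ g)) (by
        rw [Ne, map_eq_zero_iff _ hθ]; exact mul_ne_zero hu₁ hg₁)
    set z : k := (algebraMap κ[X] k w)⁻¹ with hz
    set y : k := algebraMap κ[X] k y₀ + algebraMap κ[X] k p * z with hy
    have hwg' : (φ u).eval (MvPolynomial.C y) ≠ 0 ∧ (φ g).eval (MvPolynomial.C y) ≠ 0 := by
      have := RingHom.congr_fun (hθeval z) (φ u * φ g)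
      rw [RingHom.comp_apply, coe_evalRingHom] at this
      rw [this, RingHom.comp_apply, Ne, map_eq_zero_iff _ hDF, map_mul, mul_eq_zero] at hwg
      push Not at hwg
      exact hwg
    rw [map_map, hθeval z, ← map_map] at hwirr
    obtain ⟨t, htg, htirr, ht⟩ := ih (fun i => t₀ i.succ)
      (f := f₁.map (evalRingHom (MvPolynomial.C y))) (hf₁m.map _) hwirr
      (by
        rw [map_map]
        refine separable_map_of_bezout _ hab₁ ?_
        rw [RingHom.comp_apply, Ne, map_eq_zero_iff _ hDF]
        exact hwg'.1) hwg'.2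
    have heval : MvPolynomial.eval (Fin.cons y t : Fin (n + 1) → k) =
        ((MvPolynomial.eval t).comp (evalRingHom (MvPolynomial.C y))).comp
          (φ : PolyRing (n + 1) k →+* D[X]) := by
      refine RingHom.ext fun q => (MvPolynomial.eval_eq_eval_mv_eval' t y q).trans ?_
      rw [RingHom.comp_apply, RingHom.comp_apply, coe_evalRingHom, ← eval_map_apply,
        MvPolynomial.eval_C]
      rfl
    refine ⟨Fin.cons y t, ?_, ?_, ?_⟩
    · rw [heval]
      exact htg
    · rw [heval, ← map_map, ← map_map]
      exact htirr
    · refine Fin.cases ?_ fun i => ?_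
      -- Since `y₀ = t₀ 0 + p s`, one has `(y₀ + p/w - t₀ 0) w = p (s w + 1)`.
      · refine ⟨s * w + 1, w, hpw, ?_⟩
        have hw0' : algebraMap κ[X] k w ≠ 0 := by
          rw [Ne, map_eq_zero_iff _ (IsFractionRing.injective κ[X] k)]; exact hw0
        rw [Fin.cons_zero, hy, hy₀, hz]
        simp only [map_add, map_mul, map_one]
        field_simp
        ring
      · rw [Fin.cons_succ]
        exact ht i

/-! ### Generators with unramified specializations -/

/-- For distinct roots, Taylor expansion gives `h'(x) = -c (y - x)`. Equal images would thus kill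
`h'(x)`, and with it `u = b(x) h'(x)`. -/
theorem eq_of_map_eq_of_bezout {R B F : Type*} [CommRing R] [CommRing B] [IsDomain B] [Field F]
    [Algebra R B] (ψ : B →+* F) {h a b : R[X]} {u : R} (hab : a * h + b * derivative h = C u)
    (hu : ψ (algebraMap R B u) ≠ 0) {x y : B} (hx : aeval x h = 0) (hy : aeval y h = 0)
    (hxy : ψ x = ψ y) : x = y := by
  by_contra hne
  obtain ⟨c, hc⟩ := (h.map (algebraMap R B)).binomExpansion x (y - x)
  rw [add_sub_cancel, eval_map_algebraMap, eval_map_algebraMap, hx, hy, derivative_map,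
    eval_map_algebraMap] at hc
  have hsub : y - x ≠ 0 := sub_ne_zero.2 (Ne.symm hne)
  have h1 : aeval x (derivative h) + c * (y - x) = 0 := by
    refine (mul_eq_zero.1 (?_ : (y - x) * _ = 0)).resolve_left hsub
    linear_combination -hc
  have h2 : ψ (aeval x (derivative h)) = 0 := by
    have := congrArg ψ h1
    rwa [map_add, map_mul, map_sub, hxy, sub_self, mul_zero, add_zero, map_zero] at this
  have h3 := congrArg (aeval x) hab
  rw [map_add, map_mul, map_mul, hx, mul_zero, zero_add, aeval_C] at h3
  rw [← h3, map_mul, h2, mul_zero] at hu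
  exact hu rfl

theorem map_aeval_of_comp_algebraMap {R k F B : Type*} [CommRing R] [Field k] [Field F]
    [Algebra k F] [CommRing B] [Algebra R B] {ev : R →+* k} {ψ : B →+* F}
    (hψ : ∀ r, ψ (algebraMap R B r) = algebraMap k F (ev r)) (η : B) (q : R[X]) :
    ψ (aeval η q) = aeval (ψ η) (q.map ev) := by
  rw [aeval_def, hom_eval₂, aeval_def, eval₂_map]
  congr 1
  exact RingHom.ext hψ

theorem intermediateField_adjoin_eq_top {k F : Type*} [Field k] [Field F] [Algebra k F] {x : F}
    (hx : Algebra.adjoin k {x} = ⊤) : IntermediateField.adjoin k {x} = ⊤ := by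
  rw [← top_le_iff, ← IntermediateField.toSubalgebra_le_toSubalgebra,
    IntermediateField.top_toSubalgebra, ← hx]
  exact IntermediateField.algebra_adjoin_le_adjoin k _

theorem finrank_eq_natDegree_minpoly {k F : Type*} [Field k] [Field F] [Algebra k F]
    [FiniteDimensional k F] {x : F} (hx : Algebra.adjoin k {x} = ⊤) :
    Module.finrank k F = (minpoly k x).natDegree := by
  rw [← IntermediateField.adjoin.finrank (Algebra.IsIntegral.isIntegral x),
    intermediateField_adjoin_eq_top hx, IntermediateField.finrank_top']

/-- `η` is integral over `R`, it generates `E` over `K`, and `u` lies in the ideal generated by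
its minimal polynomial and the derivative of it. -/
structure IsUnramifiedGenerator (R K : Type*) {E : Type*} [CommRing R] [Field K] [Field E]
    [Algebra R E] [Algebra K E] (η : E) (u : R) : Prop where
  isIntegral : IsIntegral R η
  adjoin_eq_top : Algebra.adjoin K {η} = ⊤
  bezout : ∃ a b : R[X], a * minpoly R η + b * derivative (minpoly R η) = C u

theorem IsUnramifiedGenerator.separable_map {R K E k : Type*} [CommRing R] [Field K] [Field E]
    [Algebra R E] [Algebra K E] [Field k] {ev : R →+* k} {η : E} {u : R}
    (hη : IsUnramifiedGenerator R K η u) (hu : ev u ≠ 0) :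
    ((minpoly R η).map ev).Separable := by
  obtain ⟨a, b, hab⟩ := hη.bezout
  exact separable_map_of_bezout ev hab hu

section Generator

set_option linter.unusedSectionVars false

variable {R K E : Type*} [CommRing R] [IsDomain R] [IsIntegrallyClosed R] [Field K] [Algebra R K]
  [IsFractionRing R K] [Field E] [Algebra R E] [Algebra K E] [IsScalarTower R K E]
  [FiniteDimensional K E] [Algebra.IsSeparable K E]

variable (R K E) in
theorem exists_isUnramifiedGenerator :
    ∃ (η : E) (u : R), u ≠ 0 ∧ IsUnramifiedGenerator R K η u := by
  obtain ⟨x, hx⟩ := Field.exists_primitive_element K E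
  have hxa : IsAlgebraic R x := by
    rw [IsFractionRing.isAlgebraic_iff R K E]
    exact Algebra.IsAlgebraic.isAlgebraic x
  obtain ⟨y, hy0, hy⟩ := hxa.exists_integral_multiple
  have hyK : algebraMap R K y ≠ 0 := by
    rwa [Ne, map_eq_zero_iff _ (IsFractionRing.injective R K)]
  have hyx : y • x = algebraMap R K y • x := (algebraMap_smul K y x).symm
  have htop : Algebra.adjoin K {y • x} = ⊤ := by
    rw [eq_top_iff, ← IntermediateField.top_toSubalgebra, ← hx,
      IntermediateField.adjoin_simple_toSubalgebra_of_isAlgebraic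
        (Algebra.IsAlgebraic.isAlgebraic x), Algebra.adjoin_le_iff, Set.singleton_subset_iff]
    have hmem := Subalgebra.smul_mem _ (Algebra.self_mem_adjoin_singleton K (y • x))
      (algebraMap R K y)⁻¹
    rwa [hyx, smul_smul, inv_mul_cancel₀ hyK, one_smul, ← hyx] at hmem
  have hsep : ((minpoly R (y • x)).map (algebraMap R K)).Separable := by
    rw [← minpoly.isIntegrallyClosed_eq_field_fractions' K hy]
    exact Algebra.IsSeparable.isSeparable K _
  obtain ⟨u, a, b, hu, hab⟩ := exists_bezout_of_separable hsep
  exact ⟨y • x, u, hu, hy, htop, a, b, hab⟩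

/-- Integral elements lie in the trace dual of `R[η]`, which by Euler's formula is `R[η]` divided by
`h'(η)`, with `h` the minimal polynomial. Multiplication by `u = b(η) h'(η)` removes that
denominator. -/
theorem IsUnramifiedGenerator.exists_smul_eq_aeval {η : E} {u : R}
    (hη : IsUnramifiedGenerator R K η u) {x : E} (hx : IsIntegral R x) :
    ∃ q : R[X], u • x = aeval η q := by
  obtain ⟨a, b, hab⟩ := hη.bezout
  have hd : x ∈ (Algebra.traceForm K E).dualSubmodule
      (Subalgebra.toSubmodule (Algebra.adjoin R {η})) := by
    rw [LinearMap.BilinForm.mem_dualSubmodule]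
    intro y hy
    have hyint : IsIntegral R y := by
      have : Algebra.adjoin R {η} ≤ integralClosure R E :=
        Algebra.adjoin_le (Set.singleton_subset_iff.2 hη.isIntegral)
      exact this hy
    rw [Submodule.mem_one, Algebra.traceForm_apply]
    exact IsIntegrallyClosed.isIntegral_iff.1 (Algebra.isIntegral_trace (hx.mul hyint))
  rw [traceForm_dualSubmodule_adjoin R K hη.adjoin_eq_top hη.isIntegral,
    minpoly.isIntegrallyClosed_eq_field_fractions' K hη.isIntegral, derivative_map,
    aeval_map_algebraMap, Submodule.mem_smul_pointwise_iff_exists] at hd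
  obtain ⟨y, hy, rfl⟩ := hd
  obtain ⟨q, rfl⟩ := (Algebra.adjoin_singleton_eq_range_aeval R η).le hy
  have h3 := congrArg (aeval η) hab
  rw [map_add, map_mul, map_mul, minpoly.aeval, mul_zero, zero_add, aeval_C] at h3
  refine ⟨b * q, ?_⟩
  rw [Algebra.smul_def, ← h3, smul_eq_mul, map_mul]
  by_cases h0 : aeval η (derivative (minpoly R η)) = 0
  · have : Separable (minpoly K η) := Algebra.IsSeparable.isSeparable K _
    rw [minpoly.isIntegrallyClosed_eq_field_fractions' K hη.isIntegral] at this
    refine absurd ?_ (this.aeval_derivative_ne_zero (x := η) ?_)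
    · rw [derivative_map, aeval_map_algebraMap, h0]
    · rw [aeval_map_algebraMap, minpoly.aeval]
  · change _ * _ * (_ * aeval η q) = _
    field_simp

section Point

variable {k F : Type*} [Field k] [Field F] [Algebra k F] {ev : R →+* k}
  {ψ : integralClosure R E →+* F} {η : integralClosure R E} {u : R}

theorem aeval_minpoly_map_eq_zero (hψ : ∀ r, ψ (algebraMap R _ r) = algebraMap k F (ev r))
    (η : integralClosure R E) : aeval (ψ η) ((minpoly R (η : E)).map ev) = 0 := by
  have : aeval η (minpoly R (η : E)) = 0 := by
    refine Subtype.ext ?_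
    rw [← Subalgebra.val_apply, ← aeval_algHom_apply]
    exact minpoly.aeval R (η : E)
  rw [← map_aeval_of_comp_algebraMap hψ, this, map_zero]

theorem IsUnramifiedGenerator.exists_map_mul_eq (hη : IsUnramifiedGenerator R K (η : E) u)
    (hψ : ∀ r, ψ (algebraMap R _ r) = algebraMap k F (ev r)) (x : integralClosure R E) :
    ∃ q : R[X], algebraMap R (integralClosure R E) u * x = aeval η q ∧
      algebraMap k F (ev u) * ψ x = aeval (ψ η) (q.map ev) := by
  obtain ⟨q, hq⟩ := hη.exists_smul_eq_aeval x.2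
  have : algebraMap R (integralClosure R E) u * x = aeval η q := by
    refine Subtype.ext ?_
    rw [← Subalgebra.val_apply (integralClosure R E) (aeval η q), ← aeval_algHom_apply,
      ← Algebra.smul_def]
    exact hq
  exact ⟨q, this, by rw [← hψ, ← map_mul, this, map_aeval_of_comp_algebraMap hψ]⟩

/-- An irreducible specialization of the minimal polynomial is the minimal polynomial of the residue
of `η`. The kernel of `ψ` is thereby described through `ev` alone. -/
theorem IsUnramifiedGenerator.map_eq_zero_iff_dvd (hη : IsUnramifiedGenerator R K (η : E) u)
    (hψ : ∀ r, ψ (algebraMap R _ r) = algebraMap k F (ev r)) (hu : ev u ≠ 0)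
    (hirr : Irreducible ((minpoly R (η : E)).map ev)) {x : integralClosure R E} {q : R[X]}
    (hq : algebraMap R (integralClosure R E) u * x = aeval η q) :
    ψ x = 0 ↔ (minpoly R (η : E)).map ev ∣ q.map ev := by
  have h1 : (minpoly R (η : E)).map ev = minpoly k (ψ η) :=
    minpoly.eq_of_irreducible_of_monic hirr (aeval_minpoly_map_eq_zero hψ η)
      ((minpoly.monic hη.isIntegral).map _)
  have h2 : algebraMap k F (ev u) * ψ x = aeval (ψ η) (q.map ev) := by
    rw [← hψ, ← map_mul, hq, map_aeval_of_comp_algebraMap hψ]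
  rw [h1, minpoly.dvd_iff, ← h2, mul_eq_zero, or_iff_right]
  rwa [map_eq_zero]

/-- Used twice: for two maximal ideals over the same point it yields uniqueness, and for `ψ` and its
twist by an automorphism it yields stability. -/
theorem IsUnramifiedGenerator.map_eq_zero_iff {F' : Type*} [Field F'] [Algebra k F']
    {ψ' : integralClosure R E →+* F'} (hη : IsUnramifiedGenerator R K (η : E) u)
    (hψ : ∀ r, ψ (algebraMap R _ r) = algebraMap k F (ev r))
    (hψ' : ∀ r, ψ' (algebraMap R _ r) = algebraMap k F' (ev r)) (hu : ev u ≠ 0)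
    (hirr : Irreducible ((minpoly R (η : E)).map ev)) (x : integralClosure R E) :
    ψ x = 0 ↔ ψ' x = 0 := by
  obtain ⟨q, hq, -⟩ := hη.exists_map_mul_eq hψ x
  rw [hη.map_eq_zero_iff_dvd hψ hu hirr hq, hη.map_eq_zero_iff_dvd hψ' hu hirr hq]

theorem IsUnramifiedGenerator.adjoin_map_eq_top (hη : IsUnramifiedGenerator R K (η : E) u)
    (hψ : ∀ r, ψ (algebraMap R _ r) = algebraMap k F (ev r)) (hu : ev u ≠ 0)
    (hsurj : Function.Surjective ψ) : Algebra.adjoin k {ψ η} = ⊤ := by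
  refine eq_top_iff.2 fun z _ => ?_
  obtain ⟨x, rfl⟩ := hsurj z
  obtain ⟨q, -, hq⟩ := hη.exists_map_mul_eq hψ x
  have hu' : algebraMap k F (ev u) ≠ 0 := by rwa [Ne, map_eq_zero]
  have : ψ x = (ev u)⁻¹ • aeval (ψ η) (q.map ev) := by
    rw [← hq, Algebra.smul_def, map_inv₀, inv_mul_cancel_left₀ hu']
  rw [this]
  exact Subalgebra.smul_mem _ (aeval_mem_adjoin_singleton k _) _

theorem IsUnramifiedGenerator.finiteDimensional (hη : IsUnramifiedGenerator R K (η : E) u)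
    (hψ : ∀ r, ψ (algebraMap R _ r) = algebraMap k F (ev r)) (hu : ev u ≠ 0)
    (hsurj : Function.Surjective ψ) : FiniteDimensional k F := by
  have hint : IsIntegral k (ψ η) :=
    ⟨_, (minpoly.monic hη.isIntegral).map ev, aeval_minpoly_map_eq_zero hψ η⟩
  have := hint.fg_adjoin_singleton
  rw [hη.adjoin_map_eq_top hψ hu hsurj] at this
  exact ⟨by rwa [Algebra.top_toSubmodule] at this⟩

theorem IsUnramifiedGenerator.isSeparable (hη : IsUnramifiedGenerator R K (η : E) u)
    (hψ : ∀ r, ψ (algebraMap R _ r) = algebraMap k F (ev r)) (hu : ev u ≠ 0)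
    (hsurj : Function.Surjective ψ) : Algebra.IsSeparable k F := by
  have hsep : IsSeparable k (ψ η) :=
    (hη.separable_map hu).of_dvd (minpoly.dvd k _ (aeval_minpoly_map_eq_zero hψ η))
  have h := (IntermediateField.isSeparable_adjoin_simple_iff_isSeparable k F).2 hsep
  rw [intermediateField_adjoin_eq_top (hη.adjoin_map_eq_top hψ hu hsurj)] at h
  exact Algebra.IsSeparable.of_algHom k _
    (IntermediateField.topEquiv (F := k) (E := F)).symm.toAlgHom

theorem IsUnramifiedGenerator.finrank_eq (hη : IsUnramifiedGenerator R K (η : E) u)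
    (hψ : ∀ r, ψ (algebraMap R _ r) = algebraMap k F (ev r)) (hu : ev u ≠ 0)
    (hirr : Irreducible ((minpoly R (η : E)).map ev)) (hsurj : Function.Surjective ψ) :
    Module.finrank k F = Module.finrank K E := by
  have hfd := hη.finiteDimensional hψ hu hsurj
  have h1 : (minpoly R (η : E)).map ev = minpoly k (ψ η) :=
    minpoly.eq_of_irreducible_of_monic hirr (aeval_minpoly_map_eq_zero hψ η)
      ((minpoly.monic hη.isIntegral).map _)
  rw [finrank_eq_natDegree_minpoly (hη.adjoin_map_eq_top hψ hu hsurj),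
    finrank_eq_natDegree_minpoly hη.adjoin_eq_top, ← h1,
    minpoly.isIntegrallyClosed_eq_field_fractions' K hη.isIntegral,
    (minpoly.monic hη.isIntegral).natDegree_map, (minpoly.monic hη.isIntegral).natDegree_map]

end Point

end Generator

/-! ### Specializations of Galois extensions -/

section Galois

set_option linter.unusedSectionVars false

variable {R K E Ω : Type*} [CommRing R] [IsDomain R] [IsIntegrallyClosed R] [Field K] [Algebra R K]
  [IsFractionRing R K] [Field E] [Algebra R E] [Algebra K E] [IsScalarTower R K E]
  [FiniteDimensional K E] [Algebra.IsSeparable K E]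
  [Field Ω] [Algebra R Ω] [Algebra K Ω] [IsScalarTower R K Ω] [FiniteDimensional K Ω]
  [IsGalois K Ω] [Algebra E Ω] [IsScalarTower K E Ω] [IsScalarTower R E Ω]
  {k F FΩ : Type*} [Field k] [Field F] [Algebra k F] [Field FΩ] [Algebra k FΩ] {ev : R →+* k}
  {ψ : integralClosure R Ω →+* FΩ} {ψE : integralClosure R E →+* F}

variable (R E Ω) in
/-- The inclusion of the integral closure of `R` in `E` into the integral closure in `Ω`. -/
abbrev integralClosureInclusion : integralClosure R E →ₐ[R] integralClosure R Ω :=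
  (IsScalarTower.toAlgHom R E Ω).mapIntegralClosure

/-- The action of a `K`-automorphism on the integral closure of `R`. -/
abbrev integralClosureAut (γ : Ω ≃ₐ[K] Ω) : integralClosure R Ω ≃ₐ[R] integralClosure R Ω :=
  (γ.restrictScalars R).mapIntegralClosure

theorem aeval_integralClosure_eq_zero_iff {x : integralClosure R E} {q : R[X]} :
    aeval x q = 0 ↔ aeval (x : E) q = 0 := by
  rw [← Subalgebra.val_apply, aeval_algHom_apply, Subalgebra.val_apply, Subtype.ext_iff]
  rfl

theorem IsUnramifiedGenerator.map_integralClosureAut_eq_zero {η : integralClosure R E} {u : R}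
    (hη : IsUnramifiedGenerator R K (η : E) u)
    (hψ : ∀ r, ψE (algebraMap R _ r) = algebraMap k F (ev r)) (hu : ev u ≠ 0)
    (hirr : Irreducible ((minpoly R (η : E)).map ev)) (σ : E ≃ₐ[K] E) (x : integralClosure R E)
    (hx : ψE x = 0) : ψE (integralClosureAut σ x) = 0 :=
  (hη.map_eq_zero_iff (ψ := ψE)
    (ψ' := ψE.comp (integralClosureAut σ).toRingEquiv.toRingHom) hψ
    (fun r => (congrArg ψE ((integralClosureAut σ).commutes r)).trans (hψ r)) hu hirr x).1 hx

/-- An integral root of a polynomial with unramified specialization lies in `E` as soon as its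
residue does. -/
theorem mem_range_of_map_eq
    (hψ : ∀ r, ψ (algebraMap R _ r) = algebraMap k FΩ (ev r))
    (hstab : ∀ (γ : Ω ≃ₐ[K] Ω) x, ψ x = 0 → ψ (integralClosureAut γ x) = 0)
    {h a b : R[X]} {u : R} (hab : a * h + b * derivative h = C u) (hu : ev u ≠ 0)
    {ξ : integralClosure R Ω} (hξ : aeval ξ h = 0) {x : integralClosure R E}
    (hx : ψ ξ = ψ (integralClosureInclusion R E Ω x)) : ∃ y : integralClosure R E,
      integralClosureInclusion R E Ω y = ξ := by
  have : IsGalois E Ω := IsGalois.tower_top_of_isGalois K E Ω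
  have : FiniteDimensional E Ω := FiniteDimensional.right K E Ω
  have hmem : (ξ : Ω) ∈ Set.range (algebraMap E Ω) := by
    rw [IsGalois.mem_range_algebraMap_iff_fixed]
    intro f
    -- As `f` fixes `x`, stability of the kernel gives `f ξ` the residue of `x`, which is that of
    -- `ξ`. Roots of `h` with equal residues coincide.
    have h1 := hstab (f.restrictScalars K) (ξ - integralClosureInclusion R E Ω x)
      (by rw [map_sub, hx, sub_self])
    have h2 : integralClosureAut (f.restrictScalars K) (integralClosureInclusion R E Ω x) =
        integralClosureInclusion R E Ω x := Subtype.ext (f.commutes (x : E))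
    rw [map_sub, h2, map_sub, ← hx, sub_eq_zero] at h1
    have h3 := eq_of_map_eq_of_bezout ψ hab (by rwa [hψ, Ne, map_eq_zero])
      (by rw [aeval_algHom_apply, hξ, map_zero]) hξ h1
    exact congrArg Subtype.val h3
  obtain ⟨y, hy⟩ := hmem
  refine ⟨⟨y, ?_⟩, Subtype.ext hy⟩
  rw [mem_integralClosure_iff, ← isIntegral_algebraMap_iff (algebraMap E Ω).injective, hy]
  exact ξ.2

theorem exists_eq_prod_X_sub_C {p : R[X]} (hp : p.Monic)
    (hs : (p.map (algebraMap R Ω)).Splits) : ∃ s : Multiset (integralClosure R Ω),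
      p.map (algebraMap R (integralClosure R Ω)) = (s.map fun a => X - C a).prod := by
  obtain ⟨s, hs'⟩ : ∃ s : Multiset (integralClosure R Ω),
      s.map (Subtype.val) = (p.map (algebraMap R Ω)).roots := by
    have h : ∀ x ∈ (p.map (algebraMap R Ω)).roots, x ∈ integralClosure R Ω := fun x hx => by
      refine ⟨p, hp, ?_⟩
      rw [← eval_map]
      exact isRoot_of_mem_roots hx
    lift (p.map (algebraMap R Ω)).roots to Multiset (integralClosure R Ω) using h with s
    exact ⟨s, rfl⟩
  refine ⟨s, map_injective (integralClosure R Ω).val.toRingHom Subtype.val_injective ?_⟩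
  rw [map_map, Polynomial.map_multiset_prod, Multiset.map_map]
  have := hs.eq_prod_roots_of_monic (hp.map _)
  rw [← hs', Multiset.map_map] at this
  refine this.trans (congrArg Multiset.prod (Multiset.map_congr rfl fun x _ => ?_))
  simp

/-- Over the integral closure in `Ω` the minimal polynomial is a product of linear factors at
conjugates of `η`; reducing this product gives both claims. -/
theorem exists_conj_of_isRoot
    (hψ : ∀ r, ψ (algebraMap R _ r) = algebraMap k FΩ (ev r)) (η : integralClosure R E) :
    (((minpoly R (η : E)).map ev).map (algebraMap k FΩ)).Splits ∧
      ∀ z : FΩ, aeval z ((minpoly R (η : E)).map ev) = 0 →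
        ∃ γ : Ω ≃ₐ[K] Ω, z = ψ (integralClosureAut γ (integralClosureInclusion R E Ω η)) := by
  have hm := minpoly.monic η.2
  have hK : minpoly K (algebraMap E Ω η) = (minpoly R (η : E)).map (algebraMap R K) := by
    rw [minpoly.algebraMap_eq (algebraMap E Ω).injective,
      minpoly.isIntegrallyClosed_eq_field_fractions' K η.2]
  obtain ⟨s, hs⟩ := exists_eq_prod_X_sub_C (Ω := Ω) hm (by
    rw [IsScalarTower.algebraMap_eq R K Ω, ← map_map, ← hK]
    exact Normal.splits inferInstance _)
  have hcomp : ψ.comp (algebraMap R _) = (algebraMap k FΩ).comp ev := RingHom.ext hψ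
  have hs' := congrArg (Polynomial.map ψ) hs
  rw [map_map, hcomp, ← map_map, Polynomial.map_multiset_prod, Multiset.map_map] at hs'
  refine ⟨?_, fun z hz => ?_⟩
  · rw [hs']
    refine Splits.multisetProd fun f hf => ?_
    obtain ⟨a, -, rfl⟩ := Multiset.mem_map.1 hf
    simp
  · rw [aeval_def, ← eval_map, hs', eval_multiset_prod, Multiset.map_map,
      Multiset.prod_eq_zero_iff, Multiset.mem_map] at hz
    obtain ⟨c, hc, hcz⟩ := hz
    have hzc : z = ψ c := by
      simpa [sub_eq_zero] using hcz
    have hroot : aeval (c : Ω) (minpoly K (algebraMap E Ω η)) = 0 := by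
      rw [hK, aeval_map_algebraMap, ← aeval_integralClosure_eq_zero_iff, aeval_def, ← eval_map, hs,
        eval_multiset_prod, Multiset.prod_eq_zero_iff]
      exact Multiset.mem_map.2 ⟨_, Multiset.mem_map.2 ⟨c, hc, rfl⟩, by simp⟩
    obtain ⟨γ, hγ⟩ := minpoly.exists_algEquiv_of_root' (Algebra.IsAlgebraic.isAlgebraic _) hroot
    exact ⟨γ, hzc.trans (congrArg ψ (Subtype.ext hγ.symm))⟩

/-- Let `y` be the residue of `η` and `ν` the cofactor of its minimal polynomial. A root of `ν` is
the residue of some `γ η`. A lift of the minimal polynomial of `y` takes `η` into the kernel, hence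
by stability also `γ η`, so both factors share a root, against separability. Stability in `Ω` thus
serves every generator of `E`. -/
theorem IsUnramifiedGenerator.irreducible_map {η : integralClosure R E} {u : R}
    (hη : IsUnramifiedGenerator R K (η : E) u) (hev : Function.Surjective ev)
    (hψ : ∀ r, ψ (algebraMap R _ r) = algebraMap k FΩ (ev r))
    (hstab : ∀ (γ : Ω ≃ₐ[K] Ω) x, ψ x = 0 → ψ (integralClosureAut γ x) = 0)
    (hu : ev u ≠ 0) : Irreducible ((minpoly R (η : E)).map ev) := by
  obtain ⟨hsplit, hconj⟩ := exists_conj_of_isRoot (K := K) (Ω := Ω) hψ η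
  set h := (minpoly R (η : E)).map ev with hh
  have hm : h.Monic := (minpoly.monic η.2).map _
  set y := ψ (integralClosureInclusion R E Ω η) with hy
  have hyh : aeval y h = 0 := by
    rw [hy, hh, ← map_aeval_of_comp_algebraMap hψ, aeval_algHom_apply,
      aeval_integralClosure_eq_zero_iff.2 (minpoly.aeval R (η : E)), map_zero, map_zero]
  have hyint : IsIntegral k y := ⟨h, hm, hyh⟩
  obtain ⟨ν, hν⟩ := minpoly.dvd k y hyh
  have hνm : ν.Monic := (minpoly.monic hyint).of_mul_monic_left (hν ▸ hm)
  have hdeg : ν.degree = 0 := by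
    by_contra hdeg
    have hνs : (ν.map (algebraMap k FΩ)).Splits :=
      hsplit.of_dvd (hm.map _).ne_zero (Polynomial.map_dvd _ ⟨_, hν.trans (mul_comm _ _)⟩)
    obtain ⟨z, hz⟩ := hνs.exists_eval_eq_zero (by rwa [degree_map])
    rw [eval_map_algebraMap] at hz
    obtain ⟨γ, rfl⟩ := hconj z (by rw [hν, map_mul, hz, mul_zero])
    obtain ⟨μ, hμ⟩ := Polynomial.map_surjective ev hev (minpoly k y)
    have h1 := hstab γ (aeval (integralClosureInclusion R E Ω η) μ) (by
      rw [map_aeval_of_comp_algebraMap hψ, hμ, minpoly.aeval])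
    rw [← aeval_algHom_apply, map_aeval_of_comp_algebraMap hψ, hμ] at h1
    have hsep : h.Separable := hη.separable_map hu
    rw [hν] at hsep
    obtain ⟨a, b, hab⟩ := hsep.isCoprime
    have := congrArg (aeval (ψ (integralClosureAut γ (integralClosureInclusion R E Ω η)))) hab
    rw [map_add, map_mul, map_mul, h1, hz, mul_zero, mul_zero, add_zero, map_one] at this
    exact zero_ne_one this
  rw [hν, hνm.degree_le_zero_iff_eq_one.1 hdeg.le, mul_one]
  exact minpoly.irreducible hyint

/-- The restriction of automorphisms to residue fields is an isomorphism. -/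
theorem IsUnramifiedGenerator.exists_mulEquiv_aut {η : integralClosure R E} {u : R}
    (hη : IsUnramifiedGenerator R K (η : E) u) (hev : Function.Surjective ev)
    (hψ : ∀ r, ψ (algebraMap R _ r) = algebraMap k FΩ (ev r))
    (hstab : ∀ (γ : Ω ≃ₐ[K] Ω) x, ψ x = 0 → ψ (integralClosureAut γ x) = 0)
    (hu : ev u ≠ 0) (hψE : ∀ r, ψE (algebraMap R _ r) = algebraMap k F (ev r))
    (hsurj : Function.Surjective ψE)
    (hker : ∀ x, ψE x = 0 → ψ (integralClosureInclusion R E Ω x) = 0) :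
    ∃ e : (E ≃ₐ[K] E) ≃* (F ≃ₐ[k] F), ∀ σ x, e σ (ψE x) = ψE (integralClosureAut σ x) := by
  have hirr := hη.irreducible_map (Ω := Ω) hev hψ hstab hu
  have hfd := hη.finiteDimensional hψE hu hsurj
  obtain ⟨a, b, hab⟩ := hη.bezout
  have hηh : aeval η (minpoly R (η : E)) = 0 :=
    aeval_integralClosure_eq_zero_iff.2 (minpoly.aeval R (η : E))
  have hex : ∀ σ : E ≃ₐ[K] E, ∃ τ : F ≃ₐ[k] F, ∀ x, τ (ψE x) = ψE (integralClosureAut σ x) := by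
    intro σ
    -- `σ` preserves the kernel of `ψE`, so it descends to the residue field.
    let f : F →+* F := ψE.liftOfSurjective hsurj
      ⟨ψE.comp (integralClosureAut σ).toRingEquiv.toRingHom, fun x hx =>
        hη.map_integralClosureAut_eq_zero hψE hu hirr σ x hx⟩
    have hf : ∀ x, f (ψE x) = ψE (integralClosureAut σ x) := fun x =>
      RingHom.liftOfRightInverse_comp_apply ..
    let g : F →ₐ[k] F := AlgHom.mk f fun c => by
      obtain ⟨r, rfl⟩ := hev c
      change f _ = _
      rw [← hψE, hf, AlgEquiv.commutes]
    exact ⟨AlgEquiv.ofBijective g (Algebra.IsAlgebraic.algHom_bijective g), hf⟩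
  choose e he using hex
  have hext : ∀ τ τ' : F ≃ₐ[k] F, (∀ x, τ (ψE x) = τ' (ψE x)) → τ = τ' := fun τ τ' h =>
    AlgEquiv.ext fun z => by
      obtain ⟨x, rfl⟩ := hsurj z
      exact h x
  let eh : (E ≃ₐ[K] E) →* (F ≃ₐ[k] F) := MonoidHom.mk' e fun σ τ => hext _ _ fun x => by
    rw [he, AlgEquiv.mul_apply, he, he]
    rfl
  refine ⟨MulEquiv.ofBijective eh ⟨?_, fun τ => ?_⟩, he⟩
  · rw [injective_iff_map_eq_one]
    intro σ hσ
    -- If `σ` acts trivially on residues, then `σ η` and `η` are roots with the same residue, hence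
    -- equal.
    have h1 : ψE (integralClosureAut σ η) = ψE η := by
      rw [← he]
      exact congrArg (fun τ : F ≃ₐ[k] F => τ (ψE η)) hσ
    have h2 := eq_of_map_eq_of_bezout ψE hab (by rwa [hψE, Ne, map_eq_zero])
      (by rw [aeval_algHom_apply, hηh, map_zero]) hηh h1
    have h3 : (σ : E →ₐ[K] E) = AlgHom.id K E := by
      refine AlgHom.ext_of_adjoin_eq_top hη.adjoin_eq_top fun x hx => ?_
      rw [Set.mem_singleton_iff.1 hx]
      exact congrArg Subtype.val h2
    exact AlgEquiv.ext fun x => AlgHom.congr_fun h3 x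
  -- Surjectivity: inside `FΩ`, `τ` moves the residue of `η` to the residue of a conjugate `γ η` in
  -- `Ω`. This residue comes from `E`, so `γ η` lies in `E`, and `η ↦ γ η` defines the required
  -- automorphism.
  · let j : F →+* FΩ := ψE.liftOfSurjective hsurj
      ⟨ψ.comp (integralClosureInclusion R E Ω).toRingHom, fun x hx => hker x hx⟩
    have hj : ∀ x, j (ψE x) = ψ (integralClosureInclusion R E Ω x) := fun x =>
      RingHom.liftOfRightInverse_comp_apply ..
    let jk : F →ₐ[k] FΩ := AlgHom.mk j fun c => by
      obtain ⟨r, rfl⟩ := hev c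
      change j _ = _
      rw [← hψE, hj, AlgHom.commutes, hψ]
    obtain ⟨z, hz⟩ := hsurj (τ (ψE η))
    have hroot : aeval (jk (τ (ψE η))) ((minpoly R (η : E)).map ev) = 0 := by
      rw [aeval_algHom_apply, aeval_algHom_apply, aeval_minpoly_map_eq_zero hψE, map_zero,
        map_zero]
    obtain ⟨γ, hγ⟩ := (exists_conj_of_isRoot (K := K) (Ω := Ω) hψ η).2 _ hroot
    obtain ⟨y, hy⟩ := mem_range_of_map_eq (E := E) hψ hstab hab hu
      (ξ := integralClosureAut γ (integralClosureInclusion R E Ω η)) (x := z)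
      (by rw [aeval_algHom_apply, aeval_algHom_apply, hηh, map_zero, map_zero])
      (by rw [← hγ, ← hz]; exact hj z)
    have hyroot : aeval y (minpoly R (η : E)) = 0 := by
      have hinj : Function.Injective (integralClosureInclusion R E Ω) := fun x x' h =>
        Subtype.ext ((algebraMap E Ω).injective (congrArg Subtype.val h))
      refine hinj ?_
      rw [← aeval_algHom_apply, hy, aeval_algHom_apply, aeval_algHom_apply, hηh, map_zero,
        map_zero]
    have hyK : aeval (y : E) (minpoly K (η : E)) = 0 := by
      rw [minpoly.isIntegrallyClosed_eq_field_fractions' K hη.isIntegral, aeval_map_algebraMap]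
      exact aeval_integralClosure_eq_zero_iff.1 hyroot
    let pb : PowerBasis K E := PowerBasis.ofAdjoinEqTop
      (Algebra.IsIntegral.isIntegral (η : E)) hη.adjoin_eq_top
    have hgen : pb.gen = η := PowerBasis.ofAdjoinEqTop_gen ..
    let s : E →ₐ[K] E := pb.lift y (by rw [hgen]; exact hyK)
    have hs : s η = y := by
      rw [← hgen]
      exact pb.lift_gen _ _
    let σ : E ≃ₐ[K] E := AlgEquiv.ofBijective s (Algebra.IsAlgebraic.algHom_bijective s)
    refine ⟨σ, ?_⟩
    have h1 : ψE y = τ (ψE η) := by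
      refine jk.toRingHom.injective (Eq.trans ?_ hγ.symm)
      rw [← hy]
      exact hj y
    have h2 : ψE (integralClosureAut σ η) = τ (ψE η) := by
      rw [← h1]
      exact congrArg ψE (Subtype.ext hs)
    have h3 : ((e σ : F ≃ₐ[k] F) : F →ₐ[k] F) = τ := by
      refine AlgHom.ext_of_adjoin_eq_top (hη.adjoin_map_eq_top hψE hu hsurj) fun x hx => ?_
      rw [Set.mem_singleton_iff.1 hx]
      exact (he σ η).trans h2
    exact AlgEquiv.ext fun x => AlgHom.congr_fun h3 x

/-- A root in the residue field of a split polynomial with unramified specialization comes from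
a root in `E`. -/
theorem exists_root_of_splits
    (hψ : ∀ r, ψ (algebraMap R _ r) = algebraMap k FΩ (ev r))
    (hstab : ∀ (γ : Ω ≃ₐ[K] Ω) x, ψ x = 0 → ψ (integralClosureAut γ x) = 0)
    (hψE : ∀ r, ψE (algebraMap R _ r) = algebraMap k F (ev r))
    (hsurj : Function.Surjective ψE)
    (hker : ∀ x, ψE x = 0 ↔ ψ (integralClosureInclusion R E Ω x) = 0)
    {h a b : R[X]} {u : R} (hm : h.Monic) (hs : (h.map (algebraMap R Ω)).Splits)
    (hab : a * h + b * derivative h = C u) (hu : ev u ≠ 0) {z : F}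
    (hz : aeval z (h.map ev) = 0) :
    ∃ y : integralClosure R E, aeval y h = 0 ∧ ψE y = z := by
  obtain ⟨x, rfl⟩ := hsurj z
  obtain ⟨s, hs⟩ := exists_eq_prod_X_sub_C hm hs
  have hx : ψ (aeval (integralClosureInclusion R E Ω x) h) = 0 := by
    rw [aeval_algHom_apply, ← hker, map_aeval_of_comp_algebraMap hψE, hz]
  have hroot : ∀ y, aeval y h = (s.map fun c => y - c).prod := fun y => by
    rw [aeval_def, ← eval_map, hs, eval_multiset_prod, Multiset.map_map]
    simp
  -- Some root `c` of `h` in `Ω` has the residue of `x`; since this residue comes from `E`, so does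
  -- `c`.
  rw [hroot, map_multiset_prod, Multiset.prod_eq_zero_iff, Multiset.map_map] at hx
  obtain ⟨c, hc, hcx⟩ := Multiset.mem_map.1 hx
  have hcx' : ψ (integralClosureInclusion R E Ω x) = ψ c := by
    rw [← sub_eq_zero, ← map_sub]; exact hcx
  have hc0 : aeval c h = 0 := by
    rw [hroot, Multiset.prod_eq_zero_iff]
    exact Multiset.mem_map.2 ⟨c, hc, sub_self c⟩
  obtain ⟨y, hy⟩ := mem_range_of_map_eq hψ hstab hab hu hc0 hcx'.symm
  refine ⟨y, ?_, ?_⟩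
  · have hinj : Function.Injective (integralClosureInclusion R E Ω) := fun x x' h =>
      Subtype.ext ((algebraMap E Ω).injective (congrArg Subtype.val h))
    refine hinj ?_
    rw [← aeval_algHom_apply, hy, hc0, map_zero]
  · rw [← sub_eq_zero, ← map_sub, hker, map_sub, hy, map_sub, hcx', sub_self]

end Galois

/-! ### Specializations at points of affine space -/

theorem exists_isMaximal_comap_eq {A B : Type*} [CommRing A] [CommRing B] (f : A →+* B)
    (hf : f.IsIntegral) (P : Ideal A) [P.IsMaximal] (hP : RingHom.ker f ≤ P) :
    ∃ Q : Ideal B, Q.IsMaximal ∧ Q.comap f = P := by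
  let _ := f.toAlgebra
  have : Algebra.IsIntegral A B := ⟨hf⟩
  exact Ideal.exists_ideal_over_maximal_of_isIntegral P hP

section Point

variable {n : ℕ} {k : Type*} [Field k]

theorem pointIdeal_eq_ker (t : Fin n → k) :
    pointIdeal t = RingHom.ker (MvPolynomial.eval t) := by
  refine le_antisymm (Ideal.span_le.2 ?_) fun p hp => ?_
  · rintro _ ⟨i, rfl⟩
    simp
  · have key : ∀ q : PolyRing n k, q - MvPolynomial.C (MvPolynomial.eval t q) ∈ pointIdeal t := by
      intro q
      induction q using MvPolynomial.induction_on with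
      | C a => simp
      | add p q hp hq =>
        rw [map_add, map_add, add_sub_add_comm]
        exact add_mem hp hq
      | mul_X p i hp =>
        rw [map_mul, map_mul, MvPolynomial.eval_X]
        have hi : MvPolynomial.X i - MvPolynomial.C (t i) ∈ pointIdeal t :=
          Ideal.subset_span ⟨i, rfl⟩
        have := add_mem (Ideal.mul_mem_left _ p hi)
          (Ideal.mul_mem_right (MvPolynomial.C (t i)) _ hp)
        convert this using 1
        ring
    have := key p
    rwa [RingHom.mem_ker.1 hp, map_zero, sub_zero] at this

theorem eval_surjective (t : Fin n → k) :
    Function.Surjective (MvPolynomial.eval t : PolyRing n k →+* k) := fun c =>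
  ⟨MvPolynomial.C c, MvPolynomial.eval_C c⟩

instance isMaximal_pointIdeal (t : Fin n → k) : (pointIdeal t).IsMaximal := by
  rw [pointIdeal_eq_ker]
  exact RingHom.ker_isMaximal_of_surjective _ (eval_surjective t)

variable {E : Type*} [Field E] [Algebra (PolyRing n k) E] {t : Fin n → k}

theorem idealAbove_map_algebraMap [Algebra k E] [IsScalarTower k (PolyRing n k) E]
    (P : IdealAbove E t) (r : PolyRing n k) :
    algebraMap (integralClosure (PolyRing n k) E) P.residueField (algebraMap _ _ r) =
      algebraMap k P.residueField (MvPolynomial.eval t r) := by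
  have h : algebraMap (PolyRing n k) (integralClosure (PolyRing n k) E)
      (r - MvPolynomial.C (MvPolynomial.eval t r)) ∈ P.ideal := by
    change _ ∈ P.ideal.under (PolyRing n k)
    rw [P.under_eq, pointIdeal_eq_ker, RingHom.mem_ker, map_sub, MvPolynomial.eval_C, sub_self]
  rw [← Ideal.algebraMap_residueField_eq_zero, map_sub, map_sub, sub_eq_zero] at h
  rw [h, IsScalarTower.algebraMap_apply k (integralClosure (PolyRing n k) E) P.residueField,
    IsScalarTower.algebraMap_apply k (PolyRing n k) (integralClosure (PolyRing n k) E)]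
  rfl

theorem idealAbove_algebraMap_surjective (P : IdealAbove E t) :
    Function.Surjective (algebraMap (integralClosure (PolyRing n k) E) P.residueField) := by
  intro z
  obtain ⟨y, rfl⟩ := (Ideal.bijective_algebraMap_quotient_residueField P.ideal).2 z
  obtain ⟨x, rfl⟩ := Ideal.Quotient.mk_surjective y
  exact ⟨x, rfl⟩

theorem idealAbove_ext {P Q : IdealAbove E t} (h : P.ideal = Q.ideal) : P = Q := by
  cases P; cases Q; cases h; rfl

variable (E t) in
theorem exists_idealAbove (hinj : Function.Injective (algebraMap (PolyRing n k) E)) :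
    Nonempty (IdealAbove E t) := by
  obtain ⟨Q, hQ, hQt⟩ := exists_isMaximal_comap_eq
    (algebraMap (PolyRing n k) (integralClosure (PolyRing n k) E))
    (fun x => Algebra.IsIntegral.isIntegral x) (pointIdeal t) (by
      rw [(RingHom.injective_iff_ker_eq_bot _).1 fun x y h => hinj (congrArg Subtype.val h)]
      exact bot_le)
  exact ⟨⟨Q, hQ, hQt⟩⟩

variable {Ω : Type*} [Field Ω] [Algebra (PolyRing n k) Ω] [Algebra E Ω]
  [IsScalarTower (PolyRing n k) E Ω]

theorem exists_idealAbove_comap (P : IdealAbove E t) : ∃ Q : IdealAbove Ω t,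
    Q.ideal.comap (integralClosureInclusion (PolyRing n k) E Ω).toRingHom = P.ideal := by
  obtain ⟨Q, hQ, hQt⟩ := exists_isMaximal_comap_eq
    (integralClosureInclusion (PolyRing n k) E Ω).toRingHom (fun x => by
      have hx : IsIntegral (PolyRing n k) x := Algebra.IsIntegral.isIntegral x
      have hcomp : (integralClosureInclusion (PolyRing n k) E Ω).toRingHom.comp
        (algebraMap (PolyRing n k) _) = algebraMap (PolyRing n k) _ :=
          RingHom.ext fun r => (integralClosureInclusion (PolyRing n k) E Ω).commutes r
      rw [IsIntegral, ← hcomp] at hx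
      exact RingHom.IsIntegralElem.of_comp hx) P.ideal (by
      rw [(RingHom.injective_iff_ker_eq_bot _).1 fun x y h =>
        Subtype.ext ((algebraMap E Ω).injective (congrArg Subtype.val h))]
      exact bot_le)
  refine ⟨⟨Q, hQ, ?_⟩, hQt⟩
  rw [← P.under_eq, ← hQt, Ideal.under, Ideal.under, Ideal.comap_comap]
  congr 1
  exact RingHom.ext fun r => ((integralClosureInclusion (PolyRing n k) E Ω).commutes r).symm

variable [Algebra k E] [IsScalarTower k (PolyRing n k) E]
  [Algebra (FunField n k) E] [IsScalarTower (PolyRing n k) (FunField n k) E]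
  [FiniteDimensional (FunField n k) E] [Algebra.IsSeparable (FunField n k) E]
  [Algebra k Ω] [IsScalarTower k (PolyRing n k) Ω]
  [Algebra (FunField n k) Ω] [IsScalarTower (PolyRing n k) (FunField n k) Ω]
  [FiniteDimensional (FunField n k) Ω] [IsGalois (FunField n k) Ω]
  [IsScalarTower (FunField n k) E Ω]

/-- Good behaviour of the specialization at `P` with respect to automorphisms and to roots of
polynomials that split in `Ω`. -/
structure IsGoodSpecialization (Ω : Type*) [Field Ω] [Algebra (PolyRing n k) Ω]
    (P : IdealAbove E t) : Prop where
  finiteDimensional : FiniteDimensional k P.residueField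
  isSeparable : Algebra.IsSeparable k P.residueField
  finrank_eq : Module.finrank k P.residueField = Module.finrank (FunField n k) E
  unique : ∀ Q : IdealAbove E t, Q = P
  irreducible_map : ∀ (η : E) (u : PolyRing n k),
    IsUnramifiedGenerator (PolyRing n k) (FunField n k) η u → MvPolynomial.eval t u ≠ 0 →
    Irreducible ((minpoly (PolyRing n k) η).map (MvPolynomial.eval t))
  exists_mulEquiv : ∃ e : (E ≃ₐ[FunField n k] E) ≃* (P.residueField ≃ₐ[k] P.residueField),
    ∀ σ x, e σ (algebraMap (integralClosure (PolyRing n k) E) _ x) =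
      algebraMap (integralClosure (PolyRing n k) E) _ (integralClosureAut σ x)
  exists_root : ∀ (h a b : (PolyRing n k)[X]) (u : PolyRing n k), h.Monic →
    (h.map (algebraMap (PolyRing n k) Ω)).Splits → a * h + b * derivative h = C u →
    MvPolynomial.eval t u ≠ 0 → ∀ z : P.residueField, aeval z (h.map (MvPolynomial.eval t)) = 0 →
    ∃ y : integralClosure (PolyRing n k) E, aeval y h = 0 ∧ algebraMap _ P.residueField y = z

/-- Irreducibility is assumed only for the generator `θ` of `Ω`. It makes a maximal ideal `Q` above
`P` stable under the Galois group, and stability carries everything over to `E`. -/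
theorem isGoodSpecialization {θ : Ω} {η : E} {u v : PolyRing n k}
    (hθ : IsUnramifiedGenerator (PolyRing n k) (FunField n k) θ v)
    (hη : IsUnramifiedGenerator (PolyRing n k) (FunField n k) η u)
    (hv : MvPolynomial.eval t v ≠ 0) (hu : MvPolynomial.eval t u ≠ 0)
    (hirr : Irreducible ((minpoly (PolyRing n k) θ).map (MvPolynomial.eval t)))
    (P : IdealAbove E t) : IsGoodSpecialization Ω P := by
  lift θ to integralClosure (PolyRing n k) Ω using hθ.isIntegral
  lift η to integralClosure (PolyRing n k) E using hη.isIntegral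
  have hev := eval_surjective t
  obtain ⟨Q, hQ⟩ := exists_idealAbove_comap (Ω := Ω) P
  have hψ := idealAbove_map_algebraMap Q
  have hψE := idealAbove_map_algebraMap P
  have hsurj := idealAbove_algebraMap_surjective P
  have hstab := hθ.map_integralClosureAut_eq_zero hψ hv hirr
  have hker : ∀ x, algebraMap (integralClosure (PolyRing n k) E) P.residueField x = 0 ↔
      algebraMap (integralClosure (PolyRing n k) Ω) Q.residueField
        (integralClosureInclusion (PolyRing n k) E Ω x) = 0 := fun x => by
    rw [Ideal.algebraMap_residueField_eq_zero, Ideal.algebraMap_residueField_eq_zero, ← hQ]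
    rfl
  have hirrE := hη.irreducible_map hev hψ hstab hu
  exact
    { finiteDimensional := hη.finiteDimensional hψE hu hsurj
      isSeparable := hη.isSeparable hψE hu hsurj
      finrank_eq := hη.finrank_eq hψE hu hirrE hsurj
      unique := fun P' => idealAbove_ext <| Ideal.ext fun x => by
        rw [← Ideal.algebraMap_residueField_eq_zero, ← Ideal.algebraMap_residueField_eq_zero]
        exact hη.map_eq_zero_iff (idealAbove_map_algebraMap P') hψE hu hirrE x
      irreducible_map := fun ζ _ hζ hw =>
        hζ.irreducible_map (η := ⟨ζ, hζ.isIntegral⟩) hev hψ hstab hw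
      exists_mulEquiv := hη.exists_mulEquiv_aut hev hψ hstab hu hψE hsurj fun x => (hker x).1
      exists_root := fun h a b u hm hs hab hu z hz =>
        exists_root_of_splits hψ hstab hψE hsurj hker hm hs hab hu hz }

end Point

/-! ### Specializations of solutions -/

theorem isGalois_normalClosure_algebraicClosure (K E : Type*) [Field K] [Field E] [Algebra K E]
    [FiniteDimensional K E] [Algebra.IsSeparable K E] :
    IsGalois K (IntermediateField.normalClosure K E (AlgebraicClosure E)) := by
  have : Algebra.IsAlgebraic K (AlgebraicClosure E) := Algebra.IsAlgebraic.trans K E _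
  have : IsAlgClosure K (AlgebraicClosure E) := ⟨inferInstance, this⟩
  have : Normal K (AlgebraicClosure E) := IsAlgClosure.normal K _
  have : Algebra.IsSeparable K (IntermediateField.normalClosure K E (AlgebraicClosure E)) := by
    rw [← le_separableClosure_iff, normalClosure_le_iff]
    intro f
    rw [le_separableClosure_iff]
    exact Algebra.IsSeparable.of_algHom K _ (AlgEquiv.ofInjectiveField f).symm.toAlgHom
  exact ⟨⟩

section Solution

variable {n : ℕ} {k : Type*} [Field k] {E : Type*} [Field E] [Algebra k E]
  [Algebra (PolyRing n k) E] [Algebra (FunField n k) E] [IsScalarTower k (PolyRing n k) E]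
  [IsScalarTower (PolyRing n k) (FunField n k) E]

/-- Reduction commutes with automorphisms and `L` lies in the integral closure, so the action on `L`
in the residue field is the one in `E`, which `liftAut_algebraMap` identifies with the action
through `α`. -/
theorem IsGoodSpecialization.exists_isSolution {L G Ω : Type*} [Field L] [Algebra k L]
    [Algebra.IsAlgebraic k L] [Group G] [Field Ω] [Algebra (PolyRing n k) Ω]
    {α : G →* (L ≃ₐ[k] L)} {ι : FunField n L →ₐ[FunField n k] E}
    {β : (E ≃ₐ[FunField n k] E) ≃* G} (hβ : IsSolution (baseChange n α) ι β)
    {t : Fin n → k} {P : IdealAbove E t} (hP : IsGoodSpecialization Ω P) :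
    ∃ β' : (P.residueField ≃ₐ[k] P.residueField) ≃* G,
      IsSolution α (P.embed (constEmbedding ι)) β' := by
  obtain ⟨e, he⟩ := hP.exists_mulEquiv
  refine ⟨e.symm.trans β, hP.finiteDimensional, hP.isSeparable, fun τ x => ?_⟩
  obtain ⟨σ, rfl⟩ := e.surjective τ
  rw [MulEquiv.trans_apply, MulEquiv.symm_apply_apply]
  refine (he σ _).trans (congrArg (algebraMap _ P.residueField) (Subtype.ext ?_))
  refine (hβ.restrict_eq σ (algebraMap L (FunField n L) x)).trans (congrArg ι ?_)
  exact liftAut_algebraMap n (α (β σ)) x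

instance isScalarTower_poly_galClosure :
    IsScalarTower (PolyRing n k) (FunField n k) (GalClosure n k E) :=
  ⟨fun a p x => Subtype.ext (smul_assoc a p (x : AlgebraicClosure E))⟩

variable [FiniteDimensional (FunField n k) E] [Algebra.IsSeparable (FunField n k) E]

instance isGalois_galClosure : IsGalois (FunField n k) (GalClosure n k E) :=
  isGalois_normalClosure_algebraicClosure _ _

instance finiteDimensional_galClosure : FiniteDimensional (FunField n k) (GalClosure n k E) :=
  inferInstance

/-- `h` is the minimal polynomial of a generator of `Ω`, and `g` is the product of the Bézout
constants for `Ω`, `E` and the Galois closure; the last one serves the degree condition. `Ω` is left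
free because the control of constants needs room beyond the Galois closure. -/
theorem exists_specialization_polynomial (Ω : Type*) [Field Ω] [Algebra k Ω]
    [Algebra (PolyRing n k) Ω] [Algebra (FunField n k) Ω] [IsScalarTower k (PolyRing n k) Ω]
    [IsScalarTower (PolyRing n k) (FunField n k) Ω] [FiniteDimensional (FunField n k) Ω]
    [IsGalois (FunField n k) Ω] [Algebra E Ω] [IsScalarTower (FunField n k) E Ω]
    [Algebra (GalClosure n k E) Ω] [IsScalarTower (FunField n k) (GalClosure n k E) Ω] :
    ∃ (h : (PolyRing n k)[X]) (g : PolyRing n k), h.Monic ∧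
      Irreducible (h.map (algebraMap _ (FunField n k))) ∧
      (h.map (algebraMap _ (FunField n k))).Separable ∧ g ≠ 0 ∧
      ∀ t, MvPolynomial.eval t g ≠ 0 → Irreducible (h.map (MvPolynomial.eval t)) →
        ∃ P : IdealAbove E t, P.IsSpecialization ∧ IsGoodSpecialization Ω P := by
  have hE : IsScalarTower (PolyRing n k) E Ω := IsScalarTower.of_algebraMap_eq fun x => by
    rw [IsScalarTower.algebraMap_apply _ (FunField n k) E,
      ← IsScalarTower.algebraMap_apply (FunField n k) E Ω,
      ← IsScalarTower.algebraMap_apply _ (FunField n k) Ω]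
  have hN : IsScalarTower (PolyRing n k) (GalClosure n k E) Ω :=
    IsScalarTower.of_algebraMap_eq fun x => by
      rw [IsScalarTower.algebraMap_apply _ (FunField n k) (GalClosure n k E),
        ← IsScalarTower.algebraMap_apply (FunField n k) (GalClosure n k E) Ω,
        ← IsScalarTower.algebraMap_apply _ (FunField n k) Ω]
  obtain ⟨θ, v, hv, hθ⟩ := exists_isUnramifiedGenerator (PolyRing n k) (FunField n k) Ω
  obtain ⟨η, u, hu, hη⟩ := exists_isUnramifiedGenerator (PolyRing n k) (FunField n k) E
  obtain ⟨ν, w, hw, hν⟩ :=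
    exists_isUnramifiedGenerator (PolyRing n k) (FunField n k) (GalClosure n k E)
  have hmin := minpoly.isIntegrallyClosed_eq_field_fractions' (FunField n k) hθ.isIntegral
  refine ⟨minpoly _ θ, v * u * w, minpoly.monic hθ.isIntegral, ?_, ?_,
    mul_ne_zero (mul_ne_zero hv hu) hw, fun t hg hirr => ?_⟩
  · rw [← hmin]
    exact minpoly.irreducible (Algebra.IsIntegral.isIntegral θ)
  · rw [← hmin]
    exact Algebra.IsSeparable.isSeparable _ θ
  · rw [map_mul, map_mul, mul_ne_zero_iff, mul_ne_zero_iff] at hg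
    obtain ⟨P⟩ := exists_idealAbove E t (by
      rw [IsScalarTower.algebraMap_eq _ (FunField n k) E]
      exact (algebraMap (FunField n k) E).injective.comp (IsFractionRing.injective _ _))
    have hP := isGoodSpecialization hθ hη hg.1.1 hg.1.2 hirr P
    exact ⟨P, ⟨fun Q => (isGoodSpecialization hθ hν hg.1.1 hg.2 hirr Q).finrank_eq, hP.unique⟩, hP⟩

theorem exists_isZariskiDense_of_isHilbertian (hk : IsHilbertian k) :
    ∃ S : Set (Fin n → k), IsZariskiDense S ∧ ∀ t ∈ S, ∃ P : IdealAbove E t,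
      P.IsSpecialization ∧ IsGoodSpecialization (GalClosure n k E) P := by
  obtain ⟨h, g, -, hirr, hsep, hg, hspec⟩ :=
    exists_specialization_polynomial (n := n) (k := k) (E := E) (GalClosure n k E)
  refine ⟨{t | ∃ P : IdealAbove E t, P.IsSpecialization ∧
    IsGoodSpecialization (GalClosure n k E) P}, fun g' hg' => ?_, fun t ht => ht⟩
  obtain ⟨t, ht, hti⟩ := hk n 1 (fun _ => h) (g * g') (fun _ => hirr) (fun _ => hsep)
    (mul_ne_zero hg hg')
  rw [map_mul, mul_ne_zero_iff] at ht
  exact ⟨t, hspec t ht.1 (hti 0), ht.2⟩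

end Solution

/-! ### Constant extensions and reduction modulo a prime -/

/-- After exchanging the two variables, `μ` is a constant polynomial with prime value, hence prime;
Gauss's lemma passes to `κ(T)`. -/
theorem irreducible_map_ratConst {κ : Type*} (k : Type*) [Field κ] [Field k] [Algebra κ[X] k]
    [IsFractionRing κ[X] k] {μ : κ[X]} (hm : μ.Monic) (hμ : Irreducible μ) :
    Irreducible (μ.map (ratConst κ k)) := by
  rw [ratConst, ← map_map]
  refine ((hm.map _).irreducible_iff_irreducible_map_fraction_map).1 ?_
  rw [← Bivariate.swap_C]
  exact (MulEquiv.irreducible_iff (Bivariate.swap (R := κ))).2 (prime_C_iff.2 hμ.prime).irreducible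

/-- `f` is the minimal polynomial of a primitive element of the separable closure of `κ` in `M`.
This closure embeds in the splitting field of `f`, where normality turns one root of `μ` into all of
them. -/
theorem exists_separable_splits_of_root (κ M : Type*) [Field κ] [Field M] [Algebra κ M]
    [FiniteDimensional κ M] : ∃ f : κ[X], f.Separable ∧
      ∀ (Ω : Type*) [Field Ω] [Algebra κ Ω], (f.map (algebraMap κ Ω)).Splits →
        ∀ μ : κ[X], μ.Monic → Irreducible μ → μ.Separable → (∃ m : M, aeval m μ = 0) →
          (μ.map (algebraMap κ Ω)).Splits := by
  obtain ⟨s, hs⟩ := Field.exists_primitive_element κ (separableClosure κ M)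
  have hsint : IsIntegral κ s := Algebra.IsIntegral.isIntegral s
  refine ⟨minpoly κ s, Algebra.IsSeparable.isSeparable κ s,
    fun Ω _ _ hsplit μ hm hirr hsep ⟨m, hmμ⟩ => ?_⟩
  let S := (minpoly κ s).SplittingField
  have hS := SplittingField.splits (minpoly κ s)
  obtain ⟨r, hr⟩ := hS.exists_eval_eq_zero (by
    rw [degree_map]; exact (minpoly.degree_pos hsint).ne')
  rw [eval_map_algebraMap] at hr
  let pb : PowerBasis κ (separableClosure κ M) := PowerBasis.ofAdjoinEqTop hsint (by
    rw [← IntermediateField.adjoin_simple_toSubalgebra_of_isAlgebraic hsint.isAlgebraic, hs,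
      IntermediateField.top_toSubalgebra])
  let j : separableClosure κ M →ₐ[κ] S := pb.lift r hr
  have hmsep : m ∈ separableClosure κ M := mem_separableClosure_iff.2
    (hsep.of_dvd (minpoly.dvd κ m hmμ))
  have hroot : aeval (j ⟨m, hmsep⟩) μ = 0 := by
    rw [aeval_algHom_apply, ← map_zero j]
    congr 1
    refine Subtype.ext ?_
    have := aeval_algHom_apply (separableClosure κ M).val ⟨m, hmsep⟩ μ
    exact this.symm.trans hmμ
  have hmin := minpoly.eq_of_irreducible_of_monic hirr hroot hm
  have hnormal : Normal κ S := Normal.of_isSplittingField (minpoly κ s)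
  have hμS : (μ.map (algebraMap κ S)).Splits := by
    rw [hmin]
    exact hnormal.splits _
  let l : S →ₐ[κ] Ω := SplittingField.lift (minpoly κ s) hsplit
  have := hμS.map (l : S →+* Ω)
  rwa [map_map, AlgHom.comp_algebraMap] at this

theorem exists_isGalois_splits {K E : Type*} [Field K] [Field E] [Algebra K E]
    [FiniteDimensional K E] [Algebra.IsSeparable K E] {f : K[X]} (hf : f.Separable) :
    ∃ Ω : IntermediateField K (AlgebraicClosure E),
      IntermediateField.normalClosure K E (AlgebraicClosure E) ≤ Ω ∧ FiniteDimensional K Ω ∧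
      IsGalois K Ω ∧ (f.map (algebraMap K Ω)).Splits := by
  let S : IntermediateField K (AlgebraicClosure E) :=
    IntermediateField.adjoin K (f.rootSet (AlgebraicClosure E))
  have hS : f.IsSplittingField K S := IntermediateField.adjoin_rootSet_isSplittingField
    (IsAlgClosed.splits _)
  have : IsGalois K S := IsGalois.of_separable_splitting_field hf
  have : FiniteDimensional K S := IsSplittingField.finiteDimensional S f
  have := isGalois_normalClosure_algebraicClosure K E
  refine ⟨_ ⊔ S, le_sup_left, inferInstance, inferInstance, ?_⟩
  have h := hS.splits'.map (IntermediateField.inclusion (le_sup_right :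
    S ≤ IntermediateField.normalClosure K E (AlgebraicClosure E) ⊔ S)).toRingHom
  rwa [map_map, AlgHom.toRingHom_eq_coe, AlgHom.comp_algebraMap] at h

/-- `O` is the localization of `κ[T]` at `p`, and `φ` is reduction to the residue field. -/
theorem exists_residue_subalgebra {κ : Type*} (k : Type*) [Field κ] [Field k] [Algebra κ[X] k]
    [IsFractionRing κ[X] k] {p : κ[X]} (hp : Irreducible p) :
    ∃ (O : Subalgebra κ[X] k) (φ : O →+* AdjoinRoot p), IsIntegrallyClosed O ∧
      (∀ x : κ[X], φ (algebraMap κ[X] O x) = AdjoinRoot.mk p x) ∧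
      (∀ (y : k) (a s : κ[X]), ¬ p ∣ s → y * algebraMap κ[X] k s = algebraMap κ[X] k a → y ∈ O) ∧
      ∀ y : O, φ y ≠ 0 → IsUnit y := by
  have : Fact (Irreducible p) := ⟨hp⟩
  have hprime : (Ideal.span {p}).IsPrime :=
    (Ideal.span_singleton_prime hp.ne_zero).2 hp.prime
  have hmem : ∀ s, s ∈ (Ideal.span {p}).primeCompl ↔ ¬ p ∣ s := fun s =>
    not_congr Ideal.mem_span_singleton
  have hle : (Ideal.span {p}).primeCompl ≤ nonZeroDivisors κ[X] :=
    Ideal.primeCompl_le_nonZeroDivisors _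
  let O := Localization.subalgebra.ofField k (Ideal.span {p}).primeCompl hle
  have hunit : ∀ s : (Ideal.span {p}).primeCompl, IsUnit (AdjoinRoot.mk p s) := fun s => by
    rw [isUnit_iff_ne_zero, Ne, AdjoinRoot.mk_eq_zero]
    exact (hmem _).1 s.2
  let φ : O →+* AdjoinRoot p := IsLocalization.lift (S := O) hunit
  have hφ : ∀ x : κ[X], φ (algebraMap κ[X] O x) = AdjoinRoot.mk p x := IsLocalization.lift_eq hunit
  refine ⟨O, φ, isIntegrallyClosed_of_isLocalization O (Ideal.span {p}).primeCompl hle, hφ,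
    fun y a s hs hy => ⟨a, s, (hmem s).2 hs, ?_⟩, fun y hy => ?_⟩
  · refine (eq_mul_inv_iff_mul_eq₀ ?_).2 hy
    rw [Ne, map_eq_zero_iff _ (IsFractionRing.injective κ[X] k)]
    rintro rfl
    exact hs (dvd_zero p)
  · obtain ⟨⟨a, s⟩, has⟩ := IsLocalization.surj (Ideal.span {p}).primeCompl y
    have ha : ¬ p ∣ a := by
      rw [← AdjoinRoot.mk_eq_zero, ← hφ, ← has, map_mul, hφ]
      exact mul_ne_zero hy (hunit s).ne_zero
    have : IsUnit (algebraMap κ[X] O a) :=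
      IsLocalization.map_units O (⟨a, (hmem a).2 ha⟩ : (Ideal.span {p}).primeCompl)
    rw [← has] at this
    exact isUnit_of_mul_isUnit_left this

/-- As `u` is a unit, `x = r(η)` with `r` over `O`. The minimal polynomial of `η` divides `μ ∘ r`,
so the reduction of `r` at `m` is a root of `μ`. -/
theorem IsUnramifiedGenerator.exists_eval_map_eq_zero {O k F M : Type*} [CommRing O] [IsDomain O]
    [IsIntegrallyClosed O] [Field k] [Algebra O k] [IsFractionRing O k] [Field F] [Algebra O F]
    [Algebra k F] [IsScalarTower O k F] [FiniteDimensional k F] [Algebra.IsSeparable k F] [Field M]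
    {η : F} {u : O} (hη : IsUnramifiedGenerator O k η u) (hu : IsUnit u) (φ : O →+* M) {m : M}
    (hm : ((minpoly O η).map φ).eval m = 0) {x : F} {μ : O[X]} (hμ : μ.Monic)
    (hx : aeval x μ = 0) : ∃ m' : M, (μ.map φ).eval m' = 0 := by
  obtain ⟨v, rfl⟩ := hu
  obtain ⟨q, hq⟩ := hη.exists_smul_eq_aeval (x := x) ⟨μ, hμ, hx⟩
  have hxq : x = aeval η (C ((v⁻¹ : Oˣ) : O) * q) := by
    rw [map_mul, aeval_C, ← hq, ← Algebra.smul_def, smul_smul, Units.inv_mul, one_smul]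
  set r := C ((v⁻¹ : Oˣ) : O) * q
  have h1 : aeval η (μ.comp r) = 0 := by rw [aeval_comp, ← hxq, hx]
  have : Module.IsTorsionFree O F := Module.isTorsionFree_iff_algebraMap_injective.2 (by
    rw [IsScalarTower.algebraMap_eq O k F]
    exact (algebraMap k F).injective.comp (IsFractionRing.injective O k))
  obtain ⟨c, hc⟩ := minpoly.isIntegrallyClosed_dvd hη.isIntegral h1
  refine ⟨(r.map φ).eval m, ?_⟩
  rw [← eval_comp, ← Polynomial.map_comp, hc, Polynomial.map_mul, eval_mul, hm, zero_mul]

theorem IsUnramifiedGenerator.map_algebraMap {R₀ R K E : Type*} [CommRing R₀] [IsDomain R₀]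
    [IsIntegrallyClosed R₀] [CommRing R] [IsDomain R] [IsIntegrallyClosed R] [Algebra R₀ R]
    [Field K] [Algebra R₀ K] [IsFractionRing R₀ K] [Algebra R K] [IsFractionRing R K]
    [IsScalarTower R₀ R K] [Field E] [Algebra K E] [Algebra R₀ E] [IsScalarTower R₀ K E]
    [Algebra R E] [IsScalarTower R K E] {η : E} {u : R₀} (hη : IsUnramifiedGenerator R₀ K η u) :
    minpoly R η = (minpoly R₀ η).map (algebraMap R₀ R) ∧
      IsUnramifiedGenerator R K η (algebraMap R₀ R u) := by
  have : IsScalarTower R₀ R E := IsScalarTower.of_algebraMap_eq fun x => by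
    rw [IsScalarTower.algebraMap_apply R K E, ← IsScalarTower.algebraMap_apply R₀ R K,
      ← IsScalarTower.algebraMap_apply R₀ K E]
  have hint : IsIntegral R η := hη.isIntegral.tower_top
  have hmin : minpoly R η = (minpoly R₀ η).map (algebraMap R₀ R) := by
    refine map_injective _ (IsFractionRing.injective R K) ?_
    rw [map_map, ← IsScalarTower.algebraMap_eq,
      ← minpoly.isIntegrallyClosed_eq_field_fractions' K hint,
      ← minpoly.isIntegrallyClosed_eq_field_fractions' K hη.isIntegral]
  obtain ⟨a, b, hab⟩ := hη.bezout
  refine ⟨hmin, hint, hη.adjoin_eq_top, a.map (algebraMap R₀ R), b.map (algebraMap R₀ R), ?_⟩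
  rw [hmin, derivative_map, ← Polynomial.map_mul, ← Polynomial.map_mul, ← Polynomial.map_add, hab,
    map_C]

section RationalFunctions

attribute [local instance] MvPolynomial.algebraMvPolynomial

variable {κ k : Type*} [Field κ] [Field k] [Algebra κ[X] k] [IsFractionRing κ[X] k] {n : ℕ}
  {E : Type*} [Field E] [Algebra k E] [Algebra (PolyRing n k) E] [Algebra (FunField n k) E]
  [IsScalarTower k (PolyRing n k) E] [IsScalarTower (PolyRing n k) (FunField n k) E]
  [FiniteDimensional (FunField n k) E] [Algebra.IsSeparable (FunField n k) E]
  [Algebra (MvPolynomial (Fin n) κ[X]) E]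
  [IsScalarTower (MvPolynomial (Fin n) κ[X]) (FunField n k) E]

/-- The constants of a specialization at a point that is close to `t₀` at the prime `p` have
conjugates in a fixed extension of the residue field of `p`. -/
theorem IsGoodSpecialization.exists_eval₂_eq_zero {Ω : Type*} [Field Ω] [Algebra (PolyRing n k) Ω]
    {t : Fin n → k} {P : IdealAbove E t} (hP : IsGoodSpecialization Ω P) {η : E}
    {u : MvPolynomial (Fin n) κ[X]}
    (hη : IsUnramifiedGenerator (MvPolynomial (Fin n) κ[X]) (FunField n k) η u) {p : κ[X]}
    (hp : Irreducible p) {t₀ : Fin n → κ[X]}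
    (ht : ∀ i, ∃ s w : κ[X], p ∣ w - 1 ∧
      (t i - algebraMap κ[X] k (t₀ i)) * algebraMap κ[X] k w = algebraMap κ[X] k (p * s))
    (hu : ¬ p ∣ MvPolynomial.eval t₀ u) {M : Type*} [Field M] (φ : AdjoinRoot p →+* M) {m : M}
    (hm : ((minpoly (MvPolynomial (Fin n) κ[X]) η).map
      ((φ.comp (AdjoinRoot.mk p)).comp (MvPolynomial.eval t₀))).eval m = 0)
    {x : P.residueField} {μ : κ[X]} (hμ : μ.Monic)
    (hx : μ.eval₂ ((algebraMap k P.residueField).comp (ratConst κ k)) x = 0) :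
    ∃ m' : M, μ.eval₂ (φ.comp (AdjoinRoot.of p)) m' = 0 := by
  have : Fact (Irreducible p) := ⟨hp⟩
  have := isFractionRing_mvPolynomial_funField κ k n
  have := hP.finiteDimensional
  have := hP.isSeparable
  obtain ⟨O, red, hO, hred, hmem, hunit⟩ := exists_residue_subalgebra k hp
  choose s w hw hsw using ht
  have hmkw : ∀ i, AdjoinRoot.mk p (w i) = 1 := fun i => by
    rw [← sub_eq_zero, ← map_one (AdjoinRoot.mk p), ← map_sub, AdjoinRoot.mk_eq_zero]
    exact hw i
  have hpw : ∀ i, ¬ p ∣ w i := fun i h => by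
    have := hmkw i
    rw [AdjoinRoot.mk_eq_zero.2 h] at this
    exact zero_ne_one this
  have hd : ∀ i, t i - algebraMap κ[X] k (t₀ i) ∈ O := fun i => hmem _ _ _ (hpw i) (hsw i)
  -- `τ` is `t` as a point over the local ring `O`. It reduces to `t₀` modulo `p` because `w i ≡ 1`,
  -- so evaluation at `t` followed by reduction is evaluation at `t₀`.
  let τ : Fin n → O := fun i => ⟨_, hd i⟩ + algebraMap κ[X] O (t₀ i)
  have hτ : ∀ i, (τ i : k) = t i := fun i => by
    change t i - algebraMap κ[X] k (t₀ i) + algebraMap κ[X] k (t₀ i) = t i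
    ring
  have hredτ : ∀ i, red (τ i) = AdjoinRoot.mk p (t₀ i) := fun i => by
    have h1 : (⟨_, hd i⟩ : O) * algebraMap κ[X] O (w i) = algebraMap κ[X] O (p * s i) :=
      Subtype.ext (hsw i)
    have h2 := congrArg red h1
    rw [map_mul, hred, hred, hmkw, mul_one, AdjoinRoot.mk_eq_zero.2 (dvd_mul_right p _)] at h2
    rw [map_add, h2, hred, zero_add]
  let ev : MvPolynomial (Fin n) κ[X] →+* O := MvPolynomial.eval₂Hom (algebraMap κ[X] O) τ
  have hev : (algebraMap O k).comp ev =
      (MvPolynomial.eval t).comp (algebraMap (MvPolynomial (Fin n) κ[X]) (PolyRing n k)) := by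
    refine MvPolynomial.ringHom_ext (fun c => ?_) fun i => ?_
    · simp only [ev, RingHom.comp_apply, MvPolynomial.coe_eval₂Hom, MvPolynomial.eval₂_C,
        MvPolynomial.algebraMap_def, MvPolynomial.map_C, MvPolynomial.eval_C]
      rfl
    · simp only [ev, RingHom.comp_apply, MvPolynomial.coe_eval₂Hom, MvPolynomial.eval₂_X,
        MvPolynomial.algebraMap_def, MvPolynomial.map_X, MvPolynomial.eval_X]
      exact hτ i
  have hredev : red.comp ev = (AdjoinRoot.mk p).comp (MvPolynomial.eval t₀) := by
    refine MvPolynomial.ringHom_ext (fun c => ?_) fun i => ?_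
    · simp [ev, hred]
    · simp [ev, hredτ]
  have hredu : red (ev u) ≠ 0 := by
    rw [← RingHom.comp_apply, hredev, RingHom.comp_apply, Ne, AdjoinRoot.mk_eq_zero]
    exact hu
  obtain ⟨hmin, hηR⟩ := hη.map_algebraMap (R := PolyRing n k)
  have hevu : MvPolynomial.eval t (algebraMap (MvPolynomial (Fin n) κ[X]) (PolyRing n k) u) ≠ 0 := by
    rw [← RingHom.comp_apply, ← hev, RingHom.comp_apply, Ne,
      map_eq_zero_iff _ (IsFractionRing.injective O k)]
    rintro h
    rw [h, map_zero] at hredu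
    exact hredu rfl
  have hirr := hP.irreducible_map η _ hηR hevu
  lift η to integralClosure (PolyRing n k) E using hηR.isIntegral
  have hψ := idealAbove_map_algebraMap P
  have hroot := aeval_minpoly_map_eq_zero hψ η
  have hmon : ((minpoly (MvPolynomial (Fin n) κ[X]) (η : E)).map ev).Monic :=
    (minpoly.monic hη.isIntegral).map ev
  have hmaps : ((minpoly (MvPolynomial (Fin n) κ[X]) (η : E)).map ev).map (algebraMap O k) =
      (minpoly (PolyRing n k) (η : E)).map (MvPolynomial.eval t) := by
    rw [map_map, hev, ← map_map, ← hmin]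
  set y := algebraMap (integralClosure (PolyRing n k) E) P.residueField η
  have hyint : IsIntegral O y := ⟨_, hmon, by
    rw [← aeval_def, ← aeval_map_algebraMap k, hmaps]
    exact hroot⟩
  -- Irreducibility at `t` identifies the minimal polynomial of `y` over `O`. The residue field thus
  -- has an unramified generator over `O` with unit constant `ev u`, and its reduction modulo `p` is
  -- the specialization at `t₀`.
  have hminy : minpoly O y = (minpoly (MvPolynomial (Fin n) κ[X]) (η : E)).map ev := by
    refine map_injective _ (IsFractionRing.injective O k) ?_
    rw [hmaps, ← minpoly.isIntegrallyClosed_eq_field_fractions' k hyint]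
    exact (minpoly.eq_of_irreducible_of_monic hirr hroot
      ((minpoly.monic hηR.isIntegral).map _)).symm
  obtain ⟨a, b, hab⟩ := hη.bezout
  have hy : IsUnramifiedGenerator O k y (ev u) :=
    ⟨hyint, hηR.adjoin_map_eq_top hψ hevu (idealAbove_algebraMap_surjective P), a.map ev, b.map ev,
      by rw [hminy, derivative_map, ← Polynomial.map_mul, ← Polynomial.map_mul,
        ← Polynomial.map_add, hab, map_C]⟩
  have hOk : (algebraMap O P.residueField).comp ((algebraMap κ[X] O).comp C) =
      (algebraMap k P.residueField).comp (ratConst κ k) := rfl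
  obtain ⟨m', hm'⟩ := hy.exists_eval_map_eq_zero (hunit _ hredu) (φ.comp red) (m := m) (by
      rw [hminy, map_map, RingHom.comp_assoc, hredev, ← RingHom.comp_assoc]
      exact hm) (x := x) (hμ.map ((algebraMap κ[X] O).comp C)) (by
      rw [aeval_def, eval₂_map, hOk, hx])
  refine ⟨m', ?_⟩
  rw [map_map, eval_map] at hm'
  convert hm' using 2
  refine RingHom.ext fun c => ?_
  exact congrArg φ (hred (C c)).symm

end RationalFunctions

/-- Euclid's argument: a prime factor of `X d + 1` cannot divide `d`. -/
theorem exists_irreducible_not_dvd {κ : Type*} [Field κ] {d : κ[X]} (hd : d ≠ 0) :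
    ∃ p : κ[X], Irreducible p ∧ ¬ p ∣ d := by
  have h0 : (X * d + 1).natDegree ≠ 0 := by
    rw [← C_1, natDegree_add_C, natDegree_X_mul hd]
    exact Nat.succ_ne_zero _
  obtain ⟨p, hp, hpd⟩ := WfDvdMonoid.exists_irreducible_factor
    (fun h => h0 (natDegree_eq_zero_of_isUnit h)) (fun h => h0 (by rw [h, natDegree_zero]))
  exact ⟨p, hp, fun h => hp.not_isUnit
    (isUnit_of_dvd_one ((_root_.dvd_add_right (h.mul_left X)).1 hpd))⟩

/-! ### The constants of a specialization -/

section Constants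

attribute [local instance] MvPolynomial.algebraMvPolynomial

variable {n : ℕ} {k : Type*} [Field k] {E : Type*} [Field E] [Algebra k E]
  [Algebra (PolyRing n k) E] [Algebra (FunField n k) E] [IsScalarTower k (PolyRing n k) E]
  [IsScalarTower (PolyRing n k) (FunField n k) E]

/-- A separable polynomial over the field of constants that has a root in the residue field and
splits in `Ω` has a root in `E` with the same residue. -/
theorem IsGoodSpecialization.exists_root_of_separable {κ : Type*} [Field κ] (i : κ →+* k)
    {Ω : Type*} [Field Ω] [Algebra (PolyRing n k) Ω] {t : Fin n → k} {P : IdealAbove E t}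
    (hP : IsGoodSpecialization Ω P) {μ : κ[X]} (hm : μ.Monic) (hsep : μ.Separable)
    (hs : (μ.map ((algebraMap (PolyRing n k) Ω).comp (MvPolynomial.C.comp i))).Splits)
    {x : P.residueField} (hx : μ.eval₂ ((algebraMap k P.residueField).comp i) x = 0) :
    ∃ y : integralClosure (PolyRing n k) E,
      μ.eval₂ ((algebraMap k E).comp i) y = 0 ∧ algebraMap _ P.residueField y = x := by
  obtain ⟨a, b, hab⟩ := hsep
  have hab' := congrArg (Polynomial.map ((MvPolynomial.C (σ := Fin n)).comp i)) hab
  rw [Polynomial.map_add, Polynomial.map_mul, Polynomial.map_mul, ← derivative_map,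
    Polynomial.map_one, ← C_1] at hab'
  obtain ⟨y, hy, hyx⟩ := hP.exists_root (μ.map (MvPolynomial.C.comp i)) _ _ 1 (hm.map _)
    (by rwa [map_map]) hab' (by rw [map_one]; exact one_ne_zero) x (by
      have : (MvPolynomial.eval t).comp (MvPolynomial.C.comp i) = i :=
        RingHom.ext fun c => MvPolynomial.eval_C _
      rwa [map_map, this, aeval_def, eval₂_map])
  refine ⟨y, ?_, hyx⟩
  rw [aeval_integralClosure_eq_zero_iff, aeval_def, eval₂_map] at hy
  convert hy using 2
  rw [IsScalarTower.algebraMap_eq k (PolyRing n k) E]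
  rfl

/-- The order of choices matters: `η`, `t₀` and `p` determine `M`, then `M` determines `f`, and `Ω`
must split `f` before `t` is chosen close to `t₀`. The minimal polynomial over `κ` of a constant of
the residue field then has a root in `M`, so it splits in `Ω` and the constant lifts to `E`. -/
theorem exists_specialization_algebraicElements [FiniteDimensional (FunField n k) E]
    [Algebra.IsSeparable (FunField n k) E] (κ : Type*) [Field κ] [Algebra κ[X] k]
    [IsFractionRing κ[X] k] :
    ∃ (Ω : IntermediateField (FunField n k) (AlgebraicClosure E)) (t : Fin n → k)
      (P : IdealAbove E t), P.IsSpecialization ∧ IsGoodSpecialization Ω P ∧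
      ∀ x ∈ algebraicElements ((algebraMap k P.residueField).comp (ratConst κ k)),
        ∃ y : integralClosure (PolyRing n k) E,
          (y : E) ∈ algebraicElements ((algebraMap k E).comp (ratConst κ k)) ∧
          algebraMap _ P.residueField y = x := by
  let _ : Algebra (MvPolynomial (Fin n) κ[X]) E := ((algebraMap (FunField n k) E).comp
    (algebraMap (MvPolynomial (Fin n) κ[X]) (FunField n k))).toAlgebra
  have : IsScalarTower (MvPolynomial (Fin n) κ[X]) (FunField n k) E :=
    IsScalarTower.of_algebraMap_eq fun _ => rfl
  have := isFractionRing_mvPolynomial_funField κ k n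
  obtain ⟨η, u, hu, hη⟩ :=
    exists_isUnramifiedGenerator (MvPolynomial (Fin n) κ[X]) (FunField n k) E
  -- Such a point exists even over a finite `κ`, because `κ[X]` is infinite.
  obtain ⟨t₀, ht₀⟩ : ∃ t₀ : Fin n → κ[X], MvPolynomial.eval t₀ u ≠ 0 := by
    by_contra! h
    exact hu (MvPolynomial.funext fun t => by rw [h t, map_zero])
  obtain ⟨p, hp, hpu⟩ := exists_irreducible_not_dvd ht₀
  have : Fact (Irreducible p) := ⟨hp⟩
  let hbar : (AdjoinRoot p)[X] := (minpoly (MvPolynomial (Fin n) κ[X]) η).map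
    ((AdjoinRoot.mk p).comp (MvPolynomial.eval t₀))
  let M := hbar.SplittingField
  obtain ⟨m, hm⟩ := (SplittingField.splits hbar).exists_eval_eq_zero (by
    rw [degree_map, (minpoly.monic hη.isIntegral).degree_map]
    exact (minpoly.degree_pos hη.isIntegral).ne')
  have : Module.Finite κ (AdjoinRoot p) := (AdjoinRoot.powerBasis hp.ne_zero).finite
  have : Module.Finite κ M := Module.Finite.trans (AdjoinRoot p) M
  obtain ⟨f, hf, hfsplit⟩ := exists_separable_splits_of_root κ M
  obtain ⟨Ω, hNΩ, hfd, hgal, hfΩ⟩ := exists_isGalois_splits (E := E)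
    (hf.map (f := (algebraMap k (FunField n k)).comp (ratConst κ k)))
  let _ : Algebra (GalClosure n k E) Ω := (IntermediateField.inclusion hNΩ).toRingHom.toAlgebra
  have : IsScalarTower (FunField n k) (GalClosure n k E) Ω :=
    IsScalarTower.of_algebraMap_eq fun _ => rfl
  let _ : Algebra E Ω :=
    ((algebraMap (GalClosure n k E) Ω).comp (algebraMap E (GalClosure n k E))).toAlgebra
  have : IsScalarTower (FunField n k) E Ω := IsScalarTower.of_algebraMap_eq fun a => by
    rw [IsScalarTower.algebraMap_apply _ (GalClosure n k E) Ω,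
      IsScalarTower.algebraMap_apply _ E (GalClosure n k E)]
    rfl
  have hkΩ : IsScalarTower k (PolyRing n k) Ω :=
    ⟨fun a p x => Subtype.ext (smul_assoc a p (x : AlgebraicClosure E))⟩
  have hRΩ : IsScalarTower (PolyRing n k) (FunField n k) Ω :=
    ⟨fun a p x => Subtype.ext (smul_assoc a p (x : AlgebraicClosure E))⟩
  obtain ⟨h, g, hmon, hirr, hsep, hg, hspec⟩ :=
    exists_specialization_polynomial (n := n) (k := k) (E := E) Ω
  obtain ⟨t, htg, htirr, ht⟩ := exists_irreducible_specialization_of_ratFunc κ k p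
    hp.natDegree_pos.ne' n t₀ hmon hirr hsep hg
  obtain ⟨P, hP, hPΩ⟩ := hspec t htg htirr
  refine ⟨Ω, t, P, hP, hPΩ, fun x ⟨q, hq0, hqx⟩ => ?_⟩
  have := hPΩ.isSeparable
  let _ : Algebra κ P.residueField := ((algebraMap k P.residueField).comp (ratConst κ k)).toAlgebra
  have hxint : IsIntegral κ x := IsAlgebraic.isIntegral ⟨q, hq0, hqx⟩
  have hμx : (minpoly κ x).eval₂ ((algebraMap k P.residueField).comp (ratConst κ k)) x = 0 :=
    minpoly.aeval κ x
  have hμm := minpoly.monic hxint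
  have hμirr := minpoly.irreducible hxint
  -- The minimal polynomial over `κ` stays irreducible over `k`, so it is also the minimal
  -- polynomial over `k`, and the residue field is separable over `k`.
  have hμsep : (minpoly κ x).Separable := by
    rw [← separable_map (ratConst κ k), minpoly.eq_of_irreducible_of_monic
      (irreducible_map_ratConst k hμm hμirr) (x := x) (by rwa [aeval_def, eval₂_map]) (hμm.map _)]
    exact Algebra.IsSeparable.isSeparable k x
  obtain ⟨m', hm'⟩ := hPΩ.exists_eval₂_eq_zero hη hp ht hpu (algebraMap (AdjoinRoot p) M) (m := m)
    (by rw [RingHom.comp_assoc, ← map_map]; exact hm) hμm hμx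
  let _ : Algebra κ Ω := ((algebraMap (FunField n k) Ω).comp
    ((algebraMap k (FunField n k)).comp (ratConst κ k))).toAlgebra
  have hμΩ := hfsplit Ω (by rwa [map_map] at hfΩ) _ hμm hμirr hμsep ⟨m', by
    rw [aeval_def, IsScalarTower.algebraMap_eq κ (AdjoinRoot p) M]
    exact hm'⟩
  obtain ⟨y, hy, hyx⟩ := hPΩ.exists_root_of_separable (ratConst κ k) hμm hμsep (by
    convert hμΩ using 2
    rw [IsScalarTower.algebraMap_eq (PolyRing n k) (FunField n k) Ω]
    rfl) hμx
  exact ⟨y, ⟨_, hμm.ne_zero, hy⟩, hyx⟩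

end Constants

end HilbertIrreducibility

end

open EmbeddingProblem in
/-- Let `α : G → Aut(L/k)` be a finite embedding problem over `k` and suppose that `α_{k(T)}` has a
solution with solution field `E`, where `T = (T_1, …, T_n)` with `n ≥ 1`.
(1) If `k` is Hilbertian, then for every `t` in some Zariski-dense subset of `k^n`, the
specialization `E_t` is the solution field of a solution to `α`.
(2) If `k = κ(T)` and `E ∩ κ̄ = L ∩ κ̄`, then there is `t ∈ k^n` such that `E_t` is the solution
field of a regular solution to `α`. -/
theorem proposition3p1
    {k L G E : Type*} [Field k] [Field L] [Algebra k L] [Algebra.IsAlgebraic k L] [Group G]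
    (α : G →* (L ≃ₐ[k] L)) (hα : IsFiniteEmbeddingProblem α)
    (n : ℕ) (hn : 1 ≤ n)
    [Field E] [Algebra k E] [Algebra (PolyRing n k) E] [Algebra (FunField n k) E]
    [IsScalarTower k (PolyRing n k) E] [IsScalarTower (PolyRing n k) (FunField n k) E]
    (ι : FunField n L →ₐ[FunField n k] E)
    (hE : ∃ β : (E ≃ₐ[FunField n k] E) ≃* G, IsSolution (baseChange n α) ι β) :
    (IsHilbertian k →
      ∃ S : Set (Fin n → k), IsZariskiDense S ∧ ∀ t ∈ S,
        ∃ P : IdealAbove E t, P.IsSpecialization ∧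
          ∃ β : (P.residueField ≃ₐ[k] P.residueField) ≃* G,
            IsSolution α (P.embed (constEmbedding ι)) β) ∧
    (∀ (κ : Type*) [Field κ] [Algebra (Polynomial κ) k] [IsFractionRing (Polynomial κ) k],
      SameConstants ((algebraMap k L).comp (ratConst κ k)) (constEmbedding ι : L →+* E) →
      ∃ t : Fin n → k, ∃ P : IdealAbove E t, P.IsSpecialization ∧
        ∃ β : (P.residueField ≃ₐ[k] P.residueField) ≃* G,
          IsRegularSolution κ α (P.embed (constEmbedding ι)) β) := by
  obtain ⟨β, hβ⟩ := hE
  have := hβ.finiteDimensional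
  have := hβ.isSeparable
  refine ⟨fun hk => ?_, fun κ _ _ _ hκ => ?_⟩
  · obtain ⟨S, hS, hSt⟩ :=
      HilbertIrreducibility.exists_isZariskiDense_of_isHilbertian (n := n) (E := E) hk
    refine ⟨S, hS, fun t ht => ?_⟩
    obtain ⟨P, hP, hPg⟩ := hSt t ht
    exact ⟨P, hP, hPg.exists_isSolution hβ⟩
  · obtain ⟨Ω, t, P, hP, hPΩ, hPκ⟩ :=
      HilbertIrreducibility.exists_specialization_algebraicElements (n := n) (k := k) (E := E) κ
    obtain ⟨β', hβ'⟩ := hPΩ.exists_isSolution hβ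
    refine ⟨t, P, hP, β', hβ', Set.Subset.antisymm ?_ ?_⟩
    -- A constant of the specialization lifts to a constant of `E`, which comes from `L` by
    -- hypothesis.
    · rw [← RingHom.comp_assoc, AlgHom.comp_algebraMap]
      intro x hx
      obtain ⟨y, hy, rfl⟩ := hPκ x hx
      rw [SameConstants, ← RingHom.comp_assoc, AlgHom.comp_algebraMap] at hκ
      rw [hκ] at hy
      obtain ⟨l, hl, hly⟩ := hy
      exact ⟨l, hl, congrArg (algebraMap (integralClosure (PolyRing n k) E) P.residueField)
        (Subtype.ext hly)⟩
    · rintro _ ⟨l, ⟨q, hq, hql⟩, rfl⟩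
      exact ⟨q, hq, by rw [← hom_eval₂, hql, map_zero]⟩
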